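/- Let $\mathbb T^3=\mathbb R^3/\mathbb Z^3$, $T>0$, $\kappa_1>\kappa_0>0$, $\tau>0$ and $\kappa:=\kappa_0+\kappa_1$. Let $u:\mathbb T^3\times[0,T]\to\mathbb R^3$ be smooth with $\operatorname{div}u=0$, and let $\eta=\eta(x,t,s)\ge 0$ be smooth on $\mathbb T^3\times[0,T]\times\mathbb R$, $1$-periodic in $s$, with $\int_0^1\eta(x,t,s)\,ds=1$ for all $(x,t)$. Set $\tilde\kappa(x,t):=\kappa_0+\kappa_1\,\eta(x,t,t/\tau)$. For $\rho_{in}\in L^2(\mathbb T^3)$ let $\rho,\bar\rho\in C([0,T];L^2(\mathbb T^3))$ be the solutions (smooth for $0<t<T$) of $$\partial_t\rho+u\cdot\nabla\rho=\operatorname{div}(\tilde\kappa\nabla\rho),\qquad \partial_t\bar\rho+u\cdot\nabla\bar\rho=\operatorname{div}(\kappa\nabla\bar\rho),\qquad \rho|_{t=0}=\bar\rho|_{t=0}=\rho_{in},$$ with total dissipations $$\tilde D:=\int_0^T\|\tilde\kappa^{1/2}\nabla\rho\|_{L^2}^2\,dt,\qquad D:=\kappa\int_0^T\|\nabla\bar\rho\|_{L^2}^2\,dt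 .$$ Let $N\in\mathbb N$, $C_N\in\mathbb R$ and $\mu\ge\|\nabla u\|_{L^\infty(\mathbb T^3\times[0,T])}$ be such that (A1) $\tau\mu<\tfrac12$ and $(\tau\mu)^{N-1}\kappa<\kappa_0$; (A2) $\|\nabla u\|_{C^n}^2\le C_N\left(\frac{\mu}{\kappa}\right)^n\mu^2$ for all $0\le n\le N$ (spatial derivatives, supremum over $x$ and $t$); (A3) $\|\rho_{in}\|_{H^n}^2\le C_N\left(\frac{\mu}{\kappa}\right)^nD$ for all $1\le n\le N$; (A4) $\|\nabla_x^n\eta\|_{L^\infty}\le C_N(\tau\mu)^2\left(\frac{\mu}{\kappa}\right)^{n/2}$ for all $1\le n\le N$, and $\|\partial_t\eta+u\cdot\nabla_x\eta\|_{L^\infty}\le C_N\mu$, where $\partial_t$ and $\nabla_x$ act with the fast variable $s$ fixed and the suprema are over $(x,t,s)$. Then $D$ and $\tilde D$ are finite, and $$\sup_{t\le T}\|\rho(t)-\bar\rho(t)\|_{L^2}^2+\kappa\int_0^T\|\nabla\rho-\nabla\bar\rho\|_{L^2}^2\,dt\le C(\tau\mu)^2D,$$ $$|D-\tilde D|\le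 C\,\tau\mu\,(D+\tilde D),$$ where the constant $C$ depends only on $N$, $C_N$ and (an upper bound for) $\|\eta\|_{L^\infty}$. -/

import Mathlib

open MeasureTheory Set Filter Topology
open scoped ENNReal ContDiff

noncomputable section

namespace TimeAveraging

/-- The Euclidean space `ℝ³`. Functions on the flat torus `𝕋³ = ℝ³/ℤ³` are represented by
`ℤ³`-periodic functions on it. -/
abbrev E3 : Type := EuclideanSpace ℝ (Fin 3)

/-- `ℤ³`-periodicity. -/
def IsPeriodic {F : Type*} (f : E3 → F) : Prop :=
  ∀ (i : Fin 3) (x : E3), f (x + EuclideanSpace.single i 1) = f x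

/-- A fundamental domain of the torus. -/
def unitCube : Set E3 := {x | ∀ i, x i ∈ Ico (0 : ℝ) 1}

/-- Lebesgue measure on the fundamental domain, i.e. the (normalized) volume of the torus. -/
def torusMeasure : Measure E3 := volume.restrict unitCube

/-- `‖f‖²_{L²(𝕋³)}`. -/
def l2Sq (f : E3 → ℝ) : ℝ≥0∞ := ∫⁻ x, ‖f x‖ₑ ^ 2 ∂torusMeasure

/-- The Fourier coefficient `∫_{𝕋³} f(x) e^{-2πi k·x} dx`. -/
def fourierCoef (f : E3 → ℝ) (k : Fin 3 → ℤ) : ℂ :=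
  ∫ x, (f x : ℂ) * Complex.exp (-(2 * Real.pi * Complex.I * ∑ i, (k i : ℂ) * (x i : ℂ)))
    ∂torusMeasure

/-- `‖f‖²_{Hⁿ(𝕋³)} = ∑ₖ (1 + |2πk|²)ⁿ |f̂(k)|²`; for `f ∈ L²(𝕋³)` this is finite exactly when
`f ∈ Hⁿ(𝕋³)`. -/
def sobolevSq (n : ℕ) (f : E3 → ℝ) : ℝ≥0∞ :=
  ∑' k : Fin 3 → ℤ,
    ENNReal.ofReal ((1 + ∑ i, (2 * Real.pi * (k i : ℝ)) ^ 2) ^ n * ‖fourierCoef f k‖ ^ 2)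

/-- `‖v‖_{Cⁿ} = ∑_{j ≤ n} sup_{t ∈ [0,T], x} |∇ʲ v(t,x)|`, where the derivatives are spatial. -/
def cNorm {F : Type*} [NormedAddCommGroup F] [NormedSpace ℝ F] (T : ℝ) (n : ℕ)
    (v : ℝ → E3 → F) : ℝ≥0∞ :=
  ∑ j ∈ Finset.range (n + 1), ⨆ t ∈ Icc (0 : ℝ) T, ⨆ x : E3, ‖iteratedFDeriv ℝ j (v t) x‖ₑ

/-- The divergence of a vector field on `ℝ³`. -/
def divergence (v : E3 → E3) (x : E3) : ℝ :=
  ∑ i : Fin 3, (fderiv ℝ v x (EuclideanSpace.single i 1)) i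

/-- A smooth, periodic, divergence-free velocity field on `𝕋³ × [0,T]`. -/
structure IsVelocity (T : ℝ) (u : ℝ → E3 → E3) : Prop where
  smooth : ContDiffOn ℝ ∞ (fun p : ℝ × E3 => u p.1 p.2) (Icc (0 : ℝ) T ×ˢ univ)
  periodic : ∀ t ∈ Icc (0 : ℝ) T, IsPeriodic (u t)
  divFree : ∀ t ∈ Icc (0 : ℝ) T, ∀ x, divergence (u t) x = 0

/-- An oscillation profile `η(x,t,s)`, `(x,t,s) ∈ 𝕋³ × [0,T] × ℝ`: smooth, nonnegative,
`1`-periodic in the fast time `s` with mean `1` over a period. -/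
structure IsProfile (T : ℝ) (η : E3 → ℝ → ℝ → ℝ) : Prop where
  smooth : ContDiffOn ℝ ∞ (fun p : E3 × ℝ × ℝ => η p.1 p.2.1 p.2.2)
    (univ ×ˢ Icc (0 : ℝ) T ×ˢ univ)
  periodic : ∀ t ∈ Icc (0 : ℝ) T, ∀ s, IsPeriodic (fun x => η x t s)
  nonneg : ∀ t ∈ Icc (0 : ℝ) T, ∀ x s, 0 ≤ η x t s
  periodic_fast : ∀ t ∈ Icc (0 : ℝ) T, ∀ x, Function.Periodic (η x t) 1
  mean : ∀ t ∈ Icc (0 : ℝ) T, ∀ x, ∫ s in (0 : ℝ)..1, η x t s = 1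

/-- `‖∇ⁿ η‖_{L^∞}`: supremum over `x`, `t ∈ [0,T]` and the fast variable `s` of the `n`-th
derivative in `x`. For `n = 0` this is `‖η‖_{L^∞}`. -/
def profileSup (T : ℝ) (n : ℕ) (η : E3 → ℝ → ℝ → ℝ) : ℝ≥0∞ :=
  ⨆ t ∈ Icc (0 : ℝ) T, ⨆ (s : ℝ) (x : E3), ‖iteratedFDeriv ℝ n (fun y => η y t s) x‖ₑ

/-- The slow advective derivative `∂ₜη + u·∇η`, with the fast variable `s` kept fixed. -/
def slowDeriv (u : ℝ → E3 → E3) (η : E3 → ℝ → ℝ → ℝ) (x : E3) (t s : ℝ) : ℝ :=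
  deriv (fun r => η x r s) t + inner ℝ (u t x) (gradient (fun y => η y t s) x)

/-- The oscillating diffusivity `κ₀ + κ₁ η(x,t,t/τ)`. -/
def oscDiffusivity (κ₀ κ₁ τ : ℝ) (η : E3 → ℝ → ℝ → ℝ) (t : ℝ) (x : E3) : ℝ :=
  κ₀ + κ₁ * η x t (t / τ)

/-- `ρ` is the solution on `𝕋³ × [0,T]` of `∂ₜρ + u·∇ρ = div(a∇ρ)`, `ρ|_{t=0} = ρin`, for an
initial datum `ρin ∈ L²(𝕋³)`: `ρ ∈ C([0,T]; L²(𝕋³))` attains the datum in `L²`, and, as is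
automatic from parabolic regularity when the coefficients are smooth and `a` is positive, it is
smooth for positive times and satisfies the equation there pointwise. -/
structure IsSolution (T : ℝ) (u : ℝ → E3 → E3) (a : ℝ → E3 → ℝ) (ρin : E3 → ℝ)
    (ρ : ℝ → E3 → ℝ) : Prop where
  smooth : ContDiffOn ℝ ∞ (fun p : ℝ × E3 => ρ p.1 p.2) (Ioo (0 : ℝ) T ×ˢ univ)
  periodic : ∀ t ∈ Ioo (0 : ℝ) T, IsPeriodic (ρ t)
  memL2 : ∀ t ∈ Icc (0 : ℝ) T, MemLp (ρ t) 2 torusMeasure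
  continuous : ∀ t ∈ Icc (0 : ℝ) T,
    Tendsto (fun s => l2Sq (fun x => ρ s x - ρ t x)) (𝓝[Icc (0 : ℝ) T] t) (𝓝 0)
  initial : ρ 0 =ᵐ[torusMeasure] ρin
  equation : ∀ t ∈ Ioo (0 : ℝ) T, ∀ x,
    deriv (fun r => ρ r x) t + inner ℝ (u t x) (gradient (ρ t) x)
      = divergence (fun y => a t y • gradient (ρ t) y) x

/-- The total dissipation `∫₀ᵀ ‖a^{1/2} ∇ρ‖²_{L²} dt`. -/
def dissipation (T : ℝ) (a : ℝ → E3 → ℝ) (ρ : ℝ → E3 → ℝ) : ℝ≥0∞ :=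
  ∫⁻ t in Ioo (0 : ℝ) T, ∫⁻ x, ENNReal.ofReal (a t x) * ‖gradient (ρ t) x‖ₑ ^ 2 ∂torusMeasure

/-- `∫₀ᵀ ‖∇ρ - ∇σ‖²_{L²} dt`. -/
def gradDistSq (T : ℝ) (ρ σ : ℝ → E3 → ℝ) : ℝ≥0∞ :=
  ∫⁻ t in Ioo (0 : ℝ) T, ∫⁻ x, ‖gradient (ρ t) x - gradient (σ t) x‖ₑ ^ 2 ∂torusMeasure

end TimeAveraging

end

noncomputable section

namespace TimeAveraging

/-! ### Integrals depending on parameters -/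

/-! Notation: `f` is ρbar, `w` is ρ - ρbar, `q` is η(x,t,t/τ), a = κ₀ + κ₁q, κ = κ₀ + κ₁, D_t = ∂ₜ +
u·∇, ν² = μ/κ and ε = τμ = τκν². Then D_t w = div(a∇w) + div(κ₁(q-1)∇f). The source has mean zero in
the fast time, so q - 1 has a bounded primitive A = 1 + ∫₀^{t/τ}(η-1)ds with 0 ≤ A ≤ 1 + ‖η‖_∞ and
D_t A = (q-1)/τ + O(μ). The corrector χ = div(τκ₁A∇f) satisfies D_t χ = div(κ₁(q-1)∇f) + div G with
G of order τ, so θ = w - χ is forced only by small fluxes (`matD_sub_corr`).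

The energy of θ dissipates only with weight a, which may drop to κ₀, far below κ. The remedy is to
add (τκ₁/2)∫A|∇w|². Its time derivative contains ½κ₁(q-1)|∇w|² = ½(a-κ)|∇w|², which exchanges part
of the oscillating dissipation for -½κ|∇w|². In the weighted gradient balance (`gradient_energy`)
integration by parts leaves, besides the source, a Hessian term of good sign (as A ≥ 0) and terms
quadratic in ∇w with coefficients O(κν²). After multiplication by τκ₁ these are O(εκ) and are
absorbed when ε is small (`deriv_corrected_energy_le`).

The forcing involves up to three derivatives of f. Since f has constant diffusivity, energy
estimates for ∇f and ∇²f show that each further derivative costs a factor ν (`regularity`), and the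
forcing integrates to O(ε²D) (`diff_bounds`). As the datum is attained only in L², initial values of
higher norms need separate arguments: for f through Fourier coefficients (`eventually_sobDens_le`),
for ∇w along a sequence of times tending to 0 (`frequently_gradSq_le`).

If ε is not small, ε^(N-1)κ < κ₀ bounds κ/κ₀ and the plain energy estimate suffices
(`diff_bounds_crude`).

For the dissipations, a|∇ρ|² - κ|∇f|² = a|∇w|² + 2a∇f·∇w + κ₁(q-1)|∇f|². The first two terms are
controlled by the first estimate. The last is, up to O(ε) errors after integration, τκ₁ d/dt∫A|∇f|²,
whose time integral is a boundary term of size εD (`abs_tinteg_dissipation_sub_le`). -/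

theorem hasFDerivAt_integral_of_continuousOn {X H F : Type*} [TopologicalSpace X]
    [MeasurableSpace X] [OpensMeasurableSpace X] [SecondCountableTopology X]
    [NormedAddCommGroup H] [NormedSpace ℝ H]
    [NormedAddCommGroup F] [NormedSpace ℝ F] [SecondCountableTopologyEither X F]
    [SecondCountableTopologyEither X (H →L[ℝ] F)]
    {ν : Measure X} [IsFiniteMeasure ν] {K : Set X} (hK : IsCompact K) (hν : ∀ᵐ x ∂ν, x ∈ K)
    {U : Set H} (hU : IsOpen U) {f : H → X → F} {f' : H → X → H →L[ℝ] F}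
    (hf : ∀ q ∈ U, Continuous (f q))
    (hd : ∀ q ∈ U, ∀ x, HasFDerivAt (fun q => f q x) (f' q x) q)
    (hf' : ContinuousOn (fun p : H × X => f' p.1 p.2) (U ×ˢ univ)) {q : H} (hq : q ∈ U) :
    HasFDerivAt (fun q => ∫ x, f q x ∂ν) (∫ x, f' q x ∂ν) q := by
  have hcont : ∀ q ∈ U, Continuous (f' q) := fun q hq => by
    have := hf'.comp_continuous (f := fun x : X => (q, x)) (by fun_prop) (fun x => ⟨hq, trivial⟩)
    exact this
  obtain ⟨C, hC⟩ := hK.exists_bound_of_continuousOn (hcont q hq).continuousOn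
  -- Joint continuity gives the bound `C + 1` near each `(q, x)`. Compactness of `K` then makes one
  -- neighbourhood of `q` serve every `x`, so a constant is a dominating function.
  have hev : ∀ᶠ q' in 𝓝 q, ∀ x ∈ K, ‖f' q' x‖ ≤ C + 1 := by
    refine hK.eventually_forall_of_forall_eventually fun x hx => ?_
    have h1 : ContinuousAt (fun p : H × X => f' p.1 p.2) (q, x) :=
      hf'.continuousAt ((hU.prod isOpen_univ).mem_nhds ⟨hq, trivial⟩)
    have h2 : ∀ᶠ p in 𝓝 (q, x), ‖f' p.1 p.2‖ < C + 1 :=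
      h1.norm.eventually_lt_const (by simpa using (hC x hx).trans_lt (lt_add_one C))
    exact h2.mono fun p hp => hp.le
  have hint : Integrable (f q) ν := by
    obtain ⟨C', hC'⟩ := hK.exists_bound_of_continuousOn (hf q hq).continuousOn
    exact Integrable.of_bound (hf q hq).aestronglyMeasurable C' (hν.mono hC')
  refine hasFDerivAt_integral_of_dominated_of_fderiv_le (bound := fun _ => C + 1)
    (s := {q' | q' ∈ U ∧ ∀ x ∈ K, ‖f' q' x‖ ≤ C + 1}) ?_ ?_ hint
    (hcont q hq).aestronglyMeasurable ?_ (integrable_const _) ?_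
  · exact (show ∀ᶠ q' in 𝓝 q, q' ∈ U from hU.mem_nhds hq).and hev
  · filter_upwards [hU.mem_nhds hq] with q' hq' using (hf q' hq').aestronglyMeasurable
  · filter_upwards [hν] with x hx q' hq' using hq'.2 x hx
  · exact Eventually.of_forall fun x q' hq' => hd q' hq'.1 x

/-! ### Integration over the torus -/

theorem closedCube_isCompact : IsCompact {x : E3 | ∀ i, x i ∈ Icc (0 : ℝ) 1} := by
  have h : IsCompact (Icc (0 : Fin 3 → ℝ) 1) := isCompact_Icc
  have h2 := h.image (PiLp.continuous_toLp 2 (fun _ : Fin 3 => ℝ))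
  convert h2 using 1
  ext x
  simp only [mem_ofPred_eq, mem_image, mem_Icc, Pi.le_def]
  constructor
  · intro hx
    exact ⟨x.ofLp, ⟨fun i => (hx i).1, fun i => (hx i).2⟩, rfl⟩
  · rintro ⟨y, ⟨h1, h2⟩, rfl⟩ i
    exact ⟨h1 i, h2 i⟩

theorem measurableSet_unitCube : MeasurableSet unitCube := by
  have : unitCube = ⋂ i, (fun x : E3 => x i) ⁻¹' Ico (0 : ℝ) 1 := by
    ext x; simp [unitCube]
  rw [this]
  refine MeasurableSet.iInter fun i => ?_
  exact measurableSet_Ico.preimage (by fun_prop)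

theorem ae_torusMeasure_mem : ∀ᵐ x ∂torusMeasure, x ∈ {x : E3 | ∀ i, x i ∈ Icc (0 : ℝ) 1} := by
  filter_upwards [ae_restrict_mem measurableSet_unitCube] with x hx i
  exact Ico_subset_Icc_self (hx i)

instance : IsFiniteMeasure torusMeasure := by
  refine ⟨?_⟩
  rw [torusMeasure, Measure.restrict_apply_univ]
  exact (measure_mono (fun x (hx : x ∈ unitCube) i => Ico_subset_Icc_self (hx i))).trans_lt
    closedCube_isCompact.measure_lt_top

theorem torusMeasure_map_ofLp :
    Measure.map WithLp.ofLp torusMeasure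
      = volume.restrict (Set.pi univ fun _ : Fin 3 => Ico (0 : ℝ) 1) := by
  have h := (PiLp.volume_preserving_ofLp (Fin 3)).restrict_preimage
    (s := Set.pi univ fun _ : Fin 3 => Ico (0 : ℝ) 1)
    (MeasurableSet.univ_pi fun _ => measurableSet_Ico)
  rw [← h.map_eq, torusMeasure]
  congr 2
  ext x; simp [unitCube]

theorem measurePreserving_ofLp_torusMeasure :
    MeasurePreserving (WithLp.ofLp : E3 → Fin 3 → ℝ) torusMeasure
      (volume.restrict (Set.pi univ fun _ : Fin 3 => Ico (0 : ℝ) 1)) :=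
  ⟨(PiLp.volume_preserving_ofLp (Fin 3)).measurable, torusMeasure_map_ofLp⟩

theorem integral_torusMeasure_eq {F : Type*} [NormedAddCommGroup F] [NormedSpace ℝ F]
    (f : E3 → F) :
    ∫ x, f x ∂torusMeasure
      = ∫ y in Set.pi univ (fun _ : Fin 3 => Ico (0 : ℝ) 1), f (WithLp.toLp 2 y) := by
  rw [← measurePreserving_ofLp_torusMeasure.integral_comp
    (MeasurableEquiv.toLp 2 (Fin 3 → ℝ)).symm.measurableEmbedding]

/-- Divergence theorem on the closed cube for the field whose only nonzero component is `f` in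
direction `i`. The integrals over the two opposite faces cancel by periodicity. -/
theorem integral_torusMeasure_partialDeriv_eq_zero {f : E3 → ℝ} (hf : ContDiff ℝ 1 f)
    (hper : IsPeriodic f) (i : Fin 3) :
    ∫ x, fderiv ℝ f x (EuclideanSpace.single i 1) ∂torusMeasure = 0 := by
  rw [integral_torusMeasure_eq, volume_pi,
    setIntegral_congr_set Measure.univ_pi_Ico_ae_eq_Icc, ← volume_pi]
  let L : (Fin 3 → ℝ) →L[ℝ] E3 :=
    ((PiLp.continuousLinearEquiv 2 ℝ (fun _ : Fin 3 => ℝ)).symm : (Fin 3 → ℝ) →L[ℝ] E3)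
  have hL : ∀ y, L y = WithLp.toLp 2 y := fun y => rfl
  let G : Fin 3 → (Fin 3 → ℝ) → ℝ := fun j y => if j = i then f (L y) else 0
  let G' : Fin 3 → (Fin 3 → ℝ) → (Fin 3 → ℝ) →L[ℝ] ℝ :=
    fun j y => if j = i then (fderiv ℝ f (L y)).comp L else 0
  have hfc : Continuous fun y => f (L y) := hf.continuous.comp L.continuous
  have hGc : ∀ j, Continuous (G j) := fun j => by
    by_cases h : j = i
    · simpa [G, h] using hfc
    · simpa [G, h] using continuous_const
  have hG'c : Continuous fun y => ∑ j, G' j y (Pi.single j 1) := by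
    refine continuous_finsetSum _ fun j _ => ?_
    by_cases h : j = i
    · simp only [G', h, if_true]
      exact (((hf.continuous_fderiv one_ne_zero).comp L.continuous).clm_comp continuous_const).clm_apply
        continuous_const
    · simpa [G', h] using continuous_const
  have hsum : ∀ y, ∑ j, G' j y (Pi.single j 1)
      = fderiv ℝ f (WithLp.toLp 2 y) (EuclideanSpace.single i 1) := fun y => by
    rw [Finset.sum_eq_single i]
    · simp only [G', if_true]
      rfl
    · intro j _ hj; simp [G', hj]
    · simp
  have key := integral_divergence_of_hasFDerivAt_off_countable' (n := 2) (a := 0) (b := 1)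
    (by intro i; simp) G G' ∅ countable_empty (fun j => (hGc j).continuousOn)
    (by
      intro y _ j
      by_cases h : j = i
      · simp only [G, G', h, if_true]
        exact (hf.differentiable one_ne_zero (L y)).hasFDerivAt.comp y L.hasFDerivAt
      · simp only [G, G', h, if_false]
        exact hasFDerivAt_const _ _)
    (hG'c.continuousOn.integrableOn_compact isCompact_Icc)
  simp only [hsum] at key
  have hIcc : (Icc (fun _ => (0:ℝ)) (fun _ => 1) : Set (Fin 3 → ℝ)) = Icc 0 1 := rfl
  rw [hIcc, key]
  refine Finset.sum_eq_zero fun j _ => ?_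
  rw [sub_eq_zero]
  congr 1
  ext y
  by_cases h : j = i
  · subst h
    simp only [G, if_true, hL]
    have h2 := hper j (WithLp.toLp 2 (Fin.insertNth j ((0 : Fin 3 → ℝ) j) y))
    rw [← h2]
    congr 1
    ext l
    rcases Fin.eq_self_or_eq_succAbove j l with rfl | ⟨m, rfl⟩
    · simp
    · simp
  · simp [G, h]

end TimeAveraging

namespace TimeAveraging

/-! ### The algebra of smooth periodic functions on `(0,T) × ℝ³` -/

/-- The open space-time slab `(0,T) × ℝ³`. -/
def slab (T : ℝ) : Set (ℝ × E3) := Ioo (0 : ℝ) T ×ˢ univ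

theorem isOpen_slab (T : ℝ) : IsOpen (slab T) := isOpen_Ioo.prod isOpen_univ

theorem mem_slab {T t : ℝ} (ht : t ∈ Ioo 0 T) (x : E3) : (t, x) ∈ slab T := ⟨ht, trivial⟩

/-- Extension by zero of a function on the slab. -/
def zext {T : ℝ} (f : slab T → ℝ) : ℝ × E3 → ℝ := Function.extend Subtype.val f 0

theorem zext_of_mem {T : ℝ} (f : slab T → ℝ) {p : ℝ × E3} (hp : p ∈ slab T) :
    zext f p = f ⟨p, hp⟩ :=
  Subtype.val_injective.extend_apply f 0 ⟨p, hp⟩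

theorem zext_of_notMem {T : ℝ} (f : slab T → ℝ) {p : ℝ × E3} (hp : p ∉ slab T) :
    zext f p = 0 :=
  Function.extend_apply' _ _ _ (by rintro ⟨a, rfl⟩; exact hp a.2)

theorem zext_add {T : ℝ} (f g : slab T → ℝ) : zext (f + g) = zext f + zext g := by
  ext p
  by_cases hp : p ∈ slab T
  · simp [zext_of_mem, hp]
  · simp [zext_of_notMem, hp]

theorem zext_mul {T : ℝ} (f g : slab T → ℝ) : zext (f * g) = zext f * zext g := by
  ext p
  by_cases hp : p ∈ slab T
  · simp [zext_of_mem, hp]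
  · simp [zext_of_notMem, hp]

/-- Smooth functions on `(0,T) × ℝ³` that are `ℤ³`-periodic in space. -/
def smoothPerSubalgebra (T : ℝ) : Subalgebra ℝ (slab T → ℝ) where
  carrier := {f | ContDiffOn ℝ ∞ (zext f) (slab T) ∧
    ∀ (i : Fin 3) (p : ℝ × E3), zext f (p + (0, EuclideanSpace.single i 1)) = zext f p}
  add_mem' := by
    rintro f g ⟨hf, hf'⟩ ⟨hg, hg'⟩
    refine ⟨?_, fun i p => ?_⟩
    · rw [zext_add]; exact hf.add hg
    · simp only [zext_add, Pi.add_apply, hf', hg']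
  mul_mem' := by
    rintro f g ⟨hf, hf'⟩ ⟨hg, hg'⟩
    refine ⟨?_, fun i p => ?_⟩
    · rw [zext_mul]; exact hf.mul hg
    · simp only [zext_mul, Pi.mul_apply, hf', hg']
  algebraMap_mem' := by
    intro c
    refine ⟨(contDiffOn_const (c := c)).congr fun p hp => ?_, fun i p => ?_⟩
    · rw [zext_of_mem _ hp]; rfl
    · by_cases hp : p ∈ slab T
      · have hp' : p + (0, EuclideanSpace.single i 1) ∈ slab T := by
          refine ⟨?_, trivial⟩; simpa using hp.1
        rw [zext_of_mem _ hp, zext_of_mem _ hp']; rfl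
      · have hp' : p + (0, EuclideanSpace.single i 1) ∉ slab T := fun h => by
          refine hp ⟨?_, trivial⟩; simpa using h.1
        rw [zext_of_notMem _ hp, zext_of_notMem _ hp']

/-- The algebra of smooth functions on `(0,T) × ℝ³` that are `ℤ³`-periodic in space. -/
def SmoothPer (T : ℝ) : Type := smoothPerSubalgebra T

instance (T : ℝ) : CommRing (SmoothPer T) := inferInstanceAs (CommRing (smoothPerSubalgebra T))

instance (T : ℝ) : Algebra ℝ (SmoothPer T) :=
  inferInstanceAs (Algebra ℝ (smoothPerSubalgebra T))

variable {T : ℝ}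

/-- The value at `(t,x)`; it is `0` off the slab. -/
def SmoothPer.val (f : SmoothPer T) (t : ℝ) (x : E3) : ℝ := zext f.1 (t, x)

namespace SmoothPer

theorem val_of_mem (f : SmoothPer T) {t : ℝ} (ht : t ∈ Ioo 0 T) (x : E3) :
    f.val t x = f.1 ⟨(t, x), mem_slab ht x⟩ := zext_of_mem _ _

theorem contDiffOn (f : SmoothPer T) :
    ContDiffOn ℝ ∞ (fun p : ℝ × E3 => f.val p.1 p.2) (slab T) := f.2.1

theorem contDiffAt (f : SmoothPer T) {t : ℝ} (ht : t ∈ Ioo 0 T) (x : E3) :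
    ContDiffAt ℝ ∞ (fun p : ℝ × E3 => f.val p.1 p.2) (t, x) :=
  f.contDiffOn.contDiffAt ((isOpen_slab T).mem_nhds (mem_slab ht x))

theorem differentiableAt (f : SmoothPer T) {t : ℝ} (ht : t ∈ Ioo 0 T) (x : E3) :
    DifferentiableAt ℝ (fun p : ℝ × E3 => f.val p.1 p.2) (t, x) :=
  (f.contDiffAt ht x).differentiableAt (by simp)

theorem contDiff_val (f : SmoothPer T) {t : ℝ} (ht : t ∈ Ioo 0 T) : ContDiff ℝ ∞ (f.val t) := by
  rw [contDiff_iff_contDiffAt]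
  intro x
  exact (f.contDiffAt ht x).comp x (f := fun y => (t, y)) (by fun_prop)

theorem isPeriodic_val (f : SmoothPer T) (t : ℝ) : IsPeriodic (f.val t) := by
  intro i x
  have := f.2.2 i (t, x)
  simpa [val] using this

-- Elements are functions on the slab itself, so agreement at interior times is equality.
-- Differential equations thereby become identities in a commutative ring with commuting
-- derivations, and energy identities reduce to ring computations.
@[ext]
theorem ext {f g : SmoothPer T} (h : ∀ t ∈ Ioo 0 T, ∀ x, f.val t x = g.val t x) : f = g := by
  apply Subtype.ext
  funext p
  have := h p.1.1 p.2.1 p.1.2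
  rwa [val_of_mem _ p.2.1, val_of_mem _ p.2.1] at this

@[simp] theorem val_add (f g : SmoothPer T) (t : ℝ) (x : E3) :
    (f + g).val t x = f.val t x + g.val t x := congrFun (zext_add f.1 g.1) (t, x)

@[simp] theorem val_mul (f g : SmoothPer T) (t : ℝ) (x : E3) :
    (f * g).val t x = f.val t x * g.val t x := congrFun (zext_mul f.1 g.1) (t, x)

theorem val_algebraMap (c : ℝ) {t : ℝ} (ht : t ∈ Ioo 0 T) (x : E3) :
    (algebraMap ℝ (SmoothPer T) c).val t x = c := by
  rw [val_of_mem _ ht]; rfl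

@[simp] theorem val_smul (c : ℝ) (f : SmoothPer T) (t : ℝ) (x : E3) :
    (c • f).val t x = c * f.val t x := by
  by_cases ht : t ∈ Ioo 0 T
  · rw [Algebra.smul_def, val_mul, val_algebraMap c ht]
  · have h : (t, x) ∉ slab T := fun h => ht h.1
    simp [val, zext_of_notMem _ h]

@[simp] theorem val_zero (t : ℝ) (x : E3) : (0 : SmoothPer T).val t x = 0 := by
  have := val_smul (T := T) 0 0 t x
  simpa using this

@[simp] theorem val_neg (f : SmoothPer T) (t : ℝ) (x : E3) : (-f).val t x = -f.val t x := by
  have := val_smul (T := T) (-1) f t x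
  simpa using this

@[simp] theorem val_sub (f g : SmoothPer T) (t : ℝ) (x : E3) :
    (f - g).val t x = f.val t x - g.val t x := by
  rw [sub_eq_add_neg, val_add, val_neg, sub_eq_add_neg]

@[simp] theorem val_sum {ι : Type*} (s : Finset ι) (f : ι → SmoothPer T) (t : ℝ) (x : E3) :
    (∑ i ∈ s, f i).val t x = ∑ i ∈ s, (f i).val t x := by
  classical
  induction s using Finset.induction_on with
  | empty => simp
  | insert a s ha ih => rw [Finset.sum_insert ha, Finset.sum_insert ha, val_add, ih]

theorem val_one {t : ℝ} (ht : t ∈ Ioo 0 T) (x : E3) : (1 : SmoothPer T).val t x = 1 := by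
  rw [← map_one (algebraMap ℝ (SmoothPer T)), val_algebraMap _ ht]

@[simp] theorem val_pow (f : SmoothPer T) (n : ℕ) (t : ℝ) (x : E3) :
    (f ^ (n + 1)).val t x = f.val t x ^ (n + 1) := by
  induction n with
  | zero => simp
  | succ n ih => rw [pow_succ, val_mul, ih]; ring

@[simp] theorem val_sq (f : SmoothPer T) (t : ℝ) (x : E3) :
    (f ^ 2).val t x = f.val t x ^ 2 := val_pow f 1 t x

/-- The element of `SmoothPer T` given by a smooth periodic function. -/
def mk (F : ℝ → E3 → ℝ) (h : ContDiffOn ℝ ∞ (fun p : ℝ × E3 => F p.1 p.2) (slab T))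
    (hper : ∀ t ∈ Ioo 0 T, IsPeriodic (F t)) : SmoothPer T :=
  ⟨fun p => F p.1.1 p.1.2, by
    refine ⟨h.congr fun p hp => zext_of_mem _ hp, fun i p => ?_⟩
    by_cases hp : p ∈ slab T
    · have hp' : p + (0, EuclideanSpace.single i 1) ∈ slab T := by
        refine ⟨?_, trivial⟩; simpa using hp.1
      rw [zext_of_mem _ hp, zext_of_mem _ hp']
      have := hper p.1 hp.1 i p.2
      simpa using this
    · have hp' : p + (0, EuclideanSpace.single i 1) ∉ slab T := fun h => by
        refine hp ⟨?_, trivial⟩; simpa using h.1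
      rw [zext_of_notMem _ hp, zext_of_notMem _ hp']⟩

theorem val_mk (F : ℝ → E3 → ℝ) (h : ContDiffOn ℝ ∞ (fun p : ℝ × E3 => F p.1 p.2) (slab T))
    (hper : ∀ t ∈ Ioo 0 T, IsPeriodic (F t)) {t : ℝ} (ht : t ∈ Ioo 0 T) (x : E3) :
    (mk F h hper).val t x = F t x := by
  rw [val_of_mem _ ht]; rfl

/-- Differentiation in the space-time direction `v`. -/
def derFun (v : ℝ × E3) (f : SmoothPer T) : SmoothPer T :=
  mk (fun t x => fderiv ℝ (fun p : ℝ × E3 => f.val p.1 p.2) (t, x) v)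
    ((f.contDiffOn.fderiv_of_isOpen (isOpen_slab T) (by simp)).clm_apply contDiffOn_const)
    (by
      intro t ht i x
      have h : (fun p : ℝ × E3 => f.val p.1 p.2)
          = fun p => (fun p : ℝ × E3 => f.val p.1 p.2) (p + (0, EuclideanSpace.single i 1)) := by
        funext p
        exact (f.2.2 i p).symm
      have h2 : fderiv ℝ (fun p : ℝ × E3 => f.val p.1 p.2) (t, x)
          = fderiv ℝ (fun p : ℝ × E3 => f.val p.1 p.2)
            ((t, x) + (0, EuclideanSpace.single i 1)) := by
        conv_lhs => rw [h]
        exact fderiv_comp_add_right _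
      simp only [h2, Prod.mk_add_mk, add_zero])

theorem val_derFun (v : ℝ × E3) (f : SmoothPer T) {t : ℝ} (ht : t ∈ Ioo 0 T) (x : E3) :
    (derFun v f).val t x = fderiv ℝ (fun p : ℝ × E3 => f.val p.1 p.2) (t, x) v :=
  val_mk _ _ _ ht x

/-- Differentiation in the space-time direction `v`, as a derivation. -/
def der (T : ℝ) (v : ℝ × E3) : Derivation ℝ (SmoothPer T) (SmoothPer T) :=
  Derivation.mk'
    { toFun := derFun v
      map_add' := by
        intro f g
        ext t ht x
        simp only [val_derFun v _ ht, val_add]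
        rw [fderiv_fun_add (f.differentiableAt ht x) (g.differentiableAt ht x)]
        rfl
      map_smul' := by
        intro c f
        ext t ht x
        simp only [val_derFun v _ ht, val_smul, RingHom.id_apply]
        rw [fderiv_const_mul (f.differentiableAt ht x)]
        rfl }
    (by
      intro f g
      ext t ht x
      simp only [LinearMap.coe_mk, AddHom.coe_mk, val_derFun v _ ht, val_mul, smul_eq_mul, val_add]
      rw [fderiv_fun_mul (f.differentiableAt ht x) (g.differentiableAt ht x)]
      simp)

theorem val_der (v : ℝ × E3) (f : SmoothPer T) {t : ℝ} (ht : t ∈ Ioo 0 T) (x : E3) :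
    (der T v f).val t x = fderiv ℝ (fun p : ℝ × E3 => f.val p.1 p.2) (t, x) v :=
  val_derFun v f ht x

theorem der_comm (v w : ℝ × E3) (f : SmoothPer T) : der T v (der T w f) = der T w (der T v f) := by
  ext t ht x
  have hmem := (isOpen_slab T).mem_nhds (mem_slab ht x)
  have key : ∀ v w : ℝ × E3, (der T v (der T w f)).val t x
      = fderiv ℝ (fderiv ℝ (fun p : ℝ × E3 => f.val p.1 p.2)) (t, x) v w := by
    intro v w
    rw [val_der v _ ht]
    have h1 : (fun p : ℝ × E3 => (der T w f).val p.1 p.2)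
        =ᶠ[𝓝 (t, x)] fun p => fderiv ℝ (fun p : ℝ × E3 => f.val p.1 p.2) p w := by
      filter_upwards [hmem] with p hp
      exact val_der w f hp.1 p.2
    rw [h1.fderiv_eq, fderiv_clm_apply]
    · simp
    · have := (f.contDiffOn.fderiv_of_isOpen (isOpen_slab T) (m := 1)
        (by norm_cast)).contDiffAt hmem
      exact this.differentiableAt one_ne_zero
    · fun_prop
  rw [key, key]
  exact ((f.contDiffAt ht x).isSymmSndFDerivAt (by simp; norm_cast)).eq v w

/-- The `i`-th spatial derivative. -/
def dx (i : Fin 3) : Derivation ℝ (SmoothPer T) (SmoothPer T) :=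
  der T (0, EuclideanSpace.single i 1)

/-- The time derivative. -/
def dt : Derivation ℝ (SmoothPer T) (SmoothPer T) := der T (1, 0)

theorem dx_comm (i j : Fin 3) (f : SmoothPer T) : dx i (dx j f) = dx j (dx i f) := der_comm _ _ _

theorem dt_dx (i : Fin 3) (f : SmoothPer T) : dt (dx i f) = dx i (dt f) := der_comm _ _ _

theorem val_dx (i : Fin 3) (f : SmoothPer T) {t : ℝ} (ht : t ∈ Ioo 0 T) (x : E3) :
    (dx i f).val t x = fderiv ℝ (f.val t) x (EuclideanSpace.single i 1) := by
  rw [dx, val_der _ _ ht]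
  have h := (f.differentiableAt ht x).hasFDerivAt.comp x (f := fun y => (t, y))
    (hasFDerivAt_prodMk_right t x)
  have h2 : fderiv ℝ (f.val t) x = _ := h.fderiv
  rw [h2]
  simp

theorem hasDerivAt_val (f : SmoothPer T) {t : ℝ} (ht : t ∈ Ioo 0 T) (x : E3) :
    HasDerivAt (fun s => f.val s x) ((dt f).val t x) t := by
  rw [dt, val_der _ _ ht]
  have h := (f.differentiableAt ht x).hasFDerivAt.comp_hasDerivAt t (f := fun s => (s, x))
    ((hasDerivAt_id t).prodMk (hasDerivAt_const t x))
  exact h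

theorem continuousOn_val (f : SmoothPer T) :
    ContinuousOn (fun p : ℝ × E3 => f.val p.1 p.2) (Ioo 0 T ×ˢ univ) := f.contDiffOn.continuousOn

theorem continuous_val (f : SmoothPer T) {t : ℝ} (ht : t ∈ Ioo 0 T) : Continuous (f.val t) :=
  (f.contDiff_val ht).continuous

theorem integrable_val (f : SmoothPer T) {t : ℝ} (ht : t ∈ Ioo 0 T) :
    Integrable (f.val t) torusMeasure := by
  obtain ⟨C, hC⟩ := closedCube_isCompact.exists_bound_of_continuousOn (f.continuous_val ht).continuousOn
  exact Integrable.of_bound (f.continuous_val ht).aestronglyMeasurable C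
    (ae_torusMeasure_mem.mono hC)

/-- The spatial integral `∫ f(t,x) dx`. -/
def integ (f : SmoothPer T) (t : ℝ) : ℝ := ∫ x, f.val t x ∂torusMeasure

theorem integ_add (f g : SmoothPer T) {t : ℝ} (ht : t ∈ Ioo 0 T) :
    (f + g).integ t = f.integ t + g.integ t := by
  simp only [integ, val_add]
  exact integral_add (f.integrable_val ht) (g.integrable_val ht)

theorem integ_sub (f g : SmoothPer T) {t : ℝ} (ht : t ∈ Ioo 0 T) :
    (f - g).integ t = f.integ t - g.integ t := by
  simp only [integ, val_sub]
  exact integral_sub (f.integrable_val ht) (g.integrable_val ht)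

theorem integ_smul (c : ℝ) (f : SmoothPer T) (t : ℝ) :
    (c • f).integ t = c * f.integ t := by
  simp only [integ, val_smul]
  exact integral_const_mul _ _

theorem integ_neg (f : SmoothPer T) (t : ℝ) : (-f).integ t = -f.integ t := by
  simp only [integ, val_neg]
  exact integral_neg _

theorem integ_zero (t : ℝ) : (0 : SmoothPer T).integ t = 0 := by
  simp [integ]

theorem integ_sum {ι : Type*} (s : Finset ι) (f : ι → SmoothPer T) {t : ℝ} (ht : t ∈ Ioo 0 T) :
    (∑ i ∈ s, f i).integ t = ∑ i ∈ s, (f i).integ t := by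
  simp only [integ, val_sum]
  exact integral_finsetSum _ fun i _ => (f i).integrable_val ht

theorem integ_mono {f g : SmoothPer T} {t : ℝ} (ht : t ∈ Ioo 0 T)
    (h : ∀ x, f.val t x ≤ g.val t x) : f.integ t ≤ g.integ t :=
  integral_mono (f.integrable_val ht) (g.integrable_val ht) h

theorem integ_nonneg {f : SmoothPer T} {t : ℝ} (h : ∀ x, 0 ≤ f.val t x) : 0 ≤ f.integ t :=
  integral_nonneg h

theorem integ_dx (i : Fin 3) (f : SmoothPer T) {t : ℝ} (ht : t ∈ Ioo 0 T) :
    (dx i f).integ t = 0 := by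
  simp only [integ, val_dx i f ht]
  exact integral_torusMeasure_partialDeriv_eq_zero ((f.contDiff_val ht).of_le (by simp))
    (f.isPeriodic_val t) i

theorem hasDerivAt_integ (f : SmoothPer T) {t : ℝ} (ht : t ∈ Ioo 0 T) :
    HasDerivAt f.integ ((dt f).integ t) t := by
  have h := hasFDerivAt_integral_of_continuousOn (ν := torusMeasure) closedCube_isCompact
    ae_torusMeasure_mem isOpen_Ioo (f := f.val)
    (f' := fun t x => (ContinuousLinearMap.toSpanSingleton ℝ ((dt f).val t x)))
    (fun q hq => f.continuous_val hq) (fun q hq x => (f.hasDerivAt_val hq x).hasFDerivAt)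
    (((ContinuousLinearMap.toSpanSingletonCLE (𝕜 := ℝ) (E := ℝ)).continuous.comp_continuousOn
      (dt f).continuousOn_val)) ht
  have h3 := ContinuousLinearMap.integral_comp_comm (μ := torusMeasure)
    ((ContinuousLinearMap.toSpanSingletonCLE (𝕜 := ℝ) (E := ℝ) : ℝ ≃L[ℝ] ℝ →L[ℝ] ℝ) : ℝ →L[ℝ] ℝ →L[ℝ] ℝ)
    ((dt f).integrable_val ht)
  have h4 : (∫ x, ContinuousLinearMap.toSpanSingleton ℝ ((dt f).val t x) ∂torusMeasure)
    = ContinuousLinearMap.toSpanSingleton ℝ ((dt f).integ t) := h3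
  rw [h4] at h
  have h5 := h.hasDerivAt
  rwa [ContinuousLinearMap.toSpanSingleton_apply, one_smul] at h5

theorem continuousOn_integ (f : SmoothPer T) : ContinuousOn f.integ (Ioo 0 T) :=
  fun _ ht => (f.hasDerivAt_integ ht).continuousAt.continuousWithinAt

end SmoothPer

end TimeAveraging

namespace TimeAveraging

/-! ### Energy identities for advection-diffusion equations -/

namespace SmoothPer

variable {T : ℝ}

theorem val_natCast (n : ℕ) {t : ℝ} (ht : t ∈ Ioo 0 T) (x : E3) :
    (n : SmoothPer T).val t x = n := by
  rw [← map_natCast (algebraMap ℝ (SmoothPer T)), val_algebraMap _ ht]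

theorem val_ofNat (n : ℕ) [n.AtLeastTwo] {t : ℝ} (ht : t ∈ Ioo 0 T) (x : E3) :
    (OfNat.ofNat n : SmoothPer T).val t x = OfNat.ofNat n :=
  val_natCast n ht x

/-- A real constant as an element of the algebra. -/
abbrev cst (c : ℝ) : SmoothPer T := algebraMap ℝ (SmoothPer T) c

/-- The material derivative `∂ₜ + u·∇`. -/
def matD (u : Fin 3 → SmoothPer T) : Derivation ℝ (SmoothPer T) (SmoothPer T) :=
  dt + ∑ i, u i • dx i

theorem matD_apply (u : Fin 3 → SmoothPer T) (f : SmoothPer T) :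
    matD u f = dt f + ∑ i, u i * dx i f := by
  simp [matD, Fin.sum_univ_three]

/-- `div(a∇f)`. -/
def divGrad (a f : SmoothPer T) : SmoothPer T := ∑ j, dx j (a * dx j f)

/-- `|∇f|²`. -/
def gradSq (f : SmoothPer T) : SmoothPer T := ∑ j, dx j f ^ 2

theorem val_gradSq (f : SmoothPer T) (t : ℝ) (x : E3) :
    (gradSq f).val t x = ∑ j, (dx j f).val t x ^ 2 := by
  simp [gradSq]

theorem val_gradSq_nonneg (f : SmoothPer T) (t : ℝ) (x : E3) : 0 ≤ (gradSq f).val t x := by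
  rw [val_gradSq]; positivity

theorem dx_mul (i : Fin 3) (f g : SmoothPer T) : dx i (f * g) = dx i f * g + f * dx i g := by
  rw [Derivation.leibniz, smul_eq_mul, smul_eq_mul]; ring

theorem dx_sq (i : Fin 3) (f : SmoothPer T) : dx i (f ^ 2) = 2 * f * dx i f := by
  rw [sq, dx_mul]; ring

theorem matD_mul (u : Fin 3 → SmoothPer T) (f g : SmoothPer T) :
    matD u (f * g) = matD u f * g + f * matD u g := by
  rw [Derivation.leibniz, smul_eq_mul, smul_eq_mul]; ring

theorem matD_sq (u : Fin 3 → SmoothPer T) (f : SmoothPer T) :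
    matD u (f ^ 2) = 2 * f * matD u f := by
  rw [sq, matD_mul]; ring

theorem dx_cst (i : Fin 3) (c : ℝ) : dx i (cst c : SmoothPer T) = 0 := Derivation.map_algebraMap _ _

theorem matD_cst (u : Fin 3 → SmoothPer T) (c : ℝ) : matD u (cst c) = 0 :=
  Derivation.map_algebraMap _ _

theorem matD_dx (u : Fin 3 → SmoothPer T) (i : Fin 3) (f : SmoothPer T) :
    matD u (dx i f) = dx i (matD u f) - ∑ j, dx i (u j) * dx j f := by
  simp only [matD_apply, map_add, map_sum, dx_mul, dt_dx, Finset.sum_add_distrib]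
  simp only [dx_comm i]
  ring

/-- Integration by parts is reduced to naming the flux `h`: what remains is an algebraic identity
between the integrands. -/
theorem integ_eq_of_eq_add_div {f g : SmoothPer T} (h : Fin 3 → SmoothPer T)
    (hfg : f = g + ∑ j, dx j (h j)) {t : ℝ} (ht : t ∈ Ioo 0 T) : f.integ t = g.integ t := by
  rw [hfg, integ_add _ _ ht, integ_sum _ _ ht]
  simp [integ_dx _ _ ht]

/-- For divergence-free `u` the transport term u·∇f equals div(uf) and integrates to zero. -/
theorem integ_matD {u : Fin 3 → SmoothPer T} (hu : ∑ j, dx j (u j) = 0) (f : SmoothPer T) {t : ℝ}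
    (ht : t ∈ Ioo 0 T) : (dt f).integ t = (matD u f).integ t := by
  refine integ_eq_of_eq_add_div (fun j => -(u j * f)) ?_ ht
  simp only [matD_apply, map_neg, dx_mul, Finset.sum_neg_distrib, Finset.sum_add_distrib,
    ← Finset.sum_mul, hu]
  ring

/-- The term 2Af div(a∇f) gives -2Aa|∇f|² and -a∇A·∇(f²). Moving the gradient off f² in the latter
yields div(a∇A)f², so no mixed product of f and ∇f survives. -/
theorem weighted_energy {u : Fin 3 → SmoothPer T} (hu : ∑ j, dx j (u j) = 0)
    {f a r : SmoothPer T} (hf : matD u f = divGrad a f + r) (A : SmoothPer T) {t : ℝ}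
    (ht : t ∈ Ioo 0 T) :
    (dt (A * f ^ 2)).integ t
      = (matD u A * f ^ 2 - 2 * (A * a * gradSq f) + divGrad a A * f ^ 2 + 2 * (A * f * r)).integ
          t := by
  rw [integ_matD hu _ ht, matD_mul, matD_sq, hf]
  refine integ_eq_of_eq_add_div (fun j => 2 * (A * f * a * dx j f) - a * dx j A * f ^ 2) ?_ ht
  simp only [divGrad, gradSq, Fin.sum_univ_three, map_sub, dx_mul, dx_sq]
  have h2 : ∀ i : Fin 3, dx i (2 : SmoothPer T) = 0 := fun i => Derivation.map_natCast _ 2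
  simp only [h2]
  ring

/-- Each ∂ᵢf satisfies the same equation with extra source div(∂ᵢa∇f) - ∂ᵢu·∇f + ∂ᵢH, and
`weighted_energy` is summed over i. The commutator div(∂ᵢa∇f) is integrated by parts twice, which
produces div(A∇a)|∇f|² and ∇A·∇f ∇a·∇f. Hence the Hessian appears only in the good term -2Aa|∇²f|²;
this matters because A may vanish and could not absorb Hessian errors. -/
theorem gradient_energy {u : Fin 3 → SmoothPer T} (hu : ∑ j, dx j (u j) = 0)
    {f a H : SmoothPer T} (hf : matD u f = divGrad a f + H) (A : SmoothPer T) {t : ℝ}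
    (ht : t ∈ Ioo 0 T) :
    (dt (A * gradSq f)).integ t
      = (matD u A * gradSq f - 2 * (A * a * ∑ i, gradSq (dx i f)) + divGrad a A * gradSq f
          + divGrad A a * gradSq f - 2 * ∑ i, ∑ j, dx j A * dx i a * dx i f * dx j f
          - 2 * (A * ∑ i, ∑ j, dx i (u j) * dx j f * dx i f)
          + 2 * (A * ∑ i, dx i f * dx i H)).integ t := by
  have h2 : ∀ i : Fin 3, dx i (2 : SmoothPer T) = 0 := fun i => Derivation.map_natCast _ 2
  have hi : ∀ i, matD u (dx i f) = divGrad a (dx i f)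
      + (∑ j, dx j (dx i a * dx j f) - ∑ j, dx i (u j) * dx j f + dx i H) := by
    intro i
    rw [matD_dx, hf]
    simp only [divGrad, map_add, map_sum, dx_mul]
    simp only [Fin.sum_univ_three, dx_comm i]
    ring
  have hsum : dt (A * gradSq f) = ∑ i, dt (A * dx i f ^ 2) := by
    rw [gradSq, Finset.mul_sum, map_sum]
  rw [hsum, integ_sum _ _ ht, Finset.sum_congr rfl fun i _ => weighted_energy hu (hi i) A ht,
    ← integ_sum _ _ ht]
  refine integ_eq_of_eq_add_div (fun j => 2 * ∑ i, A * dx i f * dx i a * dx j f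
    - A * dx j a * gradSq f) ?_ ht
  simp only [gradSq, divGrad, Fin.sum_univ_three, map_sub, map_add, dx_mul, dx_sq, h2]
  have c1 := dx_comm 1 0 f
  have c2 := dx_comm 2 0 f
  have c3 := dx_comm 2 1 f
  rw [c1, c2, c3]
  ring

end SmoothPer

end TimeAveraging

namespace TimeAveraging

/-! ### Parseval's identity on the torus -/

attribute [local instance] instMeasureSpaceUnitAddCircle

/-- The representative in `(0,1]³` of a point of the torus. -/
def torusRep (y : UnitAddTorus (Fin 3)) : E3 :=
  WithLp.toLp 2 fun i => (AddCircle.equivIoc (1 : ℝ) 0 (y i)).1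

theorem coe_torusRep (y : UnitAddTorus (Fin 3)) (i : Fin 3) :
    ((torusRep y i : ℝ) : UnitAddCircle) = y i :=
  (AddCircle.equivIoc (1 : ℝ) 0).symm_apply_apply (y i)

/-- The representatives fill (0,1]³ while the torus measure lives on [0,1)³; the two cubes differ by
a null set. -/
theorem measurePreserving_torusRep : MeasurePreserving torusRep volume torusMeasure := by
  have h1 := UnitAddTorus.measurePreserving_equivPiIoc (d := Fin 3) 0
  have hS : MeasurableSet {x : Fin 3 → ℝ | ∀ i, x i ∈ Ioc ((0 : Fin 3 → ℝ) i) ((0 : Fin 3 → ℝ) i + 1)} :=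
    MeasurableSet.univ_pi' fun i => measurableSet_Ioc
  have h2 : MeasurePreserving
      (Subtype.val : {x : Fin 3 → ℝ // ∀ i, x i ∈ Ioc ((0 : Fin 3 → ℝ) i) ((0 : Fin 3 → ℝ) i + 1)} → _)
      (Measure.comap Subtype.val volume)
      (volume.restrict {x : Fin 3 → ℝ | ∀ i, x i ∈ Ioc ((0 : Fin 3 → ℝ) i) ((0 : Fin 3 → ℝ) i + 1)}) :=
    ⟨measurable_subtype_coe, map_comap_subtype_coe hS volume⟩
  have h3 : (volume.restrict {x : Fin 3 → ℝ | ∀ i, x i ∈ Ioc ((0 : Fin 3 → ℝ) i) ((0 : Fin 3 → ℝ) i + 1)})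
      = volume.restrict (Set.pi univ fun _ : Fin 3 => Ico (0 : ℝ) 1) := by
    rw [volume_pi]
    have : {x : Fin 3 → ℝ | ∀ i, x i ∈ Ioc ((0 : Fin 3 → ℝ) i) ((0 : Fin 3 → ℝ) i + 1)}
        = Set.pi univ fun _ : Fin 3 => Ioc (0 : ℝ) 1 := by
      ext x; simp
    rw [this]
    exact Measure.restrict_congr_set
      (Measure.univ_pi_Ioc_ae_eq_Icc.trans Measure.univ_pi_Ico_ae_eq_Icc.symm)
  rw [h3] at h2
  have h4 : MeasurePreserving (WithLp.toLp 2 : (Fin 3 → ℝ) → E3)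
      (volume.restrict (Set.pi univ fun _ : Fin 3 => Ico (0 : ℝ) 1)) torusMeasure :=
    MeasurePreserving.symm (MeasurableEquiv.toLp 2 (Fin 3 → ℝ)).symm
      measurePreserving_ofLp_torusMeasure
  exact (h4.comp h2).comp h1

theorem mFourier_neg_eq (k : Fin 3 → ℤ) (y : UnitAddTorus (Fin 3)) :
    UnitAddTorus.mFourier (-k) y
      = Complex.exp (-(2 * Real.pi * Complex.I * ∑ i, (k i : ℂ) * (torusRep y i : ℂ))) := by
  have h : UnitAddTorus.mFourier (-k) y = ∏ i, fourier ((-k) i) (y i) := rfl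
  rw [h]
  simp_rw [← coe_torusRep y, fourier_coe_apply]
  rw [← Complex.exp_sum, Finset.mul_sum, ← Finset.sum_neg_distrib]
  congr 1
  refine Finset.sum_congr rfl fun i _ => ?_
  push_cast [Pi.neg_apply]
  ring

theorem integral_comp_torusRep {F : Type*} [NormedAddCommGroup F] [NormedSpace ℝ F] {f : E3 → F}
    (hf : AEStronglyMeasurable f torusMeasure) :
    ∫ y, f (torusRep y) = ∫ x, f x ∂torusMeasure := by
  have h := measurePreserving_torusRep
  rw [← h.map_eq, integral_map h.measurable.aemeasurable (by rwa [h.map_eq])]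

theorem hasSum_norm_fourierCoef_sq {f : E3 → ℝ} (hf : MemLp f 2 torusMeasure) :
    HasSum (fun k => ‖fourierCoef f k‖ ^ 2) (∫ x, f x ^ 2 ∂torusMeasure) := by
  have hfc : MemLp (fun x => (f x : ℂ)) 2 torusMeasure := hf.ofReal
  have hF : MemLp (fun y => (f (torusRep y) : ℂ)) 2 (volume : Measure (UnitAddTorus (Fin 3))) :=
    hfc.comp_measurePreserving measurePreserving_torusRep
  have key := UnitAddTorus.hasSum_sq_mFourierCoeff hF.toLp
  have hcoef : ∀ k, UnitAddTorus.mFourierCoeff hF.toLp k = fourierCoef f k := by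
    intro k
    have hm : AEStronglyMeasurable (fun x : E3 => (f x : ℂ) * Complex.exp
        (-(2 * Real.pi * Complex.I * ∑ i, (k i : ℂ) * (x i : ℂ)))) torusMeasure := by
      refine hfc.aestronglyMeasurable.mul (Continuous.aestronglyMeasurable ?_)
      fun_prop
    rw [fourierCoef, ← integral_comp_torusRep hm, UnitAddTorus.mFourierCoeff]
    refine integral_congr_ae ?_
    filter_upwards [hF.coeFn_toLp] with y hy
    rw [hy, mFourier_neg_eq, smul_eq_mul, mul_comm]
  have hint : ∫ y, ‖(hF.toLp _) y‖ ^ 2 = ∫ x, f x ^ 2 ∂torusMeasure := by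
    rw [← integral_comp_torusRep (f := fun x => f x ^ 2) (hf.aestronglyMeasurable.pow 2)]
    refine integral_congr_ae ?_
    filter_upwards [hF.coeFn_toLp] with y hy
    rw [hy]
    simp
  rw [hint] at key
  simpa only [hcoef] using key

/-- The real part of the Fourier mode with frequency `k`. -/
def cosMode (k : Fin 3 → ℤ) (x : E3) : ℝ := Real.cos (2 * Real.pi * ∑ i, (k i : ℝ) * x i)

/-- The imaginary part of the Fourier mode with frequency `k`. -/
def sinMode (k : Fin 3 → ℤ) (x : E3) : ℝ := Real.sin (2 * Real.pi * ∑ i, (k i : ℝ) * x i)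

theorem exp_mode (k : Fin 3 → ℤ) (x : E3) :
    Complex.exp (-(2 * Real.pi * Complex.I * ∑ i, (k i : ℂ) * (x i : ℂ)))
      = (cosMode k x : ℂ) - (sinMode k x : ℂ) * Complex.I := by
  have h : -(2 * Real.pi * Complex.I * ∑ i, (k i : ℂ) * (x i : ℂ))
      = ((-(2 * Real.pi * ∑ i, (k i : ℝ) * x i) : ℝ) : ℂ) * Complex.I := by
    push_cast; ring
  rw [h, Complex.exp_mul_I, ← Complex.ofReal_cos, ← Complex.ofReal_sin, Real.cos_neg, Real.sin_neg,
    cosMode, sinMode]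
  push_cast; ring

theorem contDiff_cosMode (k : Fin 3 → ℤ) : ContDiff ℝ ∞ (cosMode k) := by
  unfold cosMode; fun_prop

theorem contDiff_sinMode (k : Fin 3 → ℤ) : ContDiff ℝ ∞ (sinMode k) := by
  unfold sinMode; fun_prop

theorem mode_arg_add_single (k : Fin 3 → ℤ) (x : E3) (i : Fin 3) :
    2 * Real.pi * ∑ j, (k j : ℝ) * (x + EuclideanSpace.single i 1 : E3) j
      = 2 * Real.pi * ∑ j, (k j : ℝ) * x j + (k i : ℤ) * (2 * Real.pi) := by
  have : ∀ j, (k j : ℝ) * (x + EuclideanSpace.single i 1 : E3) j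
      = (k j : ℝ) * x j + (if j = i then (k j : ℝ) else 0) := by
    intro j
    simp only [PiLp.add_apply, PiLp.single_apply]
    split_ifs <;> ring
  simp only [this, Finset.sum_add_distrib, Finset.sum_ite_eq', Finset.mem_univ, if_true]
  ring

theorem isPeriodic_cosMode (k : Fin 3 → ℤ) : IsPeriodic (cosMode k) := by
  intro i x
  rw [cosMode, mode_arg_add_single, Real.cos_add_int_mul_two_pi, cosMode]

theorem isPeriodic_sinMode (k : Fin 3 → ℤ) : IsPeriodic (sinMode k) := by
  intro i x
  rw [sinMode, mode_arg_add_single, Real.sin_add_int_mul_two_pi, sinMode]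

theorem hasFDerivAt_mode_arg (k : Fin 3 → ℤ) (x : E3) (i : Fin 3) :
    ∃ L : E3 →L[ℝ] ℝ, HasFDerivAt (fun x : E3 => 2 * Real.pi * ∑ j, (k j : ℝ) * x j) L x ∧
      L (EuclideanSpace.single i 1) = 2 * Real.pi * k i := by
  refine ⟨(2 * Real.pi) • ∑ j, (k j : ℝ) • (EuclideanSpace.proj j : E3 →L[ℝ] ℝ), ?_, ?_⟩
  · have h := ((2 * Real.pi) • ∑ j, (k j : ℝ) • (EuclideanSpace.proj j : E3 →L[ℝ] ℝ)).hasFDerivAt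
      (x := x)
    refine h.congr_of_eventuallyEq (Eventually.of_forall fun y => ?_)
    simp
  · simp

theorem fderiv_cosMode (k : Fin 3 → ℤ) (x : E3) (i : Fin 3) :
    fderiv ℝ (cosMode k) x (EuclideanSpace.single i 1) = -(2 * Real.pi * k i) * sinMode k x := by
  obtain ⟨L, hL, hLi⟩ := hasFDerivAt_mode_arg k x i
  have h : fderiv ℝ (cosMode k) x = _ := hL.cos.fderiv
  rw [h, smul_apply, hLi, sinMode, smul_eq_mul]
  ring

theorem fderiv_sinMode (k : Fin 3 → ℤ) (x : E3) (i : Fin 3) :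
    fderiv ℝ (sinMode k) x (EuclideanSpace.single i 1) = (2 * Real.pi * k i) * cosMode k x := by
  obtain ⟨L, hL, hLi⟩ := hasFDerivAt_mode_arg k x i
  have h : fderiv ℝ (sinMode k) x = _ := hL.sin.fderiv
  rw [h, smul_apply, hLi, cosMode, smul_eq_mul]
  ring

theorem norm_fourierCoef_sq {f : E3 → ℝ} (hf : Integrable f torusMeasure) (k : Fin 3 → ℤ) :
    ‖fourierCoef f k‖ ^ 2 = (∫ x, f x * cosMode k x ∂torusMeasure) ^ 2
      + (∫ x, f x * sinMode k x ∂torusMeasure) ^ 2 := by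
  have hc : Integrable (fun x => f x * cosMode k x) torusMeasure := by
    refine hf.mul_bdd (c := 1) (contDiff_cosMode k).continuous.aestronglyMeasurable ?_
    exact Eventually.of_forall fun x => by simpa [cosMode] using Real.abs_cos_le_one _
  have hs : Integrable (fun x => f x * sinMode k x) torusMeasure := by
    refine hf.mul_bdd (c := 1) (contDiff_sinMode k).continuous.aestronglyMeasurable ?_
    exact Eventually.of_forall fun x => by simpa [sinMode] using Real.abs_sin_le_one _
  have h : fourierCoef f k = ((∫ x, f x * cosMode k x ∂torusMeasure : ℝ) : ℂ)
      - ((∫ x, f x * sinMode k x ∂torusMeasure : ℝ) : ℂ) * Complex.I := by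
    rw [fourierCoef, ← integral_complex_ofReal, ← integral_complex_ofReal, ← integral_mul_const,
      ← integral_sub hc.ofReal (hs.ofReal.mul_const _)]
    refine integral_congr_ae (Eventually.of_forall fun x => ?_)
    simp only [exp_mode]
    push_cast; ring
  rw [h, ← Complex.normSq_eq_norm_sq, Complex.normSq_apply]
  simp
  ring

end TimeAveraging

namespace TimeAveraging

/-! ### Integration in time -/

theorem aecover_Ioo_shrink (T : ℝ) :
    AECover (volume.restrict (Ioo 0 T)) atTop
      -- The shift guarantees n + 3 ≥ 2, so the interval is nonempty already for n = 0.
      fun n : ℕ => Icc (T / (n + 3)) (T - T / (n + 3)) := by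
  have h : Tendsto (fun n : ℕ => T / ((n : ℝ) + 3)) atTop (𝓝 0) :=
    tendsto_const_nhds.div_atTop
      (tendsto_atTop_add_const_right _ _ tendsto_natCast_atTop_atTop)
  refine aecover_Ioo_of_Icc h ?_
  simpa using h.const_sub T

theorem shrink_bounds {T : ℝ} (hT : 0 < T) (n : ℕ) :
    0 < T / ((n : ℝ) + 3) ∧ T / ((n : ℝ) + 3) ≤ T - T / (n + 3) ∧ T - T / (n + 3) < T := by
  have h0 : (0 : ℝ) < n + 3 := by positivity
  have h1 : 0 < T / ((n : ℝ) + 3) := by positivity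
  refine ⟨h1, ?_, by linarith⟩
  have h2 : T / ((n : ℝ) + 3) ≤ T / 2 :=
    div_le_div_of_nonneg_left hT.le two_pos (by linarith [(Nat.cast_nonneg n : (0 : ℝ) ≤ n)])
  linarith

theorem lintegral_ofReal_Ioo_le {T : ℝ} (hT : 0 < T) {g : ℝ → ℝ} (hg : ContinuousOn g (Ioo 0 T))
    (h0 : ∀ t ∈ Ioo 0 T, 0 ≤ g t) {X : ℝ}
    (hX : ∀ t₀ t₁, 0 < t₀ → t₀ ≤ t₁ → t₁ < T → ∫ t in t₀..t₁, g t ≤ X) :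
    ∫⁻ t in Ioo 0 T, ENNReal.ofReal (g t) ≤ ENNReal.ofReal X := by
  have hm : AEMeasurable (fun t => ENNReal.ofReal (g t)) (volume.restrict (Ioo 0 T)) :=
    (hg.aemeasurable measurableSet_Ioo).ennreal_ofReal
  refine le_of_tendsto
    ((aecover_Ioo_shrink T).lintegral_tendsto_of_countably_generated hm)
    (Eventually.of_forall fun n => ?_)
  obtain ⟨h1, h2, h3⟩ := shrink_bounds hT n
  have hsub : Icc (T / ((n : ℝ) + 3)) (T - T / (n + 3)) ⊆ Ioo 0 T := fun t ht =>
    ⟨h1.trans_le ht.1, ht.2.trans_lt h3⟩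
  rw [Measure.restrict_restrict measurableSet_Icc, inter_eq_left.2 hsub,
    ← ofReal_integral_eq_lintegral_ofReal]
  · refine ENNReal.ofReal_le_ofReal ?_
    rw [integral_Icc_eq_integral_Ioc, ← intervalIntegral.integral_of_le h2]
    exact hX _ _ h1 h2 h3
  · exact (hg.mono hsub).integrableOn_compact isCompact_Icc
  · filter_upwards [ae_restrict_mem measurableSet_Icc] with t ht using h0 t (hsub ht)

theorem integrableOn_Ioo_of_bound {T : ℝ} (hT : 0 < T) {g : ℝ → ℝ} (hg : ContinuousOn g (Ioo 0 T))
    (h0 : ∀ t ∈ Ioo 0 T, 0 ≤ g t) {X : ℝ}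
    (hX : ∀ t₀ t₁, 0 < t₀ → t₀ ≤ t₁ → t₁ < T → ∫ t in t₀..t₁, g t ≤ X) :
    IntegrableOn g (Ioo 0 T) := by
  refine ⟨hg.aestronglyMeasurable measurableSet_Ioo, ?_⟩
  have h := (lintegral_ofReal_Ioo_le hT hg h0 hX).trans_lt ENNReal.ofReal_lt_top
  rw [HasFiniteIntegral]
  refine lt_of_le_of_lt (le_of_eq ?_) h
  refine setLIntegral_congr_fun measurableSet_Ioo fun t ht => ?_
  exact Real.enorm_of_nonneg (h0 t ht)

theorem intervalIntegral_le_setIntegral_Ioo {T : ℝ} {g : ℝ → ℝ} (hg : IntegrableOn g (Ioo 0 T))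
    (h0 : ∀ t ∈ Ioo 0 T, 0 ≤ g t) {t₀ t₁ : ℝ} (h₀ : 0 < t₀) (h₁ : t₀ ≤ t₁) (h₂ : t₁ < T) :
    ∫ t in t₀..t₁, g t ≤ ∫ t in Ioo 0 T, g t := by
  rw [intervalIntegral.integral_of_le h₁]
  refine setIntegral_mono_set hg ?_ ?_
  · filter_upwards [ae_restrict_mem measurableSet_Ioo] with t ht using h0 t ht
  · exact Eventually.of_forall fun t ht => ⟨h₀.trans ht.1, ht.2.trans_lt h₂⟩

/-- Absolute continuity at 0: pick δ so that the integral over [δ, T/2] is within ε of its supremum.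
Any interval to the left of δ can then contribute at most ε, as the integrand is nonnegative. -/
theorem eventually_intervalIntegral_le {T : ℝ} (hT : 0 < T) {g : ℝ → ℝ}
    (hg : ContinuousOn g (Ioo 0 T)) (h0 : ∀ t ∈ Ioo 0 T, 0 ≤ g t) {X : ℝ}
    (hX : ∀ t₀ t₁, 0 < t₀ → t₀ ≤ t₁ → t₁ < T → ∫ t in t₀..t₁, g t ≤ X) {ε : ℝ} (hε : 0 < ε) :
    ∃ δ ∈ Ioo 0 T, ∀ t₀ t₁, 0 < t₀ → t₀ ≤ t₁ → t₁ ≤ δ → ∫ t in t₀..t₁, g t ≤ ε := by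
  have hI : ∀ a b, a ∈ Ioo 0 T → b ∈ Ioo 0 T → IntervalIntegrable g volume a b := fun a b ha hb =>
    (hg.mono (ordConnected_Ioo.uIcc_subset ha hb)).intervalIntegrable
  have hm : T / 2 ∈ Ioo 0 T := ⟨by positivity, by linarith⟩
  let S : Set ℝ := (fun s => ∫ t in s..(T / 2), g t) '' Ioc 0 (T / 2)
  have hne : S.Nonempty := ⟨_, T / 2, ⟨hm.1, le_rfl⟩, rfl⟩
  have hbdd : BddAbove S := ⟨X, by
    rintro _ ⟨s, hs, rfl⟩; exact hX s (T / 2) hs.1 hs.2 hm.2⟩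
  obtain ⟨_, ⟨δ, hδ, rfl⟩, hδ'⟩ := exists_lt_of_lt_csSup hne (sub_lt_self (sSup S) hε)
  have hδm : δ ∈ Ioo 0 T := ⟨hδ.1, hδ.2.trans_lt hm.2⟩
  refine ⟨δ, hδm, fun t₀ t₁ h₀ h₁ h₂ => ?_⟩
  have ht₀ : t₀ ∈ Ioo 0 T := ⟨h₀, (h₁.trans h₂).trans_lt hδm.2⟩
  have ht₁ : t₁ ∈ Ioo 0 T := ⟨h₀.trans_le h₁, h₂.trans_lt hδm.2⟩
  have hle : ∫ t in t₀..(T / 2), g t ≤ sSup S :=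
    le_csSup hbdd ⟨t₀, ⟨h₀, (h₁.trans h₂).trans hδ.2⟩, rfl⟩
  have e1 := intervalIntegral.integral_add_adjacent_intervals (hI _ _ ht₀ ht₁) (hI _ _ ht₁ hm)
  have e2 := intervalIntegral.integral_add_adjacent_intervals (hI _ _ ht₁ hδm) (hI _ _ hδm hm)
  have hpos : 0 ≤ ∫ t in t₁..δ, g t := intervalIntegral.integral_nonneg h₂ fun t ht =>
    h0 t ⟨ht₁.1.trans_le ht.1, ht.2.trans_lt hδm.2⟩
  simp only at hδ'
  linarith

namespace SmoothPer

variable {T : ℝ}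

theorem mem_Ioo_of_le {t₀ t₁ t : ℝ} (h₀ : 0 < t₀) (h₂ : t₁ < T) (ht : t ∈ Icc t₀ t₁) :
    t ∈ Ioo 0 T := ⟨h₀.trans_le ht.1, ht.2.trans_lt h₂⟩

theorem intervalIntegrable_integ (f : SmoothPer T) {t₀ t₁ : ℝ} (h₀ : 0 < t₀) (h₁ : t₀ ≤ t₁)
    (h₂ : t₁ < T) : IntervalIntegrable f.integ volume t₀ t₁ := by
  refine ContinuousOn.intervalIntegrable_of_Icc h₁ (f.continuousOn_integ.mono fun t ht => ?_)
  exact mem_Ioo_of_le h₀ h₂ ht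

/-- The space-time integral over `[t₀,t₁]`. -/
def tinteg (f : SmoothPer T) (t₀ t₁ : ℝ) : ℝ := ∫ t in t₀..t₁, f.integ t

theorem tinteg_dt (f : SmoothPer T) {t₀ t₁ : ℝ} (h₀ : 0 < t₀) (h₁ : t₀ ≤ t₁) (h₂ : t₁ < T) :
    (dt f).tinteg t₀ t₁ = f.integ t₁ - f.integ t₀ := by
  refine intervalIntegral.integral_eq_sub_of_hasDerivAt (fun t ht => ?_)
    (intervalIntegrable_integ _ h₀ h₁ h₂)
  rw [uIcc_of_le h₁] at ht
  exact f.hasDerivAt_integ (mem_Ioo_of_le h₀ h₂ ht)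

theorem tinteg_add (f g : SmoothPer T) {t₀ t₁ : ℝ} (h₀ : 0 < t₀) (h₁ : t₀ ≤ t₁) (h₂ : t₁ < T) :
    (f + g).tinteg t₀ t₁ = f.tinteg t₀ t₁ + g.tinteg t₀ t₁ := by
  rw [tinteg, tinteg, tinteg, ← intervalIntegral.integral_add
    (intervalIntegrable_integ _ h₀ h₁ h₂) (intervalIntegrable_integ _ h₀ h₁ h₂)]
  refine intervalIntegral.integral_congr fun t ht => ?_
  rw [uIcc_of_le h₁] at ht
  exact integ_add f g (mem_Ioo_of_le h₀ h₂ ht)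

theorem tinteg_smul (c : ℝ) (f : SmoothPer T) (t₀ t₁ : ℝ) :
    (c • f).tinteg t₀ t₁ = c * f.tinteg t₀ t₁ := by
  simp only [tinteg, integ_smul, intervalIntegral.integral_const_mul]

theorem tinteg_sub (f g : SmoothPer T) {t₀ t₁ : ℝ} (h₀ : 0 < t₀) (h₁ : t₀ ≤ t₁) (h₂ : t₁ < T) :
    (f - g).tinteg t₀ t₁ = f.tinteg t₀ t₁ - g.tinteg t₀ t₁ := by
  have h : f - g = f + (-1 : ℝ) • g := by rw [neg_smul, one_smul, sub_eq_add_neg]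
  rw [h, tinteg_add _ _ h₀ h₁ h₂, tinteg_smul]
  ring

theorem tinteg_congr {f g : SmoothPer T} {t₀ t₁ : ℝ} (h₀ : 0 < t₀) (h₁ : t₀ ≤ t₁) (h₂ : t₁ < T)
    (h : ∀ t ∈ Ioo 0 T, f.integ t = g.integ t) : f.tinteg t₀ t₁ = g.tinteg t₀ t₁ := by
  refine intervalIntegral.integral_congr fun t ht => ?_
  rw [uIcc_of_le h₁] at ht
  exact h t (mem_Ioo_of_le h₀ h₂ ht)

theorem tinteg_mono {f g : SmoothPer T} {t₀ t₁ : ℝ} (h₀ : 0 < t₀) (h₁ : t₀ ≤ t₁) (h₂ : t₁ < T)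
    (h : ∀ t ∈ Ioo 0 T, ∀ x, f.val t x ≤ g.val t x) : f.tinteg t₀ t₁ ≤ g.tinteg t₀ t₁ :=
  intervalIntegral.integral_mono_on h₁ (intervalIntegrable_integ _ h₀ h₁ h₂)
    (intervalIntegrable_integ _ h₀ h₁ h₂) fun t ht =>
      integ_mono (mem_Ioo_of_le h₀ h₂ ht) (h t (mem_Ioo_of_le h₀ h₂ ht))

theorem tinteg_nonneg {f : SmoothPer T} {t₀ t₁ : ℝ} (h₁ : t₀ ≤ t₁)
    (h : ∀ t x, 0 ≤ f.val t x) : 0 ≤ f.tinteg t₀ t₁ :=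
  intervalIntegral.integral_nonneg h₁ fun t _ => integ_nonneg (h t)

/-- The space-time integral of `f` over any `[t₀,t₁] ⊆ (0,T)` is at most `X`. -/
def TBound (f : SmoothPer T) (X : ℝ) : Prop :=
  ∀ ⦃t₀ t₁ : ℝ⦄, 0 < t₀ → t₀ ≤ t₁ → t₁ < T → f.tinteg t₀ t₁ ≤ X

theorem TBound.mono {f g : SmoothPer T} {X : ℝ} (hg : TBound g X)
    (h : ∀ t ∈ Ioo 0 T, ∀ x, f.val t x ≤ g.val t x) : TBound f X := fun _ _ h₀ h₁ h₂ =>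
  (tinteg_mono h₀ h₁ h₂ h).trans (hg h₀ h₁ h₂)

theorem TBound.add {f g : SmoothPer T} {X Y : ℝ} (hf : TBound f X) (hg : TBound g Y) :
    TBound (f + g) (X + Y) := fun _ _ h₀ h₁ h₂ => by
  rw [tinteg_add _ _ h₀ h₁ h₂]; exact add_le_add (hf h₀ h₁ h₂) (hg h₀ h₁ h₂)

theorem TBound.smul {f : SmoothPer T} {X c : ℝ} (hf : TBound f X) (hc : 0 ≤ c) :
    TBound (c • f) (c * X) := fun _ _ h₀ h₁ h₂ => by
  rw [tinteg_smul]; exact mul_le_mul_of_nonneg_left (hf h₀ h₁ h₂) hc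

theorem TBound.le {f : SmoothPer T} {X Y : ℝ} (hf : TBound f X) (hXY : X ≤ Y) : TBound f Y :=
  fun _ _ h₀ h₁ h₂ => (hf h₀ h₁ h₂).trans hXY

/-! ### Fourier coefficients and Sobolev norms -/

/-- The real Fourier mode as an element of the algebra. -/
def cosEl (k : Fin 3 → ℤ) : SmoothPer T :=
  mk (fun _ x => cosMode k x) ((contDiff_cosMode k).comp contDiff_snd).contDiffOn
    fun _ _ => isPeriodic_cosMode k

/-- The imaginary Fourier mode as an element of the algebra. -/
def sinEl (k : Fin 3 → ℤ) : SmoothPer T :=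
  mk (fun _ x => sinMode k x) ((contDiff_sinMode k).comp contDiff_snd).contDiffOn
    fun _ _ => isPeriodic_sinMode k

theorem val_cosEl (k : Fin 3 → ℤ) {t : ℝ} (ht : t ∈ Ioo 0 T) (x : E3) :
    (cosEl k : SmoothPer T).val t x = cosMode k x := val_mk _ _ _ ht x

theorem val_sinEl (k : Fin 3 → ℤ) {t : ℝ} (ht : t ∈ Ioo 0 T) (x : E3) :
    (sinEl k : SmoothPer T).val t x = sinMode k x := val_mk _ _ _ ht x

theorem dx_cosEl (i : Fin 3) (k : Fin 3 → ℤ) :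
    dx i (cosEl k : SmoothPer T) = -(cst (2 * Real.pi * k i) * sinEl k) := by
  ext t ht x
  have h : (cosEl k : SmoothPer T).val t = cosMode k := funext (val_cosEl k ht)
  rw [val_dx _ _ ht, h, fderiv_cosMode, val_neg, val_mul, val_algebraMap _ ht, val_sinEl k ht]
  ring

theorem dx_sinEl (i : Fin 3) (k : Fin 3 → ℤ) :
    dx i (sinEl k : SmoothPer T) = cst (2 * Real.pi * k i) * cosEl k := by
  ext t ht x
  have h : (sinEl k : SmoothPer T).val t = sinMode k := funext (val_sinEl k ht)
  rw [val_dx _ _ ht, h, fderiv_sinMode, val_mul, val_algebraMap _ ht, val_cosEl k ht]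

theorem dt_cosEl (k : Fin 3 → ℤ) : dt (cosEl k : SmoothPer T) = 0 := by
  ext t ht x
  have h := (cosEl k : SmoothPer T).hasDerivAt_val ht x
  have h2 : HasDerivAt (fun s => (cosEl k : SmoothPer T).val s x) 0 t := by
    refine (hasDerivAt_const t (cosMode k x)).congr_of_eventuallyEq ?_
    filter_upwards [isOpen_Ioo.mem_nhds ht] with s hs using val_cosEl k hs x
  rw [h.unique h2, val_zero]

theorem dt_sinEl (k : Fin 3 → ℤ) : dt (sinEl k : SmoothPer T) = 0 := by
  ext t ht x
  have h := (sinEl k : SmoothPer T).hasDerivAt_val ht x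
  have h2 : HasDerivAt (fun s => (sinEl k : SmoothPer T).val s x) 0 t := by
    refine (hasDerivAt_const t (sinMode k x)).congr_of_eventuallyEq ?_
    filter_upwards [isOpen_Ioo.mem_nhds ht] with s hs using val_sinEl k hs x
  rw [h.unique h2, val_zero]

/-- The squared modulus of the `k`-th Fourier coefficient. -/
def coefSq (f : SmoothPer T) (k : Fin 3 → ℤ) (t : ℝ) : ℝ :=
  (f * cosEl k).integ t ^ 2 + (f * sinEl k).integ t ^ 2

theorem coefSq_nonneg (f : SmoothPer T) (k : Fin 3 → ℤ) (t : ℝ) : 0 ≤ coefSq f k t := by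
  unfold coefSq; positivity

theorem norm_fourierCoef_val_sq (f : SmoothPer T) (k : Fin 3 → ℤ) {t : ℝ} (ht : t ∈ Ioo 0 T) :
    ‖fourierCoef (f.val t) k‖ ^ 2 = coefSq f k t := by
  rw [norm_fourierCoef_sq (f.integrable_val ht), coefSq]
  simp only [integ, val_mul, val_cosEl k ht, val_sinEl k ht]

theorem memLp_val (f : SmoothPer T) {t : ℝ} (ht : t ∈ Ioo 0 T) :
    MemLp (f.val t) 2 torusMeasure := by
  rw [memLp_two_iff_integrable_sq (f.continuous_val ht).aestronglyMeasurable]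
  have h := (f ^ 2).integrable_val ht
  rwa [funext fun x => val_sq f t x] at h

theorem hasSum_coefSq (f : SmoothPer T) {t : ℝ} (ht : t ∈ Ioo 0 T) :
    HasSum (fun k => coefSq f k t) ((f ^ 2).integ t) := by
  have h := hasSum_norm_fourierCoef_sq (f.memLp_val ht)
  simp only [norm_fourierCoef_val_sq f _ ht] at h
  simpa [integ] using h

theorem integ_cst_mul (c : ℝ) (f : SmoothPer T) (t : ℝ) :
    (cst c * f).integ t = c * f.integ t := by
  rw [← Algebra.smul_def, integ_smul]

theorem integ_dx_mul (i : Fin 3) (f g : SmoothPer T) {t : ℝ} (ht : t ∈ Ioo 0 T) :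
    (dx i f * g).integ t = -(f * dx i g).integ t := by
  have h := integ_dx i (f * g) ht
  rw [dx_mul, integ_add _ _ ht] at h
  linarith

/-- Integration by parts interchanges the cosine and sine coefficients up to sign and the factor
2πkᵢ, so the sum of their squares is merely rescaled. -/
theorem coefSq_dx (i : Fin 3) (f : SmoothPer T) (k : Fin 3 → ℤ) {t : ℝ} (ht : t ∈ Ioo 0 T) :
    coefSq (dx i f) k t = (2 * Real.pi * k i) ^ 2 * coefSq f k t := by
  have h1 : f * -(cst (2 * Real.pi * k i) * sinEl k) = -(cst (2 * Real.pi * k i) * (f * sinEl k)) := by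
    ring
  have h2 : f * (cst (2 * Real.pi * k i) * cosEl k) = cst (2 * Real.pi * k i) * (f * cosEl k) := by
    ring
  rw [coefSq, coefSq, integ_dx_mul i _ _ ht, integ_dx_mul i _ _ ht, dx_cosEl, dx_sinEl, h1, h2,
    integ_neg, integ_cst_mul, integ_cst_mul]
  ring

/-- The eigenvalue `|2πk|²` of the negative Laplacian. -/
def freqSq (k : Fin 3 → ℤ) : ℝ := ∑ i, (2 * Real.pi * (k i : ℝ)) ^ 2

theorem freqSq_nonneg (k : Fin 3 → ℤ) : 0 ≤ freqSq k := by
  unfold freqSq; positivity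

/-- The squared length of the tensor of `m`-th spatial derivatives. -/
def sobDens : ℕ → SmoothPer T → SmoothPer T
  | 0, f => f ^ 2
  | m + 1, f => ∑ i, sobDens m (dx i f)

theorem hasSum_sobDens (m : ℕ) (f : SmoothPer T) {t : ℝ} (ht : t ∈ Ioo 0 T) :
    HasSum (fun k => freqSq k ^ m * coefSq f k t) ((sobDens m f).integ t) := by
  induction m generalizing f with
  | zero => simpa [sobDens] using hasSum_coefSq f ht
  | succ m ih =>
    rw [sobDens, integ_sum _ _ ht]
    have h := hasSum_sum (s := Finset.univ) fun i (_ : i ∈ Finset.univ) => ih (dx i f)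
    refine h.congr_fun fun k => ?_
    simp only [coefSq_dx _ _ _ ht, freqSq, pow_succ, Finset.mul_sum, Finset.sum_mul]
    refine Finset.sum_congr rfl fun i _ => ?_
    ring

theorem sobDens_nonneg (m : ℕ) (f : SmoothPer T) (t : ℝ) (x : E3) : 0 ≤ (sobDens m f).val t x := by
  induction m generalizing f with
  | zero => rw [sobDens, val_sq]; positivity
  | succ m ih => rw [sobDens, val_sum]; exact Finset.sum_nonneg fun i _ => ih _

/-- Testing the equation with a Fourier mode gives diffusive damping at rate κ|2πk|², and an
advection term in which the derivative falls on the mode and costs 2πkⱼ. Young's inequality spends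
the whole damping on this factor and leaves the coefficients of uⱼf undifferentiated, so order m for
f near time 0 only needs order m for uf, integrated in time. -/
theorem coefSq_deriv_le {u : Fin 3 → SmoothPer T} (hu : ∑ j, dx j (u j) = 0) {κ : ℝ} (hκ : 0 < κ)
    {f : SmoothPer T} (hf : matD u f = divGrad (cst κ) f) (k : Fin 3 → ℤ) {t : ℝ}
    (ht : t ∈ Ioo 0 T) :
    ∃ d, HasDerivAt (coefSq f k) d t ∧ d ≤ (1 / (2 * κ)) * ∑ j, coefSq (u j * f) k t := by
  set c : SmoothPer T := cosEl k with hc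
  set s : SmoothPer T := sinEl k with hs
  have hα : (dt (f * c)).integ t = -(κ * freqSq k) * (f * c).integ t
      - ∑ j, (2 * Real.pi * k j) * (u j * f * s).integ t := by
    have h1 : (dt (f * c)).integ t = (cst (-(κ * freqSq k)) * (f * c)
        - ∑ j, cst (2 * Real.pi * k j) * (u j * f * s)).integ t := by
      rw [integ_matD hu _ ht, matD_mul, hf]
      refine integ_eq_of_eq_add_div (fun j => cst κ * dx j f * c
        + cst κ * f * (cst (2 * Real.pi * k j) * s)) ?_ ht
      rw [matD_apply u c, hc, dt_cosEl, ← hc]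
      simp only [divGrad, Fin.sum_univ_three, map_add, dx_mul, dx_cst, hc, hs, dx_cosEl, dx_sinEl]
      simp only [freqSq, cst, Fin.sum_univ_three, map_neg, map_mul, map_add, map_pow]
      ring
    rw [h1, integ_sub _ _ ht, integ_cst_mul, integ_sum _ _ ht]
    simp only [integ_cst_mul]
  have hβ : (dt (f * s)).integ t = -(κ * freqSq k) * (f * s).integ t
      + ∑ j, (2 * Real.pi * k j) * (u j * f * c).integ t := by
    have h1 : (dt (f * s)).integ t = (cst (-(κ * freqSq k)) * (f * s)
        + ∑ j, cst (2 * Real.pi * k j) * (u j * f * c)).integ t := by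
      rw [integ_matD hu _ ht, matD_mul, hf]
      refine integ_eq_of_eq_add_div (fun j => cst κ * dx j f * s
        - cst κ * f * (cst (2 * Real.pi * k j) * c)) ?_ ht
      rw [matD_apply u s, hs, dt_sinEl, ← hs]
      simp only [divGrad, Fin.sum_univ_three, map_sub, dx_mul, dx_cst, hc, hs, dx_cosEl, dx_sinEl]
      simp only [freqSq, cst, Fin.sum_univ_three, map_neg, map_mul, map_add, map_pow]
      ring
    rw [h1, integ_add _ _ ht, integ_cst_mul, integ_sum _ _ ht]
    simp only [integ_cst_mul]
  refine ⟨_, (((f * c).hasDerivAt_integ ht).pow 2).add (((f * s).hasDerivAt_integ ht).pow 2), ?_⟩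
  rw [hα, hβ]
  simp only [coefSq, freqSq, Fin.sum_univ_three, ← hc, ← hs]
  generalize (f * c).integ t = α
  generalize (f * s).integ t = β
  -- Young's inequality in the form of two completed squares; `n` stands for 2πkⱼ.
  have key : ∀ n p q : ℝ, 2 * n * (β * p - α * q)
      ≤ 2 * κ * n ^ 2 * (α ^ 2 + β ^ 2) + (1 / (2 * κ)) * (p ^ 2 + q ^ 2) := by
    intro n p q
    have e : 2 * κ * n ^ 2 * (α ^ 2 + β ^ 2) + (1 / (2 * κ)) * (p ^ 2 + q ^ 2)
        - 2 * n * (β * p - α * q)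
        = (1 / (2 * κ)) * ((2 * κ * n * β - p) ^ 2 + (2 * κ * n * α + q) ^ 2) := by
      field_simp; ring
    have : 0 ≤ (1 / (2 * κ)) * ((2 * κ * n * β - p) ^ 2 + (2 * κ * n * α + q) ^ 2) := by positivity
    linarith
  have k0 := key (2 * Real.pi * k 0) ((u 0 * f * c).integ t) ((u 0 * f * s).integ t)
  have k1 := key (2 * Real.pi * k 1) ((u 1 * f * c).integ t) ((u 1 * f * s).integ t)
  have k2 := key (2 * Real.pi * k 2) ((u 2 * f * c).integ t) ((u 2 * f * s).integ t)
  norm_num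
  norm_num at k0 k1 k2
  linarith

/-- The Sobolev norm of a solution near the initial time is at most that of the datum, up to a
small error. -/
theorem eventually_sobDens_le (hT : 0 < T) {u : Fin 3 → SmoothPer T} (hu : ∑ j, dx j (u j) = 0)
    {κ : ℝ} (hκ : 0 < κ) {f : SmoothPer T} (hf : matD u f = divGrad (cst κ) f) (m : ℕ)
    {f₀ : E3 → ℝ}
    (hlim : ∀ k, Tendsto (coefSq f k) (𝓝[>] 0) (𝓝 (‖fourierCoef f₀ k‖ ^ 2)))
    {S : ℝ} (hS0 : 0 ≤ S) (hS : sobolevSq m f₀ ≤ ENNReal.ofReal S) {X : ℝ}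
    (hX : TBound (∑ j, sobDens m (u j * f)) X) {ε : ℝ} (hε : 0 < ε) :
    ∀ᶠ t in 𝓝[>] (0 : ℝ), (sobDens m f).integ t ≤ S + ε := by
  set P := ∑ j, sobDens m (u j * f) with hP
  have hP0 : ∀ t x, 0 ≤ P.val t x := fun t x => by
    rw [hP, val_sum]; exact Finset.sum_nonneg fun j _ => sobDens_nonneg _ _ _ _
  -- The tolerance 2κε compensates the factor 1/(2κ) in `coefSq_deriv_le`.
  obtain ⟨δ, hδ, hδ'⟩ := eventually_intervalIntegral_le hT P.continuousOn_integ
    (fun t _ => integ_nonneg (hP0 t)) hX (mul_pos (mul_pos two_pos hκ) hε)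
  have hfin : ∀ F : Finset (Fin 3 → ℤ), ∑ k ∈ F, freqSq k ^ m * ‖fourierCoef f₀ k‖ ^ 2 ≤ S := by
    intro F
    have h1 : ENNReal.ofReal (∑ k ∈ F, freqSq k ^ m * ‖fourierCoef f₀ k‖ ^ 2)
        ≤ sobolevSq m f₀ := by
      rw [ENNReal.ofReal_sum_of_nonneg fun k _ =>
        mul_nonneg (pow_nonneg (freqSq_nonneg k) m) (by positivity)]
      refine le_trans (Finset.sum_le_sum fun k _ => ENNReal.ofReal_le_ofReal ?_)
        (ENNReal.sum_le_tsum F)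
      gcongr
      · exact freqSq_nonneg k
      · rw [freqSq]; linarith
    exact (ENNReal.ofReal_le_ofReal_iff hS0).1 (h1.trans hS)
  have hmem : Ioc (0 : ℝ) δ ∈ 𝓝[>] (0 : ℝ) := Ioc_mem_nhdsGT hδ.1
  filter_upwards [hmem] with t ht
  have htT : t ∈ Ioo 0 T := ⟨ht.1, ht.2.trans_lt hδ.2⟩
  -- Only finitely many modes are followed at a time. Each coefficient converges as s → 0 by L²
  -- continuity, whereas continuity of the full Sobolev norm at 0 is not known.
  refine hasSum_le_of_sum_le (hasSum_sobDens m f htT) fun F => ?_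
  have hlimF : Tendsto (fun s => ∑ k ∈ F, freqSq k ^ m * coefSq f k s + ε) (𝓝[>] 0)
      (𝓝 (∑ k ∈ F, freqSq k ^ m * ‖fourierCoef f₀ k‖ ^ 2 + ε)) :=
    (tendsto_finsetSum _ fun k _ => (hlim k).const_mul _).add_const ε
  refine le_trans (ge_of_tendsto hlimF ?_) (add_le_add_left (hfin F) ε)
  filter_upwards [Ioo_mem_nhdsGT ht.1] with s hs
  have hder : ∀ r ∈ Ioo 0 T, ∃ d,
      HasDerivAt (fun r => ∑ k ∈ F, freqSq k ^ m * coefSq f k r) d r ∧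
        d ≤ (1 / (2 * κ)) * P.integ r := by
    intro r hr
    choose d hd hd' using fun k => coefSq_deriv_le hu hκ hf k hr
    refine ⟨∑ k ∈ F, freqSq k ^ m * d k,
      HasDerivAt.fun_sum fun k _ => (hd k).const_mul _, ?_⟩
    calc ∑ k ∈ F, freqSq k ^ m * d k
        ≤ ∑ k ∈ F, freqSq k ^ m * ((1 / (2 * κ)) * ∑ j, coefSq (u j * f) k r) :=
          Finset.sum_le_sum fun k _ =>
            mul_le_mul_of_nonneg_left (hd' k) (pow_nonneg (freqSq_nonneg k) m)
      _ = (1 / (2 * κ)) * ∑ j, ∑ k ∈ F, freqSq k ^ m * coefSq (u j * f) k r := by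
          rw [Finset.sum_comm, Finset.mul_sum]
          refine Finset.sum_congr rfl fun k _ => ?_
          rw [← Finset.mul_sum]; ring
      _ ≤ (1 / (2 * κ)) * P.integ r := by
          refine mul_le_mul_of_nonneg_left ?_ (by positivity)
          rw [hP, integ_sum _ _ hr]
          exact Finset.sum_le_sum fun j _ => sum_le_hasSum F
            (fun k _ => mul_nonneg (pow_nonneg (freqSq_nonneg k) m) (coefSq_nonneg _ _ _))
            (hasSum_sobDens m (u j * f) hr)
  choose! d hd hd' using hder
  have hIcc : ∀ r ∈ Icc s t, r ∈ Ioo 0 T := fun r hr => mem_Ioo_of_le hs.1 htT.2 hr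
  have hle := intervalIntegral.sub_le_integral_of_hasDeriv_right_of_le hs.2.le
    (g := fun r => ∑ k ∈ F, freqSq k ^ m * coefSq f k r) (g' := d)
    (φ := fun r => (1 / (2 * κ)) * P.integ r)
    (fun r hr => (hd r (hIcc r hr)).continuousAt.continuousWithinAt)
    (fun r hr => (hd r (hIcc r (Ioo_subset_Icc_self hr))).hasDerivWithinAt)
    ((continuousOn_const.mul (P.continuousOn_integ.mono hIcc)).integrableOn_Icc)
    (fun r hr => hd' r (hIcc r (Ioo_subset_Icc_self hr)))
  have hsm := hδ' s t hs.1 hs.2.le ht.2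
  rw [intervalIntegral.integral_const_mul] at hle
  have h3 : (1 / (2 * κ)) * ∫ r in s..t, P.integ r ≤ (1 / (2 * κ)) * (2 * κ * ε) :=
    mul_le_mul_of_nonneg_left hsm (by positivity)
  have h4 : (1 / (2 * κ)) * (2 * κ * ε) = ε := by field_simp
  linarith

end SmoothPer

end TimeAveraging

namespace TimeAveraging

/-! ### Smooth dependence of integrals on parameters -/

theorem hasFDerivAt_left_of_contDiffOn {H F : Type*} [NormedAddCommGroup H] [NormedSpace ℝ H]
    [NormedAddCommGroup F] [NormedSpace ℝ F] {U : Set H} (hU : IsOpen U) {f : H × ℝ → F}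
    (hf : ContDiffOn ℝ ∞ f (U ×ˢ univ)) {q : H} (hq : q ∈ U) (s : ℝ) :
    HasFDerivAt (fun q => f (q, s))
      ((fderiv ℝ f (q, s)).comp (ContinuousLinearMap.inl ℝ H ℝ)) q := by
  have h1 : HasFDerivAt f (fderiv ℝ f (q, s)) (q, s) :=
    ((hf.contDiffAt ((hU.prod isOpen_univ).mem_nhds ⟨hq, trivial⟩)).differentiableAt
      (by simp)).hasFDerivAt
  exact h1.comp q (hasFDerivAt_prodMk_left q s)

theorem continuousOn_fderiv_left {H F : Type*} [NormedAddCommGroup H] [NormedSpace ℝ H]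
    [NormedAddCommGroup F] [NormedSpace ℝ F] {U : Set H} (hU : IsOpen U) {f : H × ℝ → F}
    (hf : ContDiffOn ℝ ∞ f (U ×ˢ univ)) :
    ContinuousOn (fun p : H × ℝ => fderiv ℝ (fun q => f (q, p.2)) p.1) (U ×ˢ univ) := by
  have hc : ContinuousOn (fderiv ℝ f) (U ×ˢ univ) :=
    hf.continuousOn_fderiv_of_isOpen (hU.prod isOpen_univ) (by simp)
  have hc2 : ContinuousOn (fun p => (fderiv ℝ f p).comp (ContinuousLinearMap.inl ℝ H ℝ))
    (U ×ˢ univ) := hc.clm_comp continuousOn_const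
  exact hc2.congr fun p hp => (hasFDerivAt_left_of_contDiffOn hU hf hp.1 p.2).fderiv

theorem hasFDerivAt_intervalIntegral_param {H F : Type*} [NormedAddCommGroup H] [NormedSpace ℝ H]
    [NormedAddCommGroup F] [NormedSpace ℝ F] {U : Set H} (hU : IsOpen U) {f : H × ℝ → F}
    (hf : ContDiffOn ℝ ∞ f (U ×ˢ univ)) {a b : ℝ} (hab : a ≤ b) {q : H} (hq : q ∈ U) :
    HasFDerivAt (fun q => ∫ s in a..b, f (q, s))
      (∫ s in a..b, fderiv ℝ (fun q => f (q, s)) q) q := by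
  simp only [intervalIntegral.integral_of_le hab]
  refine hasFDerivAt_integral_of_continuousOn (ν := volume.restrict (Ioc a b))
    (isCompact_Icc (a := a) (b := b)) ?_ hU (f := fun q s => f (q, s))
    (f' := fun q s => fderiv ℝ (fun q => f (q, s)) q) ?_ ?_ ?_ hq
  · filter_upwards [ae_restrict_mem measurableSet_Ioc] with s hs using Ioc_subset_Icc_self hs
  · intro q hq
    exact hf.continuousOn.comp_continuous (f := fun s : ℝ => (q, s)) (by fun_prop)
      fun s => ⟨hq, trivial⟩
  · intro q hq s
    exact (hasFDerivAt_left_of_contDiffOn hU hf hq s).differentiableAt.hasFDerivAt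
  · exact continuousOn_fderiv_left hU hf

/-- Induction on the order. The target space is generalized because the derivative is an integral of
the same kind with values in continuous linear maps. -/
theorem contDiffOn_nat_integral_param {H : Type} [NormedAddCommGroup H] [NormedSpace ℝ H]
    {U : Set H} (hU : IsOpen U) (n : ℕ) : ∀ {F : Type} [NormedAddCommGroup F] [NormedSpace ℝ F]
    {f : H × ℝ → F}, ContDiffOn ℝ ∞ f (U ×ˢ univ) →
      ContDiffOn ℝ n (fun q => ∫ s in (0 : ℝ)..1, f (q, s)) U := by
  induction n with
  | zero =>
    intro F _ _ f hf
    refine contDiffOn_zero.2 fun q hq => ?_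
    exact (hasFDerivAt_intervalIntegral_param hU hf zero_le_one hq).continuousAt.continuousWithinAt
  | succ n ih =>
    intro F _ _ f hf
    have hopen : IsOpen (U ×ˢ (univ : Set ℝ)) := hU.prod isOpen_univ
    have h := fun q hq => hasFDerivAt_intervalIntegral_param hU hf zero_le_one (q := q) hq
    rw [Nat.cast_succ, contDiffOn_succ_iff_fderiv_of_isOpen hU]
    refine ⟨fun q hq => (h q hq).differentiableAt.differentiableWithinAt, by simp, ?_⟩
    refine (ih (f := fun p => (fderiv ℝ f p).comp (ContinuousLinearMap.inl ℝ H ℝ)) ?_).congr ?_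
    · exact (hf.fderiv_of_isOpen hopen (by simp)).clm_comp contDiffOn_const
    · intro q hq
      rw [(h q hq).fderiv]
      refine intervalIntegral.integral_congr fun s _ => ?_
      exact (hasFDerivAt_left_of_contDiffOn hU hf hq s).fderiv

/-- The substitution s = q.2 · r moves the variable endpoint into the integrand, so differentiation
under an integral over the fixed interval [0,1] applies. -/
theorem contDiffOn_primitive {H : Type} [NormedAddCommGroup H] [NormedSpace ℝ H]
    {U : Set H} (hU : IsOpen U) {f : H × ℝ → ℝ} (hf : ContDiffOn ℝ ∞ f (U ×ˢ univ)) :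
    ContDiffOn ℝ ∞ (fun q : H × ℝ => ∫ s in (0 : ℝ)..q.2, f (q.1, s)) (U ×ˢ univ) := by
  have h : ∀ q : H × ℝ, ∫ s in (0 : ℝ)..q.2, f (q.1, s)
      = ∫ r in (0 : ℝ)..1, q.2 * f (q.1, q.2 * r) := fun q => by
    rw [intervalIntegral.integral_const_mul,
      intervalIntegral.mul_integral_comp_mul_left (f := fun s => f (q.1, s))]
    simp
  simp only [h]
  rw [contDiffOn_infty]
  intro n
  refine contDiffOn_nat_integral_param (hU.prod isOpen_univ) n
    (f := fun p : (H × ℝ) × ℝ => p.1.2 * f (p.1.1, p.1.2 * p.2)) ?_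
  refine ContDiffOn.mul (by fun_prop) (hf.comp (by fun_prop) ?_)
  intro p hp
  exact ⟨hp.1.1, trivial⟩

/-! ### The primitive of the oscillation profile in the fast time -/

section Corrector

variable {T : ℝ} {η : E3 → ℝ → ℝ → ℝ}

/-- The profile as a function of `((t,x),s)`. -/
def profFun (η : E3 → ℝ → ℝ → ℝ) (p : (ℝ × E3) × ℝ) : ℝ := η p.1.2 p.1.1 p.2

theorem IsProfile.contDiffOn_profFun (hη : IsProfile T η) :
    ContDiffOn ℝ ∞ (profFun η) (slab T ×ˢ univ) := by
  refine hη.smooth.comp (f := fun p : (ℝ × E3) × ℝ => (p.1.2, p.1.1, p.2)) (by fun_prop) ?_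
  intro p hp
  exact ⟨trivial, Ioo_subset_Icc_self hp.1.1, trivial⟩

theorem IsProfile.continuous_fast (hη : IsProfile T η) {t : ℝ} (ht : t ∈ Ioo 0 T) (x : E3) :
    Continuous (η x t) :=
  hη.contDiffOn_profFun.continuousOn.comp_continuous (f := fun s : ℝ => ((t, x), s)) (by fun_prop)
    fun _ => ⟨mem_slab ht x, trivial⟩

/-- Whole periods contribute nothing to a primitive of a mean-zero periodic function. With `n` the
integer part of `b`, the interval has length at most 1, and bounds uniform in t/τ follow. -/
theorem IsProfile.integral_sub_one (hη : IsProfile T η) {t : ℝ} (ht : t ∈ Ioo 0 T) (x : E3)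
    (n : ℤ) (b : ℝ) :
    ∫ s in (0 : ℝ)..b, (η x t s - 1) = ∫ s in (n : ℝ)..b, (η x t s - 1) := by
  have hc : Continuous fun s => η x t s - 1 := (hη.continuous_fast ht x).sub continuous_const
  have hper : Function.Periodic (fun s => η x t s - 1) 1 := fun s => by
    simp only [hη.periodic_fast t (Ioo_subset_Icc_self ht) x s]
  have h0 : ∫ s in (0 : ℝ)..1, (η x t s - 1) = 0 := by
    rw [intervalIntegral.integral_sub ((hη.continuous_fast ht x).intervalIntegrable _ _)
      (by simp), hη.mean t (Ioo_subset_Icc_self ht) x]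
    simp
  have hz := hper.intervalIntegral_add_zsmul_eq n 0 (fun a b => hc.intervalIntegrable a b)
  simp only [zero_add, h0, zsmul_eq_mul, mul_one, mul_zero] at hz
  rw [← intervalIntegral.integral_add_adjacent_intervals (hc.intervalIntegrable 0 (n : ℝ))
    (hc.intervalIntegrable (n : ℝ) b), hz, zero_add]

/-- The profile evaluated along the fast time `t/τ`. -/
def IsProfile.osc (hη : IsProfile T η) (τ : ℝ) : SmoothPer T :=
  SmoothPer.mk (fun t x => η x t (t / τ))
    (hη.contDiffOn_profFun.comp (f := fun p : ℝ × E3 => (p, p.1 / τ))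
      (contDiff_id.prodMk (contDiff_fst.div_const τ)).contDiffOn fun _ hp => ⟨hp, trivial⟩)
    fun t ht => hη.periodic t (Ioo_subset_Icc_self ht) (t / τ)

theorem IsProfile.val_osc (hη : IsProfile T η) (τ : ℝ) {t : ℝ} (ht : t ∈ Ioo 0 T) (x : E3) :
    (hη.osc τ).val t x = η x t (t / τ) := SmoothPer.val_mk _ _ _ ht x

theorem IsProfile.contDiffOn_primitive (hη : IsProfile T η) :
    ContDiffOn ℝ ∞ (fun q : (ℝ × E3) × ℝ => ∫ s in (0 : ℝ)..q.2, (profFun η (q.1, s) - 1))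
      (slab T ×ˢ univ) :=
  TimeAveraging.contDiffOn_primitive (isOpen_slab T) (f := fun q => profFun η q - 1)
    (hη.contDiffOn_profFun.sub contDiffOn_const)

theorem IsProfile.contDiffOn_corrector (hη : IsProfile T η) (τ : ℝ) :
    ContDiffOn ℝ ∞ (fun p : ℝ × E3 => 1 + ∫ s in (0 : ℝ)..(p.1 / τ), (η p.2 p.1 s - 1))
      (slab T) :=
  contDiffOn_const.add
    (hη.contDiffOn_primitive.comp (f := fun p : ℝ × E3 => (p, p.1 / τ))
      (contDiff_id.prodMk (contDiff_fst.div_const τ)).contDiffOn fun _ hp => ⟨hp, trivial⟩)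

/-- The nonnegative primitive `1 + ∫₀^{t/τ} (η(x,t,s) - 1) ds`. -/
def IsProfile.corrector (hη : IsProfile T η) (τ : ℝ) : SmoothPer T :=
  SmoothPer.mk (fun t x => 1 + ∫ s in (0 : ℝ)..(t / τ), (η x t s - 1))
    (hη.contDiffOn_corrector τ)
    fun t ht i x => by
      have h : ∀ s, η (x + EuclideanSpace.single i 1) t s = η x t s := fun s =>
        hη.periodic t (Ioo_subset_Icc_self ht) s i x
      simp only [h]

theorem IsProfile.val_corrector_eq (hη : IsProfile T η) (τ : ℝ) {t : ℝ} (ht : t ∈ Ioo 0 T)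
    (x : E3) : (hη.corrector τ).val t x = 1 + ∫ s in (0 : ℝ)..(t / τ), (η x t s - 1) :=
  SmoothPer.val_mk _ _ _ ht x

theorem IsProfile.val_corrector (hη : IsProfile T η) (τ : ℝ) {t : ℝ} (ht : t ∈ Ioo 0 T) (x : E3) :
    (hη.corrector τ).val t x
      = 1 + ∫ s in (⌊t / τ⌋ : ℝ)..(t / τ), (η x t s - 1) := by
  rw [hη.val_corrector_eq τ ht, hη.integral_sub_one ht x ⌊t / τ⌋]

theorem fract_bounds (b : ℝ) : (⌊b⌋ : ℝ) ≤ b ∧ b - ⌊b⌋ ≤ 1 :=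
  ⟨Int.floor_le b, by linarith [Int.lt_floor_add_one b]⟩

/-- Over the last incomplete period the integral of η is nonnegative and that of 1 is at most 1, so
the primitive is at least -1. The added constant 1 in the corrector makes it nonnegative, as the
weighted energy requires. -/
theorem IsProfile.corrector_bounds (hη : IsProfile T η) (τ : ℝ) {M : ℝ}
    (hM : ∀ t ∈ Ioo 0 T, ∀ x s, η x t s ≤ M) {t : ℝ} (ht : t ∈ Ioo 0 T) (x : E3) :
    0 ≤ (hη.corrector τ).val t x ∧ (hη.corrector τ).val t x ≤ 1 + M := by
  obtain ⟨h1, h2⟩ := fract_bounds (t / τ)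
  rw [hη.val_corrector τ ht]
  have hc := hη.continuous_fast ht x
  rw [intervalIntegral.integral_sub (hc.intervalIntegrable _ _) (by simp)]
  have hlo : 0 ≤ ∫ s in (⌊t / τ⌋ : ℝ)..(t / τ), η x t s :=
    intervalIntegral.integral_nonneg h1 fun s _ => hη.nonneg t (Ioo_subset_Icc_self ht) x s
  have hhi : ∫ s in (⌊t / τ⌋ : ℝ)..(t / τ), η x t s ≤ ∫ s in (⌊t / τ⌋ : ℝ)..(t / τ), M :=
    intervalIntegral.integral_mono_on h1 (hc.intervalIntegrable _ _) (by simp)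
      fun s _ => hM t ht x s
  have hM0 : 0 ≤ M := (hη.nonneg t (Ioo_subset_Icc_self ht) x 0).trans (hM t ht x 0)
  simp only [intervalIntegral.integral_const, smul_eq_mul, mul_one] at hhi ⊢
  constructor
  · linarith
  · nlinarith

/-- Chain rule in the slow variables and in the fast endpoint. The slow part is an integral over
less than one period, hence bounded like the integrand; the endpoint part carries the large factor
1/τ and reproduces η - 1. -/
theorem IsProfile.fderiv_corrector (hη : IsProfile T η) (τ : ℝ) {t : ℝ} (ht : t ∈ Ioo 0 T)
    (x : E3) (v : ℝ × E3) :
    (SmoothPer.der T v (hη.corrector τ)).val t x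
      = (∫ s in (⌊t / τ⌋ : ℝ)..(t / τ), fderiv ℝ (fun p => profFun η (p, s)) (t, x) v)
        + v.1 / τ * (η x t (t / τ) - 1) := by
  have hp := mem_slab ht x
  have hopen := isOpen_slab T
  set b := t / τ with hb
  set G : (ℝ × E3) × ℝ → ℝ := fun q => ∫ s in (0 : ℝ)..q.2, (profFun η (q.1, s) - 1) with hG
  have hmem : (((t, x), b) : (ℝ × E3) × ℝ) ∈ slab T ×ˢ (univ : Set ℝ) := ⟨hp, trivial⟩
  have hGd : HasFDerivAt G (fderiv ℝ G ((t, x), b)) ((t, x), b) :=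
    ((hη.contDiffOn_primitive.contDiffAt
      ((hopen.prod isOpen_univ).mem_nhds hmem)).differentiableAt (by simp)).hasFDerivAt
  have e1 : fderiv ℝ G ((t, x), b) (v, 0)
      = ∫ s in (⌊b⌋ : ℝ)..b, fderiv ℝ (fun p => profFun η (p, s)) (t, x) v := by
    have h1 := hGd.comp (t, x) (f := fun p => (p, b)) (hasFDerivAt_prodMk_left (t, x) b)
    have hf : ContDiffOn ℝ ∞ (fun q : (ℝ × E3) × ℝ => profFun η q - 1) (slab T ×ˢ univ) :=
      hη.contDiffOn_profFun.sub contDiffOn_const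
    have h2 := hasFDerivAt_intervalIntegral_param hopen hf (Int.floor_le b) hp
    -- Here `b` is frozen and only the slow variables move, so the discontinuity of the integer part
    -- is harmless.
    have h3 : G ∘ (fun p => (p, b)) =ᶠ[𝓝 (t, x)]
        fun q => ∫ s in (⌊b⌋ : ℝ)..b, (profFun η (q, s) - 1) := by
      filter_upwards [hopen.mem_nhds hp] with q hq
      exact hη.integral_sub_one hq.1 q.2 ⌊b⌋ b
    have h4 := h1.unique (h2.congr_of_eventuallyEq h3)
    have h5 : fderiv ℝ G ((t, x), b) (v, 0)
        = (∫ s in (⌊b⌋ : ℝ)..b, fderiv ℝ (fun q => profFun η (q, s) - 1) (t, x)) v := by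
      rw [← h4]; rfl
    rw [h5, ContinuousLinearMap.intervalIntegral_apply]
    · simp only [fderiv_sub_const]
    · refine Continuous.intervalIntegrable ?_ _ _
      simp only [fderiv_sub_const]
      exact (continuousOn_fderiv_left hopen hη.contDiffOn_profFun).comp_continuous
        (f := fun s : ℝ => ((t, x), s)) (by fun_prop) fun s => ⟨hp, trivial⟩
  have e2 : fderiv ℝ G ((t, x), b) (0, 1) = η x t b - 1 := by
    have h1 := hGd.comp_hasDerivAt b (f := fun r => ((t, x), r))
      ((hasDerivAt_const b (t, x)).prodMk (hasDerivAt_id b))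
    have hc : Continuous fun s => η x t s - 1 := (hη.continuous_fast ht x).sub continuous_const
    have h2 : HasDerivAt (G ∘ fun r => ((t, x), r)) (η x t b - 1) b :=
      intervalIntegral.integral_hasDerivAt_right (hc.intervalIntegrable _ _)
        hc.aestronglyMeasurable.stronglyMeasurableAtFilter hc.continuousAt
    exact h1.unique h2
  have e3 : fderiv ℝ (fun p : ℝ × E3 => (hη.corrector τ).val p.1 p.2) (t, x) v
      = fderiv ℝ G ((t, x), b) (v, v.1 / τ) := by
    have h1 : HasFDerivAt (fun p : ℝ × E3 => (p, p.1 / τ))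
        ((ContinuousLinearMap.id ℝ (ℝ × E3)).prod
          (τ⁻¹ • ContinuousLinearMap.fst ℝ ℝ E3)) (t, x) := by
      refine (hasFDerivAt_id _).prodMk ?_
      have h := (hasFDerivAt_fst (𝕜 := ℝ) (p := (t, x))).const_mul τ⁻¹
      simpa [div_eq_inv_mul] using h
    have h2 := (hGd.comp (t, x) h1).const_add 1
    have h3 : (fun p : ℝ × E3 => (hη.corrector τ).val p.1 p.2)
        =ᶠ[𝓝 (t, x)] fun p => 1 + (G ∘ fun p : ℝ × E3 => (p, p.1 / τ)) p := by
      filter_upwards [hopen.mem_nhds hp] with q hq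
      exact hη.val_corrector_eq τ hq.1 q.2
    rw [(h2.congr_of_eventuallyEq h3).fderiv]
    simp [div_eq_inv_mul]
  rw [SmoothPer.val_der _ _ ht, e3]
  have h6 : ((v, v.1 / τ) : (ℝ × E3) × ℝ) = (v, 0) + (v.1 / τ) • ((0 : ℝ × E3), (1 : ℝ)) := by
    simp
  rw [h6, map_add, map_smul, e1, e2, smul_eq_mul]

end Corrector

end TimeAveraging

namespace TimeAveraging

/-! ### Coordinates of gradients and divergences -/

theorem gradient_apply (f : E3 → ℝ) (x : E3) (i : Fin 3) :
    gradient f x i = fderiv ℝ f x (EuclideanSpace.single i 1) := by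
  have h : (InnerProductSpace.toDual ℝ E3) (gradient f x) (EuclideanSpace.single i 1)
      = fderiv ℝ f x (EuclideanSpace.single i 1) := by rw [toDual_gradient]
  rw [← h, InnerProductSpace.toDual_apply_apply, EuclideanSpace.inner_single_right]
  simp

theorem inner_gradient (f : E3 → ℝ) (x v : E3) :
    inner ℝ v (gradient f x) = fderiv ℝ f x v := by
  have h : (InnerProductSpace.toDual ℝ E3) (gradient f x) v = fderiv ℝ f x v := by
    rw [toDual_gradient]
  rw [← h, InnerProductSpace.toDual_apply_apply, real_inner_comm]

theorem eq_sum_single (v : E3) : v = ∑ i, v i • EuclideanSpace.single i (1 : ℝ) := by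
  ext j
  simp [Pi.single_apply]

theorem norm_gradient_sq (f : E3 → ℝ) (x : E3) :
    ‖gradient f x‖ ^ 2 = ∑ i, fderiv ℝ f x (EuclideanSpace.single i 1) ^ 2 := by
  rw [EuclideanSpace.real_norm_sq_eq]
  simp only [gradient_apply]

theorem abs_fderiv_single_le {F : Type*} [NormedAddCommGroup F] [NormedSpace ℝ F] (f : E3 → F)
    (x : E3) (i : Fin 3) : ‖fderiv ℝ f x (EuclideanSpace.single i 1)‖ ≤ ‖fderiv ℝ f x‖ := by
  refine (ContinuousLinearMap.le_opNorm _ _).trans (le_of_eq ?_)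
  simp

theorem norm_fderiv_fderiv {F : Type*} [NormedAddCommGroup F] [NormedSpace ℝ F] (f : E3 → F)
    (x : E3) : ‖fderiv ℝ (fderiv ℝ f) x‖ = ‖iteratedFDeriv ℝ 2 f x‖ := by
  rw [← norm_iteratedFDeriv_one, norm_iteratedFDeriv_fderiv]

theorem norm_fderiv_fderiv_single_le {F : Type*} [NormedAddCommGroup F] [NormedSpace ℝ F]
    {f : E3 → F} (hf : ContDiff ℝ ∞ f) (x : E3) (i j : Fin 3) :
    ‖fderiv ℝ (fun y => fderiv ℝ f y (EuclideanSpace.single i 1)) x (EuclideanSpace.single j 1)‖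
      ≤ ‖fderiv ℝ (fderiv ℝ f) x‖ := by
  have hd : DifferentiableAt ℝ (fderiv ℝ f) x :=
    ((hf.fderiv_right (m := 1) (by norm_cast)).differentiable one_ne_zero) x
  rw [fderiv_clm_apply hd (by fun_prop)]
  simp only [fderiv_fun_const, Pi.zero_apply, ContinuousLinearMap.comp_zero, zero_add,
    ContinuousLinearMap.flip_apply]
  refine (ContinuousLinearMap.le_opNorm _ _).trans ?_
  rw [PiLp.norm_single, norm_one, mul_one]
  exact (abs_fderiv_single_le _ _ _)

namespace SmoothPer

variable {T : ℝ}

theorem val_dx_of_eq {f : SmoothPer T} {φ : E3 → ℝ} {t : ℝ} (ht : t ∈ Ioo 0 T)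
    (h : ∀ x, f.val t x = φ x) (i : Fin 3) (x : E3) :
    (dx i f).val t x = fderiv ℝ φ x (EuclideanSpace.single i 1) := by
  rw [val_dx _ _ ht, show f.val t = φ from funext h]

theorem abs_val_dx_le {f : SmoothPer T} {φ : E3 → ℝ} {t : ℝ} (ht : t ∈ Ioo 0 T)
    (h : ∀ x, f.val t x = φ x) (i : Fin 3) (x : E3) :
    |(dx i f).val t x| ≤ ‖iteratedFDeriv ℝ 1 φ x‖ := by
  rw [val_dx_of_eq ht h, norm_iteratedFDeriv_one]
  exact abs_fderiv_single_le φ x i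

theorem abs_val_dx_dx_le {f : SmoothPer T} {φ : E3 → ℝ} {t : ℝ} (ht : t ∈ Ioo 0 T)
    (h : ∀ x, f.val t x = φ x) (i j : Fin 3) (x : E3) :
    |(dx j (dx i f)).val t x| ≤ ‖iteratedFDeriv ℝ 2 φ x‖ := by
  have hφ : ContDiff ℝ ∞ φ := by
    rw [show φ = f.val t from (funext h).symm]; exact f.contDiff_val ht
  rw [val_dx_of_eq ht (fun x => val_dx_of_eq ht h i x), ← norm_fderiv_fderiv]
  exact norm_fderiv_fderiv_single_le hφ x i j

end SmoothPer

/-! ### Bounds for the corrector -/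

section Corrector

variable {T : ℝ} {η : E3 → ℝ → ℝ → ℝ}

theorem IsProfile.contDiff_space_fast (hη : IsProfile T η) {t : ℝ} (ht : t ∈ Ioo 0 T) :
    ContDiff ℝ ∞ (fun p : E3 × ℝ => η p.1 t p.2) := by
  rw [← contDiffOn_univ]
  refine hη.contDiffOn_profFun.comp (f := fun p : E3 × ℝ => ((t, p.1), p.2)) (by fun_prop) ?_
  exact fun p _ => ⟨mem_slab ht p.1, trivial⟩

theorem IsProfile.contDiff_space (hη : IsProfile T η) {t : ℝ} (ht : t ∈ Ioo 0 T) (s : ℝ) :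
    ContDiff ℝ ∞ (fun y => η y t s) :=
  (hη.contDiff_space_fast ht).comp (f := fun y : E3 => (y, s)) (by fun_prop)

theorem norm_integral_fract_le {f : ℝ → ℝ} {b C : ℝ} (h : ∀ s, |f s| ≤ C) :
    |∫ s in (⌊b⌋ : ℝ)..b, f s| ≤ C := by
  obtain ⟨h1, h2⟩ := fract_bounds b
  have h3 := intervalIntegral.norm_integral_le_of_norm_le_const (f := f) (C := C)
    (a := (⌊b⌋ : ℝ)) (b := b) fun s _ => h s
  have hC : 0 ≤ C := (abs_nonneg _).trans (h 0)
  rw [abs_of_nonneg (sub_nonneg.2 h1)] at h3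
  exact h3.trans (by nlinarith)

theorem IsProfile.fderiv_profFun (hη : IsProfile T η) {t : ℝ} (ht : t ∈ Ioo 0 T) (x : E3) (s : ℝ)
    (v : E3) :
    fderiv ℝ (fun p => profFun η (p, s)) (t, x) (0, v) = fderiv ℝ (fun y => η y t s) x v := by
  have h1 := (hasFDerivAt_left_of_contDiffOn (isOpen_slab T) hη.contDiffOn_profFun
    (mem_slab ht x) s).differentiableAt.hasFDerivAt
  have h2 := h1.comp x (f := fun y => (t, y)) (hasFDerivAt_prodMk_right t x)
  have h3 : HasFDerivAt (fun y => η y t s) _ x := h2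
  rw [h3.fderiv]
  rfl

theorem IsProfile.fderiv_profFun_time (hη : IsProfile T η) {t : ℝ} (ht : t ∈ Ioo 0 T) (x : E3)
    (s : ℝ) :
    fderiv ℝ (fun p => profFun η (p, s)) (t, x) (1, 0) = deriv (fun r => η x r s) t := by
  have h1 := (hasFDerivAt_left_of_contDiffOn (isOpen_slab T) hη.contDiffOn_profFun
    (mem_slab ht x) s).differentiableAt.hasFDerivAt
  have h2 := h1.comp_hasDerivAt t (f := fun r => (r, x))
    ((hasDerivAt_id t).prodMk (hasDerivAt_const t x))
  have h3 : HasDerivAt (fun r => η x r s) _ t := h2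
  rw [h3.deriv]

theorem IsProfile.val_dx_corrector (hη : IsProfile T η) (τ : ℝ) {t : ℝ} (ht : t ∈ Ioo 0 T)
    (x : E3) (i : Fin 3) :
    (SmoothPer.dx i (hη.corrector τ)).val t x
      = ∫ s in (⌊t / τ⌋ : ℝ)..(t / τ),
          fderiv ℝ (fun y => η y t s) x (EuclideanSpace.single i 1) := by
  rw [SmoothPer.dx, hη.fderiv_corrector τ ht]
  simp only [zero_div, zero_mul, add_zero, hη.fderiv_profFun ht]

theorem IsProfile.abs_dx_corrector_le (hη : IsProfile T η) (τ : ℝ) {t C : ℝ} (ht : t ∈ Ioo 0 T)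
    (hC : ∀ s x, ‖iteratedFDeriv ℝ 1 (fun y => η y t s) x‖ ≤ C) (x : E3) (i : Fin 3) :
    |(SmoothPer.dx i (hη.corrector τ)).val t x| ≤ C := by
  rw [hη.val_dx_corrector τ ht]
  refine norm_integral_fract_le fun s => ?_
  refine (abs_fderiv_single_le (fun y => η y t s) x i).trans ?_
  rw [← norm_iteratedFDeriv_one]
  exact hC s x

theorem IsProfile.abs_dx_dx_corrector_le (hη : IsProfile T η) (τ : ℝ) {t C : ℝ} (ht : t ∈ Ioo 0 T)
    (hC : ∀ s x, ‖iteratedFDeriv ℝ 2 (fun y => η y t s) x‖ ≤ C) (x : E3) (i j : Fin 3) :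
    |(SmoothPer.dx j (SmoothPer.dx i (hη.corrector τ))).val t x| ≤ C := by
  have hs := hη.contDiff_space_fast ht
  let h : E3 × ℝ → ℝ := fun p => fderiv ℝ (fun y => η y t p.2) p.1 (EuclideanSpace.single i 1)
  have hh : ContDiff ℝ ∞ h := by
    have h1 : h = fun p : E3 × ℝ => fderiv ℝ (fun p : E3 × ℝ => η p.1 t p.2) p
        (EuclideanSpace.single i 1, 0) := by
      funext p
      have h2 := hasFDerivAt_left_of_contDiffOn (U := (univ : Set E3)) isOpen_univ
        (f := fun p : E3 × ℝ => η p.1 t p.2) (hs.contDiffOn (s := univ ×ˢ univ))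
        (mem_univ p.1) p.2
      have h3 : fderiv ℝ (fun y => η y t p.2) p.1 = _ := h2.fderiv
      simp only [h, h3]
      rfl
    rw [h1]
    exact (hs.fderiv_right (by simp)).clm_apply contDiff_const
  have hval : ∀ y, (SmoothPer.dx i (hη.corrector τ)).val t y
      = ∫ s in (⌊t / τ⌋ : ℝ)..(t / τ), h (y, s) := fun y => hη.val_dx_corrector τ ht y i
  have hd := hasFDerivAt_intervalIntegral_param (U := (univ : Set E3)) isOpen_univ (f := h)
    (hh.contDiffOn (s := univ ×ˢ univ)) (Int.floor_le (t / τ)) (mem_univ x)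
  rw [SmoothPer.val_dx_of_eq ht hval, hd.fderiv, ContinuousLinearMap.intervalIntegral_apply]
  · refine norm_integral_fract_le fun s => ?_
    refine (norm_fderiv_fderiv_single_le (hη.contDiff_space ht s) x i j).trans ?_
    rw [norm_fderiv_fderiv]
    exact hC s x
  · refine Continuous.intervalIntegrable ?_ _ _
    exact (continuousOn_fderiv_left (U := (univ : Set E3)) isOpen_univ (f := h)
      (hh.contDiffOn (s := univ ×ˢ univ))).comp_continuous
        (f := fun s : ℝ => (x, s)) (by fun_prop) fun s => ⟨trivial, trivial⟩

theorem IsProfile.abs_dx_osc_le (hη : IsProfile T η) (τ : ℝ) {t C : ℝ} (ht : t ∈ Ioo 0 T)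
    (hC : ∀ s x, ‖iteratedFDeriv ℝ 1 (fun y => η y t s) x‖ ≤ C) (x : E3) (i : Fin 3) :
    |(SmoothPer.dx i (hη.osc τ)).val t x| ≤ C :=
  (SmoothPer.abs_val_dx_le ht (hη.val_osc τ ht) i x).trans (hC _ x)

theorem IsProfile.abs_dx_dx_osc_le (hη : IsProfile T η) (τ : ℝ) {t C : ℝ} (ht : t ∈ Ioo 0 T)
    (hC : ∀ s x, ‖iteratedFDeriv ℝ 2 (fun y => η y t s) x‖ ≤ C) (x : E3) (i j : Fin 3) :
    |(SmoothPer.dx j (SmoothPer.dx i (hη.osc τ))).val t x| ≤ C :=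
  (SmoothPer.abs_val_dx_dx_le ht (hη.val_osc τ ht) i j x).trans (hC _ x)

theorem norm_iteratedFDeriv_le_of_profileSup {n : ℕ} {C : ℝ} (hC : 0 ≤ C)
    (h : profileSup T n η ≤ ENNReal.ofReal C) {t : ℝ} (ht : t ∈ Ioo 0 T) (s : ℝ) (x : E3) :
    ‖iteratedFDeriv ℝ n (fun y => η y t s) x‖ ≤ C := by
  have h1 : ‖iteratedFDeriv ℝ n (fun y => η y t s) x‖ₑ ≤ profileSup T n η := by
    unfold profileSup
    refine le_trans ?_ (le_iSup₂ (f := fun t (_ : t ∈ Icc (0 : ℝ) T) => ⨆ (s : ℝ) (x : E3),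
      ‖iteratedFDeriv ℝ n (fun y => η y t s) x‖ₑ) t (Ioo_subset_Icc_self ht))
    exact le_iSup₂ (f := fun s x => ‖iteratedFDeriv ℝ n (fun y => η y t s) x‖ₑ) s x
  have h2 := h1.trans h
  rw [← ofReal_norm] at h2
  exact (ENNReal.ofReal_le_ofReal_iff hC).1 h2

end Corrector

/-! ### Solutions as elements of the algebra -/

section Solutions

open SmoothPer

variable {T : ℝ} {u : ℝ → E3 → E3}

/-- The components of a velocity field. -/
def IsVelocity.comp (hu : IsVelocity T u) (i : Fin 3) : SmoothPer T :=
  SmoothPer.mk (fun t x => u t x i)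
    (by
      have h := hu.smooth.mono (show slab T ⊆ _ from prod_mono Ioo_subset_Icc_self subset_rfl)
      exact contDiffOn_euclidean.1 h i)
    fun t ht j x => by
      simp only [hu.periodic t (Ioo_subset_Icc_self ht) j x]

theorem IsVelocity.val_comp (hu : IsVelocity T u) (i : Fin 3) {t : ℝ} (ht : t ∈ Ioo 0 T) (x : E3) :
    (hu.comp i).val t x = u t x i := SmoothPer.val_mk _ _ _ ht x

theorem IsVelocity.contDiff_space (hu : IsVelocity T u) {t : ℝ} (ht : t ∈ Ioo 0 T) :
    ContDiff ℝ ∞ (u t) := by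
  rw [← contDiffOn_univ]
  exact hu.smooth.comp (f := fun x : E3 => (t, x)) (by fun_prop)
    fun x _ => ⟨Ioo_subset_Icc_self ht, trivial⟩

theorem fderiv_coord {v : E3 → E3} {x : E3} (hv : DifferentiableAt ℝ v x) (i : Fin 3) (w : E3) :
    fderiv ℝ (fun y => v y i) x w = fderiv ℝ v x w i := by
  have h := ((EuclideanSpace.proj i : E3 →L[ℝ] ℝ).hasFDerivAt (x := v x)).comp x hv.hasFDerivAt
  have h2 : HasFDerivAt (fun y => v y i) _ x := h
  rw [h2.fderiv]
  rfl

theorem IsVelocity.val_dx_comp (hu : IsVelocity T u) (i j : Fin 3) {t : ℝ} (ht : t ∈ Ioo 0 T)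
    (x : E3) :
    (dx j (hu.comp i)).val t x = fderiv ℝ (u t) x (EuclideanSpace.single j 1) i := by
  rw [val_dx_of_eq ht (fun y => hu.val_comp i ht y),
    fderiv_coord ((hu.contDiff_space ht).differentiable (by simp) x)]

theorem abs_coord_le (v : E3) (i : Fin 3) : |v i| ≤ ‖v‖ := PiLp.norm_apply_le v i

theorem IsVelocity.abs_dx_comp_le (hu : IsVelocity T u) (i j : Fin 3) {t μ : ℝ} (ht : t ∈ Ioo 0 T)
    {x : E3} (h : ‖fderiv ℝ (u t) x‖ ≤ μ) : |(dx j (hu.comp i)).val t x| ≤ μ := by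
  rw [hu.val_dx_comp i j ht]
  exact (abs_coord_le _ i).trans ((abs_fderiv_single_le _ x j).trans h)

theorem IsVelocity.abs_dx_dx_comp_le (hu : IsVelocity T u) (i j k : Fin 3) {t C : ℝ}
    (ht : t ∈ Ioo 0 T) {x : E3} (h : ‖iteratedFDeriv ℝ 1 (fderiv ℝ (u t)) x‖ ≤ C) :
    |(dx k (dx j (hu.comp i))).val t x| ≤ C := by
  have hs := hu.contDiff_space ht
  have hd : DifferentiableAt ℝ (fun y => fderiv ℝ (u t) y (EuclideanSpace.single j 1)) x :=
    (((hs.fderiv_right (m := 1) (by norm_cast)).clm_apply contDiff_const).differentiable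
      one_ne_zero) x
  rw [val_dx_of_eq ht (fun y => hu.val_dx_comp i j ht y), fderiv_coord hd]
  refine (abs_coord_le _ i).trans ((norm_fderiv_fderiv_single_le hs x j k).trans ?_)
  rwa [← norm_iteratedFDeriv_one]

theorem IsVelocity.sum_dx_comp (hu : IsVelocity T u) : ∑ j, dx j (hu.comp j) = 0 := by
  ext t ht x
  rw [val_sum, val_zero, ← hu.divFree t (Ioo_subset_Icc_self ht) x, divergence]
  exact Finset.sum_congr rfl fun j _ => hu.val_dx_comp j j ht x

theorem val_matD (hu : IsVelocity T u) (f : SmoothPer T) {t : ℝ} (ht : t ∈ Ioo 0 T) (x : E3) :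
    (matD hu.comp f).val t x
      = fderiv ℝ (fun p : ℝ × E3 => f.val p.1 p.2) (t, x) (1, u t x) := by
  have h : ((1, u t x) : ℝ × E3)
      = (1, 0) + ∑ i, u t x i • ((0 : ℝ), EuclideanSpace.single i (1 : ℝ)) := by
    refine Prod.ext ?_ ?_
    · simp [Prod.fst_sum]
    · simp only [Prod.snd_add, Prod.snd_sum, Prod.smul_snd, zero_add]
      exact eq_sum_single _
  rw [h, map_add, map_sum, matD_apply, val_add, val_sum, dt, val_der _ _ ht]
  congr 1
  refine Finset.sum_congr rfl fun i _ => ?_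
  rw [val_mul, hu.val_comp i ht, dx, val_der _ _ ht, map_smul, smul_eq_mul]

theorem val_matD' (hu : IsVelocity T u) (f : SmoothPer T) {t : ℝ} (ht : t ∈ Ioo 0 T) (x : E3) :
    (matD hu.comp f).val t x
      = deriv (fun r => f.val r x) t + inner ℝ (u t x) (gradient (f.val t) x) := by
  rw [matD_apply, val_add, val_sum, (f.hasDerivAt_val ht x).deriv, inner_gradient]
  congr 1
  conv_rhs => rw [eq_sum_single (u t x), map_sum]
  refine Finset.sum_congr rfl fun i _ => ?_
  rw [val_mul, hu.val_comp i ht, val_dx _ _ ht, map_smul, smul_eq_mul]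

variable {a : ℝ → E3 → ℝ} {ρin : E3 → ℝ} {ρ : ℝ → E3 → ℝ}

/-- A solution as an element of the algebra. -/
def IsSolution.el (h : IsSolution T u a ρin ρ) : SmoothPer T := SmoothPer.mk ρ h.smooth h.periodic

theorem IsSolution.val_el (h : IsSolution T u a ρin ρ) {t : ℝ} (ht : t ∈ Ioo 0 T) (x : E3) :
    h.el.val t x = ρ t x := SmoothPer.val_mk _ _ _ ht x

theorem IsSolution.val_gradSq (h : IsSolution T u a ρin ρ) {t : ℝ} (ht : t ∈ Ioo 0 T) (x : E3) :
    (gradSq h.el).val t x = ‖gradient (ρ t) x‖ ^ 2 := by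
  rw [SmoothPer.val_gradSq, norm_gradient_sq]
  exact Finset.sum_congr rfl fun i _ => by rw [val_dx_of_eq ht (fun y => h.val_el ht y)]

theorem IsSolution.matD_el (hu : IsVelocity T u) (h : IsSolution T u a ρin ρ) {α : SmoothPer T}
    (hα : ∀ t ∈ Ioo 0 T, ∀ x, α.val t x = a t x) : matD hu.comp h.el = divGrad α h.el := by
  ext t ht x
  have hval : h.el.val t = ρ t := funext fun y => h.val_el ht y
  have hder : deriv (fun r => h.el.val r x) t = deriv (fun r => ρ r x) t := by
    refine Filter.EventuallyEq.deriv_eq ?_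
    filter_upwards [isOpen_Ioo.mem_nhds ht] with r hr using h.val_el hr x
  rw [val_matD' hu _ ht, hval, hder, h.equation t ht x, divergence, divGrad, val_sum]
  refine Finset.sum_congr rfl fun j _ => ?_
  have hcoord : ∀ y, (α * dx j h.el).val t y = (a t y • gradient (ρ t) y) j := fun y => by
    rw [val_mul, hα t ht, PiLp.smul_apply, gradient_apply, val_dx_of_eq ht (fun y => h.val_el ht y),
      smul_eq_mul]
  have hd : DifferentiableAt ℝ (fun y => a t y • gradient (ρ t) y) x := by
    rw [differentiableAt_euclidean]
    intro i
    have hcoord : ∀ y, (α * dx i h.el).val t y = (a t y • gradient (ρ t) y) i := fun y => by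
      rw [val_mul, hα t ht, PiLp.smul_apply, gradient_apply,
        val_dx_of_eq ht (fun y => h.val_el ht y), smul_eq_mul]
    rw [← funext hcoord]
    exact ((α * dx i h.el).contDiff_val ht).differentiable (by simp) x
  rw [val_dx_of_eq ht hcoord, fderiv_coord hd]

/-- The advective derivative with the fast time fixed passes under the integral over the last
incomplete period and is bounded there by the slow derivative of η; the endpoint term is exactly
(q-1)/τ. -/
theorem IsProfile.matD_corrector {η : E3 → ℝ → ℝ → ℝ} (hu : IsVelocity T u) (hη : IsProfile T η)
    (τ : ℝ) {t C : ℝ} (ht : t ∈ Ioo 0 T) (hC : ∀ x s, |slowDeriv u η x t s| ≤ C) (x : E3) :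
    |(matD hu.comp (hη.corrector τ)).val t x - 1 / τ * ((hη.osc τ).val t x - 1)| ≤ C := by
  have h := hη.fderiv_corrector τ ht x (1, u t x)
  rw [val_der _ _ ht] at h
  rw [val_matD hu _ ht, h, hη.val_osc τ ht, add_sub_cancel_right]
  refine norm_integral_fract_le fun s => ?_
  have h2 : ((1, u t x) : ℝ × E3) = (1, 0) + (0, u t x) := by simp
  rw [h2, map_add, hη.fderiv_profFun_time ht, hη.fderiv_profFun ht]
  have h3 := hC x s
  rwa [slowDeriv, inner_gradient] at h3

end Solutions

end TimeAveraging

namespace TimeAveraging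

/-! ### Square integrals and limits at the boundary of the time interval -/

theorem l2Sq_eq_ofReal {f : E3 → ℝ} (hf : MemLp f 2 torusMeasure) :
    l2Sq f = ENNReal.ofReal (∫ x, f x ^ 2 ∂torusMeasure) := by
  rw [ofReal_integral_eq_lintegral_ofReal hf.integrable_sq
    (Eventually.of_forall fun x => sq_nonneg (f x)), l2Sq]
  refine lintegral_congr fun x => ?_
  rw [← sq_abs, ENNReal.ofReal_pow (abs_nonneg _), ← Real.enorm_eq_ofReal_abs]

theorem integral_add_sq_le {f g : E3 → ℝ} (hf : MemLp f 2 torusMeasure)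
    (hg : MemLp g 2 torusMeasure) :
    ∫ x, (f x + g x) ^ 2 ∂torusMeasure
      ≤ 2 * (∫ x, f x ^ 2 ∂torusMeasure) + 2 * ∫ x, g x ^ 2 ∂torusMeasure := by
  rw [← integral_const_mul, ← integral_const_mul, ← integral_add (hf.integrable_sq.const_mul _)
    (hg.integrable_sq.const_mul _)]
  refine integral_mono (hf.add hg).integrable_sq ((hf.integrable_sq.const_mul _).add
    (hg.integrable_sq.const_mul _)) fun x => ?_
  simp only
  nlinarith [sq_nonneg (f x - g x)]

theorem fourierCoef_sub {f g : E3 → ℝ} (hf : Integrable f torusMeasure)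
    (hg : Integrable g torusMeasure) (k : Fin 3 → ℤ) :
    fourierCoef (fun x => f x - g x) k = fourierCoef f k - fourierCoef g k := by
  have hm : ∀ h : E3 → ℝ, Integrable h torusMeasure → Integrable (fun x : E3 => (h x : ℂ) *
      Complex.exp (-(2 * Real.pi * Complex.I * ∑ i, (k i : ℂ) * (x i : ℂ)))) torusMeasure := by
    intro h hh
    refine hh.ofReal.mul_bdd (c := 1) (Continuous.aestronglyMeasurable (by fun_prop)) ?_
    refine Eventually.of_forall fun x => le_of_eq ?_
    have : -(2 * Real.pi * Complex.I * ∑ i, (k i : ℂ) * (x i : ℂ))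
        = ((-(2 * Real.pi * ∑ i, (k i : ℝ) * x i) : ℝ) : ℂ) * Complex.I := by
      push_cast; ring
    rw [this, Complex.norm_exp_ofReal_mul_I]
  rw [fourierCoef, fourierCoef, fourierCoef, ← integral_sub (hm f hf) (hm g hg)]
  refine integral_congr_ae (Eventually.of_forall fun x => ?_)
  simp only [Complex.ofReal_sub, sub_mul]

section Solutions

open SmoothPer

variable {T : ℝ} {u : ℝ → E3 → E3} {a : ℝ → E3 → ℝ} {ρin : E3 → ℝ} {ρ : ℝ → E3 → ℝ}

theorem IsSolution.tendsto_sq (h : IsSolution T u a ρin ρ) {t : ℝ}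
    (ht : t ∈ Icc 0 T) :
    Tendsto (fun s => ∫ x, (ρ s x - ρ t x) ^ 2 ∂torusMeasure) (𝓝[Ioo 0 T] t) (𝓝 0) := by
  have h1 := (h.continuous t ht).mono_left (nhdsWithin_mono t Ioo_subset_Icc_self)
  have h2 := (ENNReal.tendsto_toReal ENNReal.zero_ne_top).comp h1
  refine Tendsto.congr' ?_ h2
  filter_upwards [self_mem_nhdsWithin] with s hs
  have hm : MemLp (fun x => ρ s x - ρ t x) 2 torusMeasure :=
    (h.memL2 s (Ioo_subset_Icc_self hs)).sub (h.memL2 t ht)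
  rw [Function.comp_apply, l2Sq_eq_ofReal hm, ENNReal.toReal_ofReal
    (integral_nonneg fun x => sq_nonneg _)]

/-- By Parseval a single coefficient of a difference is bounded by its L² norm, so L² continuity at
time 0 is enough. -/
theorem IsSolution.tendsto_coefSq (hT : 0 < T) (h : IsSolution T u a ρin ρ) (k : Fin 3 → ℤ) :
    Tendsto (coefSq h.el k) (𝓝[>] 0) (𝓝 (‖fourierCoef ρin k‖ ^ 2)) := by
  have h0 : (0 : ℝ) ∈ Icc 0 T := ⟨le_rfl, hT.le⟩
  have hin : fourierCoef ρin k = fourierCoef (ρ 0) k := by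
    rw [fourierCoef, fourierCoef]
    refine integral_congr_ae ?_
    filter_upwards [h.initial] with x hx
    rw [hx]
  have key : Tendsto (fun t => fourierCoef (ρ t) k) (𝓝[Ioo 0 T] 0) (𝓝 (fourierCoef (ρ 0) k)) := by
    rw [tendsto_iff_norm_sub_tendsto_zero]
    have hs := (h.tendsto_sq h0).sqrt
    rw [Real.sqrt_zero] at hs
    refine squeeze_zero' (Eventually.of_forall fun t => norm_nonneg _) ?_ hs
    filter_upwards [self_mem_nhdsWithin] with t ht
    have hm : MemLp (fun x => ρ t x - ρ 0 x) 2 torusMeasure :=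
      (h.memL2 t (Ioo_subset_Icc_self ht)).sub (h.memL2 0 h0)
    rw [← fourierCoef_sub ((h.memL2 t (Ioo_subset_Icc_self ht)).integrable one_le_two)
      ((h.memL2 0 h0).integrable one_le_two)]
    exact Real.le_sqrt_of_sq_le
      (le_hasSum (hasSum_norm_fourierCoef_sq hm) k fun j _ => sq_nonneg _)
  rw [hin]
  rw [nhdsWithin_Ioo_eq_nhdsGT hT] at key
  refine (key.norm.pow 2).congr' ?_
  filter_upwards [Ioo_mem_nhdsGT hT] with t ht
  rw [← norm_fourierCoef_val_sq _ _ ht, funext fun x => h.val_el ht x]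

theorem IsSolution.integ_sq (h : IsSolution T u a ρin ρ) {t : ℝ} (ht : t ∈ Ioo 0 T) :
    (h.el ^ 2).integ t = ∫ x, ρ t x ^ 2 ∂torusMeasure := by
  simp only [integ, val_sq, h.val_el ht]

theorem IsSolution.eventually_integ_sq_le (hT : 0 < T) (h : IsSolution T u a ρin ρ) :
    ∃ Y, ∀ᶠ t in 𝓝[>] (0 : ℝ), (h.el ^ 2).integ t ≤ Y := by
  have h0 : (0 : ℝ) ∈ Icc 0 T := ⟨le_rfl, hT.le⟩
  have h1 := h.tendsto_sq h0
  rw [nhdsWithin_Ioo_eq_nhdsGT hT] at h1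
  refine ⟨2 * 1 + 2 * ∫ x, ρ 0 x ^ 2 ∂torusMeasure, ?_⟩
  filter_upwards [h1.eventually_le_const one_pos, Ioo_mem_nhdsGT hT] with t ht1 ht
  rw [h.integ_sq ht]
  have hm : MemLp (fun x => ρ t x - ρ 0 x) 2 torusMeasure :=
    (h.memL2 t (Ioo_subset_Icc_self ht)).sub (h.memL2 0 h0)
  have h2 := integral_add_sq_le hm (h.memL2 0 h0)
  simp only [sub_add_cancel] at h2
  linarith

variable {b : ℝ → E3 → ℝ} {σ : ℝ → E3 → ℝ}

theorem IsSolution.tendsto_integ_sub_sq (hT : 0 < T) (h : IsSolution T u a ρin ρ)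
    (h' : IsSolution T u b ρin σ) :
    Tendsto ((h.el - h'.el) ^ 2).integ (𝓝[>] 0) (𝓝 0) := by
  have h0 : (0 : ℝ) ∈ Icc 0 T := ⟨le_rfl, hT.le⟩
  have h1 := ((h.tendsto_sq h0).const_mul 2).add ((h'.tendsto_sq h0).const_mul 2)
  rw [nhdsWithin_Ioo_eq_nhdsGT hT] at h1
  simp only [mul_zero, add_zero] at h1
  refine squeeze_zero' (Eventually.of_forall fun t => integ_nonneg fun x => ?_) ?_ h1
  · rw [val_sq]; positivity
  filter_upwards [Ioo_mem_nhdsGT hT] with t ht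
  have hm : MemLp (fun x => ρ t x - ρ 0 x) 2 torusMeasure :=
    (h.memL2 t (Ioo_subset_Icc_self ht)).sub (h.memL2 0 h0)
  have hm' : MemLp (fun x => -(σ t x - σ 0 x)) 2 torusMeasure :=
    ((h'.memL2 t (Ioo_subset_Icc_self ht)).sub (h'.memL2 0 h0)).neg
  have h2 := integral_add_sq_le hm hm'
  simp only [neg_sq] at h2
  refine le_trans (le_of_eq ?_) h2
  rw [integ]
  refine integral_congr_ae ?_
  filter_upwards [h.initial, h'.initial] with x hx hx'
  rw [val_sq, val_sub, h.val_el ht, h'.val_el ht, hx, hx']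
  ring

/-- This carries an interior bound to t = 0 and t = T by L² continuity. The factor 2 comes from
(y+z)² ≤ 2y² + 2z² and is harmless for the final constant. -/
theorem IsSolution.l2Sq_sub_le (hT : 0 < T) (h : IsSolution T u a ρin ρ)
    (h' : IsSolution T u b ρin σ) {X : ℝ}
    (hX : ∀ t ∈ Ioo 0 T, ((h.el - h'.el) ^ 2).integ t ≤ X) {t : ℝ} (ht : t ∈ Icc 0 T) :
    l2Sq (fun x => ρ t x - σ t x) ≤ ENNReal.ofReal (2 * X) := by
  have hm := fun s (hs : s ∈ Icc 0 T) => (h.memL2 s hs).sub (h'.memL2 s hs)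
  have hm0 : MemLp (fun x => ρ t x - σ t x) 2 torusMeasure := hm t ht
  rw [l2Sq_eq_ofReal hm0]
  refine ENNReal.ofReal_le_ofReal ?_
  have h1 := (((h.tendsto_sq ht).const_mul 4).add ((h'.tendsto_sq ht).const_mul 4)).const_add
    (2 * X)
  simp only [mul_zero, add_zero] at h1
  have : (𝓝[Ioo 0 T] t).NeBot := by
    rw [← mem_closure_iff_nhdsWithin_neBot, closure_Ioo hT.ne]; exact ht
  refine ge_of_tendsto h1 ?_
  filter_upwards [self_mem_nhdsWithin] with s hs
  have hs' := Ioo_subset_Icc_self hs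
  have e1 : MemLp (fun x => ρ s x - σ s x) 2 torusMeasure := hm s hs'
  have e2 : MemLp (fun x => -(ρ s x - ρ t x)) 2 torusMeasure :=
    ((h.memL2 s hs').sub (h.memL2 t ht)).neg
  have e3 : MemLp (fun x => σ s x - σ t x) 2 torusMeasure :=
    (h'.memL2 s hs').sub (h'.memL2 t ht)
  have i1 := integral_add_sq_le e1 (e2.add e3)
  have i2 := integral_add_sq_le e2 e3
  simp only [neg_sq, Pi.add_apply] at i1 i2
  have i3 : ∫ x, (ρ s x - σ s x) ^ 2 ∂torusMeasure ≤ X := by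
    refine le_trans (le_of_eq ?_) (hX s hs)
    simp only [integ, val_sq, val_sub, h.val_el hs, h'.val_el hs]
  have i4 : ∫ x, (ρ t x - σ t x) ^ 2 ∂torusMeasure
      = ∫ x, (ρ s x - σ s x + (-(ρ s x - ρ t x) + (σ s x - σ t x))) ^ 2 ∂torusMeasure := by
    congr 1; ext x; ring
  rw [i4]
  linarith

end Solutions

/-! ### Uniform bounds for the velocity -/

theorem IsPeriodic.exists_mem_closedCube {F : Type*} {f : E3 → F} (hf : IsPeriodic f) (x : E3) :
    ∃ y ∈ {y : E3 | ∀ i, y i ∈ Icc (0 : ℝ) 1}, f y = f x := by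
  have hp : ∀ i, Function.Periodic f (EuclideanSpace.single i (1 : ℝ)) := fun i y => hf i y
  have h := (((hp 0).zsmul (-⌊x 0⌋)).add_period ((hp 1).zsmul (-⌊x 1⌋))).add_period
    ((hp 2).zsmul (-⌊x 2⌋))
  refine ⟨_, fun i => ?_, h x⟩
  have e : ∀ i, (x + (-⌊x 0⌋ • EuclideanSpace.single 0 (1 : ℝ)
      + -⌊x 1⌋ • EuclideanSpace.single 1 (1 : ℝ)
      + -⌊x 2⌋ • EuclideanSpace.single 2 (1 : ℝ)) : E3) i = Int.fract (x i) := by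
    intro i
    fin_cases i <;> simp [Int.fract, sub_eq_add_neg]
  rw [e i]
  exact ⟨Int.fract_nonneg _, (Int.fract_lt_one _).le⟩

/-- Compactness of [0,T] times the closed cube. The bound is purely qualitative: it serves to show
that time integrals near 0 are finite and does not enter the final constant. -/
theorem IsVelocity.exists_bound {T : ℝ} {u : ℝ → E3 → E3} (hu : IsVelocity T u) :
    ∃ U, ∀ t ∈ Icc 0 T, ∀ x, ‖u t x‖ ≤ U := by
  have hK : IsCompact (Icc (0 : ℝ) T ×ˢ {y : E3 | ∀ i, y i ∈ Icc (0 : ℝ) 1}) :=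
    isCompact_Icc.prod closedCube_isCompact
  obtain ⟨U, hU⟩ := hK.exists_bound_of_continuousOn
    (hu.smooth.continuousOn.mono (prod_mono subset_rfl (subset_univ _)))
  refine ⟨U, fun t ht x => ?_⟩
  obtain ⟨y, hy, hyx⟩ := (hu.periodic t ht).exists_mem_closedCube x
  rw [← hyx]
  exact hU (t, y) ⟨ht, hy⟩

end TimeAveraging

namespace TimeAveraging

/-! ### Elementary inequalities for finite sums -/

/-- Young's inequality weighted so that `x` may be one derivative higher than `y`, with `ν` playing
the role of an inverse length. -/
theorem abs_sum_sum_mul_le_weighted {M ν : ℝ} (hM : 0 ≤ M) {m : Fin 3 → Fin 3 → ℝ}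
    (hm : ∀ i j, |m i j| ≤ M * ν) (x y : Fin 3 → ℝ) :
    |∑ i, ∑ j, m i j * y j * x i| ≤ 3 / 2 * M * (∑ i, x i ^ 2 + ν ^ 2 * ∑ j, y j ^ 2) := by
  have h : ∀ i j, |m i j * y j * x i| ≤ M / 2 * (x i ^ 2 + ν ^ 2 * y j ^ 2) := fun i j => by
    rw [abs_mul, abs_mul]
    have h1 : ν * (|y j| * |x i|) ≤ (x i ^ 2 + ν ^ 2 * y j ^ 2) / 2 := by
      nlinarith [sq_nonneg (ν * |y j| - |x i|), sq_abs (y j), sq_abs (x i)]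
    calc |m i j| * |y j| * |x i| = |m i j| * (|y j| * |x i|) := by ring
      _ ≤ (M * ν) * (|y j| * |x i|) := mul_le_mul_of_nonneg_right (hm i j) (by positivity)
      _ = M * (ν * (|y j| * |x i|)) := by ring
      _ ≤ M * ((x i ^ 2 + ν ^ 2 * y j ^ 2) / 2) := mul_le_mul_of_nonneg_left h1 hM
      _ = M / 2 * (x i ^ 2 + ν ^ 2 * y j ^ 2) := by ring
  calc |∑ i, ∑ j, m i j * y j * x i| ≤ ∑ i, ∑ j, |m i j * y j * x i| :=
        (Finset.abs_sum_le_sum_abs _ _).trans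
          (Finset.sum_le_sum fun i _ => Finset.abs_sum_le_sum_abs _ _)
    _ ≤ ∑ i, ∑ j, M / 2 * (x i ^ 2 + ν ^ 2 * y j ^ 2) :=
        Finset.sum_le_sum fun i _ => Finset.sum_le_sum fun j _ => h i j
    _ = 3 / 2 * M * (∑ i, x i ^ 2 + ν ^ 2 * ∑ j, y j ^ 2) := by
        simp only [Fin.sum_univ_three]; ring

theorem abs_sum_sum_mul_le {M : ℝ} {m : Fin 3 → Fin 3 → ℝ} (hm : ∀ i j, |m i j| ≤ M)
    (x y : Fin 3 → ℝ) :
    |∑ i, ∑ j, m i j * y j * x i| ≤ 3 / 2 * M * (∑ i, x i ^ 2 + ∑ j, y j ^ 2) := by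
  simpa using abs_sum_sum_mul_le_weighted (ν := 1) ((abs_nonneg _).trans (hm 0 0))
    (by simpa using hm) x y

namespace SmoothPer

variable {T : ℝ}

/-! ### Regularity estimates for constant diffusivity -/

theorem energy {u : Fin 3 → SmoothPer T} (hu : ∑ j, dx j (u j) = 0) {f a r : SmoothPer T}
    (hf : matD u f = divGrad a f + r) {t : ℝ} (ht : t ∈ Ioo 0 T) :
    (dt (f ^ 2)).integ t = (2 * (f * r) - 2 * (a * gradSq f)).integ t := by
  have h := weighted_energy hu hf 1 ht
  rw [one_mul] at h
  rw [h]
  congr 1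
  simp [divGrad]
  ring

theorem gradient_energy_cst {u : Fin 3 → SmoothPer T} (hu : ∑ j, dx j (u j) = 0)
    {f H : SmoothPer T} {κ : ℝ} (hf : matD u f = divGrad (cst κ) f + H) {t : ℝ}
    (ht : t ∈ Ioo 0 T) :
    (dt (gradSq f)).integ t = (2 * (∑ i, dx i f * dx i H)
      - 2 * (∑ i, ∑ j, dx i (u j) * dx j f * dx i f)
      - (2 : ℝ) • (κ • ∑ i, gradSq (dx i f))).integ t := by
  have h := gradient_energy hu hf 1 ht
  rw [one_mul] at h
  rw [h]
  congr 1
  simp only [divGrad, dx_cst, Derivation.map_one_eq_zero, mul_zero, zero_mul,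
    Finset.sum_const_zero, map_zero, one_mul, Algebra.smul_def, map_ofNat]
  ring

theorem tinteg_le_tinteg_left {f : SmoothPer T} (hf : ∀ t x, 0 ≤ f.val t x) {s t₀ t₁ : ℝ}
    (hs : 0 < s) (hst : s ≤ t₀) (h₁ : t₀ ≤ t₁) (h₂ : t₁ < T) :
    f.tinteg t₀ t₁ ≤ f.tinteg s t₁ := by
  have h := intervalIntegral.integral_add_adjacent_intervals
    (intervalIntegrable_integ f hs hst (h₁.trans_lt h₂))
    (intervalIntegrable_integ f (hs.trans_le hst) h₁ h₂)
  have h0 : 0 ≤ f.tinteg s t₀ := tinteg_nonneg hst hf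
  simp only [tinteg] at h h0 ⊢
  linarith

/-- Start the inequality at a time s before t₀ where the initial bound holds and enlarge [t₀,t₁] to
[s,t₁], as `h` is nonnegative. Such times need only accumulate at 0, which is all that is available
for the gradient of the difference. -/
theorem bound_of_energy_ineq {g h : SmoothPer T}
    (hh : ∀ t x, 0 ≤ h.val t x) {S X : ℝ}
    (hle : ∀ t₀ t₁, 0 < t₀ → t₀ ≤ t₁ → t₁ < T →
      g.integ t₁ + h.tinteg t₀ t₁ ≤ g.integ t₀ + X)
    (hS : ∀ ε > 0, ∃ᶠ t in 𝓝[>] (0 : ℝ), g.integ t ≤ S + ε) {t₀ t₁ : ℝ} (h₀ : 0 < t₀)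
    (h₁ : t₀ ≤ t₁) (h₂ : t₁ < T) : g.integ t₁ + h.tinteg t₀ t₁ ≤ S + X := by
  refine le_of_forall_pos_le_add fun ε hε => ?_
  obtain ⟨s, hs, hs1, hs2⟩ := ((hS ε hε).and_eventually (Ioc_mem_nhdsGT h₀)).exists
  have h3 := hle s t₁ hs1 (hs2.trans h₁) h₂
  have h4 := tinteg_le_tinteg_left hh hs1 hs2 h₁ h₂
  linarith

theorem bounds_of_energy_ineq {g h : SmoothPer T} (hg : ∀ t x, 0 ≤ g.val t x)
    (hh : ∀ t x, 0 ≤ h.val t x) {S X : ℝ}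
    (hle : ∀ t₀ t₁, 0 < t₀ → t₀ ≤ t₁ → t₁ < T →
      g.integ t₁ + h.tinteg t₀ t₁ ≤ g.integ t₀ + X)
    (hS : ∀ ε > 0, ∃ᶠ t in 𝓝[>] (0 : ℝ), g.integ t ≤ S + ε) :
    (∀ t ∈ Ioo 0 T, g.integ t ≤ S + X) ∧ TBound h (S + X) := by
  constructor
  · intro t ht
    have h1 := bound_of_energy_ineq hh hle hS ht.1 le_rfl ht.2
    have h2 : 0 ≤ h.tinteg t t := tinteg_nonneg le_rfl hh
    linarith
  · intro t₀ t₁ h₀ h₁ h₂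
    have h1 := bound_of_energy_ineq hh hle hS h₀ h₁ h₂
    have h2 : 0 ≤ g.integ t₁ := integ_nonneg (hg t₁)
    linarith

/-- `|∇²f|²`. -/
def hessSq (f : SmoothPer T) : SmoothPer T := ∑ i, gradSq (dx i f)

/-- `|∇³f|²`. -/
def thirdSq (f : SmoothPer T) : SmoothPer T := ∑ i, hessSq (dx i f)

theorem val_hessSq (f : SmoothPer T) (t : ℝ) (x : E3) :
    (hessSq f).val t x = ∑ i, ∑ j, (dx j (dx i f)).val t x ^ 2 := by
  simp [hessSq, val_gradSq]

theorem val_hessSq_nonneg (f : SmoothPer T) (t : ℝ) (x : E3) : 0 ≤ (hessSq f).val t x := by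
  rw [val_hessSq]; positivity

theorem val_thirdSq (f : SmoothPer T) (t : ℝ) (x : E3) :
    (thirdSq f).val t x = ∑ i, ∑ j, ∑ k, (dx k (dx j (dx i f))).val t x ^ 2 := by
  simp [thirdSq, val_hessSq]

theorem val_thirdSq_nonneg (f : SmoothPer T) (t : ℝ) (x : E3) : 0 ≤ (thirdSq f).val t x := by
  rw [val_thirdSq]; positivity

/-- The time-integrated form of a differential inequality for spatial integrals. -/
theorem integ_add_tinteg_le {g h p : SmoothPer T}
    (hd : ∀ t ∈ Ioo 0 T, (dt g).integ t ≤ (p - h).integ t) {X : ℝ} (hp : TBound p X) {t₀ t₁ : ℝ}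
    (h₀ : 0 < t₀) (h₁ : t₀ ≤ t₁) (h₂ : t₁ < T) :
    g.integ t₁ + h.tinteg t₀ t₁ ≤ g.integ t₀ + X := by
  have h3 := tinteg_dt g h₀ h₁ h₂
  have h4 : (dt g).tinteg t₀ t₁ ≤ (p - h).tinteg t₀ t₁ :=
    intervalIntegral.integral_mono_on h₁ (intervalIntegrable_integ _ h₀ h₁ h₂)
      (intervalIntegrable_integ _ h₀ h₁ h₂) fun t ht => hd t (mem_Ioo_of_le h₀ h₂ ht)
  rw [tinteg_sub _ _ h₀ h₁ h₂] at h4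
  have h5 := hp h₀ h₁ h₂
  linarith

theorem gradSq_bounds {u : Fin 3 → SmoothPer T} (hu : ∑ j, dx j (u j) = 0) {κ ν : ℝ}
    (hκ : 0 < κ) (hdu : ∀ i j, ∀ t ∈ Ioo 0 T, ∀ x, |(dx i (u j)).val t x| ≤ κ * ν ^ 2)
    {f : SmoothPer T} (hf : matD u f = divGrad (cst κ) f) {D S : ℝ}
    (hD : TBound (κ • gradSq f) D)
    (hS : ∀ ε > 0, ∀ᶠ t in 𝓝[>] (0 : ℝ), (gradSq f).integ t ≤ S + ε) :
    (∀ t ∈ Ioo 0 T, (gradSq f).integ t ≤ S + 6 * ν ^ 2 * D) ∧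
      TBound ((2 : ℝ) • (κ • hessSq f)) (S + 6 * ν ^ 2 * D) := by
  refine bounds_of_energy_ineq (val_gradSq_nonneg f) (fun t x => ?_)
    (fun t₀ t₁ h₀ h₁ h₂ => integ_add_tinteg_le (p := (6 * ν ^ 2) • (κ • gradSq f)) ?_
      (hD.smul (by positivity)) h₀ h₁ h₂) fun ε hε => (hS ε hε).frequently
  · rw [val_smul, val_smul]
    have := val_hessSq_nonneg f t x
    positivity
  · intro t ht
    rw [gradient_energy_cst hu (by rw [hf, add_zero]) ht]
    refine integ_mono ht fun x => ?_
    -- The constant is 6 = 2 · (3/2) · 2, because both factors of the bilinear form are ∇f.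
    have h1 := abs_sum_sum_mul_le (fun i j => hdu i j t ht x) (fun i => (dx i f).val t x)
      (fun j => (dx j f).val t x)
    have h2 := (abs_le.1 h1).1
    simp only [hessSq, map_zero, mul_zero, Finset.sum_const_zero, val_sub, val_mul, val_smul,
      val_sum, val_ofNat _ ht, val_zero, val_gradSq]
    linarith

theorem hessSq_bounds {u : Fin 3 → SmoothPer T} (hu : ∑ j, dx j (u j) = 0) {κ ν K : ℝ}
    (hκ : 0 < κ) (hK : 0 ≤ K)
    (hdu : ∀ i j, ∀ t ∈ Ioo 0 T, ∀ x, |(dx i (u j)).val t x| ≤ κ * ν ^ 2)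
    (hddu : ∀ i j k, ∀ t ∈ Ioo 0 T, ∀ x, |(dx i (dx j (u k))).val t x| ≤ K * κ * ν ^ 3)
    {f : SmoothPer T} (hf : matD u f = divGrad (cst κ) f) {X Y S : ℝ}
    (hX : TBound (κ • gradSq f) X) (hY : TBound (κ • hessSq f) Y)
    (hS : ∀ ε > 0, ∀ᶠ t in 𝓝[>] (0 : ℝ), (hessSq f).integ t ≤ S + ε) :
    (∀ t ∈ Ioo 0 T, (hessSq f).integ t
        ≤ S + ((12 + 3 * K) * ν ^ 2 * Y + 9 * K * ν ^ 4 * X)) ∧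
      TBound ((2 : ℝ) • (κ • thirdSq f))
        (S + ((12 + 3 * K) * ν ^ 2 * Y + 9 * K * ν ^ 4 * X)) := by
  refine bounds_of_energy_ineq (val_hessSq_nonneg f) (fun t x => ?_)
    (fun t₀ t₁ h₀ h₁ h₂ => integ_add_tinteg_le
      (p := ((12 + 3 * K) * ν ^ 2) • (κ • hessSq f) + (9 * K * ν ^ 4) • (κ • gradSq f)) ?_
      ((hY.smul (by positivity)).add (hX.smul (by positivity))) h₀ h₁ h₂) fun ε hε => (hS ε hε).frequently
  · rw [val_smul, val_smul]
    have := val_thirdSq_nonneg f t x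
    positivity
  · intro t ht
    have hk : ∀ k, matD u (dx k f) = divGrad (cst κ) (dx k f) + -∑ j, dx k (u j) * dx j f := by
      intro k
      rw [matD_dx, hf]
      simp only [divGrad, Fin.sum_univ_three, map_add, dx_mul, dx_cst, zero_mul, zero_add,
        dx_comm k]
      ring
    have hsum : (dt (hessSq f)).integ t = ∑ k, (dt (gradSq (dx k f))).integ t := by
      rw [hessSq, map_sum, integ_sum _ _ ht]
    rw [hsum, Finset.sum_congr rfl fun k _ => gradient_energy_cst hu (hk k) ht,
      ← integ_sum _ _ ht]
    refine integ_mono ht fun x => ?_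
    -- Two of the three terms are of the form ∇u ∇²f ∇²f and give 6 + 6 = 12. The third is ∇²u ∇f
    -- ∇²f: the weighted inequality gives 3K for the Hessian and, after summation over k, 9K for the
    -- gradient.
    have h1 : ∀ k, |∑ i, ∑ j, (dx i (u j)).val t x * (dx j (dx k f)).val t x
        * (dx i (dx k f)).val t x| ≤ _ := fun k =>
      abs_sum_sum_mul_le (fun i j => hdu i j t ht x) (fun i => (dx i (dx k f)).val t x)
        (fun j => (dx j (dx k f)).val t x)
    have h2 : ∀ i, |∑ k, ∑ j, (dx k (u j)).val t x * (dx i (dx j f)).val t x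
        * (dx i (dx k f)).val t x| ≤ _ := fun i =>
      abs_sum_sum_mul_le (fun k j => hdu k j t ht x) (fun k => (dx i (dx k f)).val t x)
        (fun j => (dx i (dx j f)).val t x)
    have h3 : ∀ k, |∑ i, ∑ j, (dx i (dx k (u j))).val t x * (dx j f).val t x
        * (dx i (dx k f)).val t x| ≤ _ := fun k =>
      abs_sum_sum_mul_le_weighted (M := K * κ * ν ^ 2) (ν := ν) (by positivity)
        (fun i j => (hddu i k j t ht x).trans (by nlinarith))
        (fun i => (dx i (dx k f)).val t x) (fun j => (dx j f).val t x)
    simp only [val_sum, val_sub, val_add, val_mul, val_smul, val_ofNat _ ht, thirdSq, map_neg,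
      map_sum, dx_mul, val_neg, val_hessSq, val_gradSq]
    simp only [Fin.sum_univ_three] at h1 h2 h3 ⊢
    have a0 := (abs_le.1 (h1 0)).1
    have a1 := (abs_le.1 (h1 1)).1
    have a2 := (abs_le.1 (h1 2)).1
    have b0 := (abs_le.1 (h2 0)).1
    have b1 := (abs_le.1 (h2 1)).1
    have b2 := (abs_le.1 (h2 2)).1
    have c0 := (abs_le.1 (h3 0)).1
    have c1 := (abs_le.1 (h3 1)).1
    have c2 := (abs_le.1 (h3 2)).1
    simp only [dx_comm 1 0, dx_comm 2 0, dx_comm 2 1] at a0 a1 a2 b0 b1 b2 c0 c1 c2 ⊢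
    linarith

end SmoothPer

end TimeAveraging

namespace TimeAveraging

namespace SmoothPer

variable {T : ℝ}

/-! ### Dissipation bounds and regularity -/

theorem val_nonneg_of_Ioo {f : SmoothPer T} (h : ∀ t ∈ Ioo 0 T, ∀ x, 0 ≤ f.val t x) (t : ℝ)
    (x : E3) : 0 ≤ f.val t x := by
  by_cases ht : t ∈ Ioo 0 T
  · exact h t ht x
  · exact (zext_of_notMem f.1 fun h => ht h.1).ge

theorem tbound_zero : TBound (0 : SmoothPer T) 0 := fun t₀ t₁ _ _ _ => by
  simp [tinteg, integ_zero]

theorem tbound_of_integ_le {f : SmoothPer T} {Y : ℝ} (hY0 : 0 ≤ Y)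
    (hY : ∀ t ∈ Ioo 0 T, f.integ t ≤ Y) : TBound f (T * Y) := by
  intro t₀ t₁ h₀ h₁ h₂
  have h := intervalIntegral.integral_mono_on (g := fun _ => Y) h₁
    (intervalIntegrable_integ f h₀ h₁ h₂) (by simp) fun t ht => hY t (mem_Ioo_of_le h₀ h₂ ht)
  rw [intervalIntegral.integral_const, smul_eq_mul] at h
  exact h.trans (mul_le_mul_of_nonneg_right (by linarith) hY0)

theorem energy_bounds {u : Fin 3 → SmoothPer T} (hu : ∑ j, dx j (u j) = 0) {f a : SmoothPer T}
    (hf : matD u f = divGrad a f) (ha : ∀ t ∈ Ioo 0 T, ∀ x, 0 ≤ a.val t x) {Y : ℝ}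
    (hY : ∀ᶠ t in 𝓝[>] (0 : ℝ), (f ^ 2).integ t ≤ Y) :
    (∀ t ∈ Ioo 0 T, (f ^ 2).integ t ≤ Y) ∧ TBound ((2 : ℝ) • (a * gradSq f)) Y := by
  have h0 : ∀ t ∈ Ioo 0 T, ∀ x, 0 ≤ ((2 : ℝ) • (a * gradSq f)).val t x := fun t ht x => by
    rw [val_smul, val_mul]
    have := ha t ht x
    have := val_gradSq_nonneg f t x
    positivity
  have h := bounds_of_energy_ineq (g := f ^ 2) (S := Y) (X := 0)
    (fun t x => by rw [val_sq]; positivity) (val_nonneg_of_Ioo h0)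
    (fun t₀ t₁ h₀ h₁ h₂ => integ_add_tinteg_le (p := 0) (fun t ht => ?_) tbound_zero h₀ h₁ h₂)
    fun ε hε => (hY.mono fun t ht => by linarith).frequently
  · simpa using h
  · rw [energy hu (r := 0) (by rw [hf, add_zero]) ht]
    refine integ_mono ht fun x => ?_
    simp [val_ofNat _ ht]

theorem gradSq_mul_le {u f : SmoothPer T} {U : ℝ} {t : ℝ} {x : E3} (h0 : |u.val t x| ≤ U)
    (h1 : ∀ i, |(dx i u).val t x| ≤ U) :
    (gradSq (u * f)).val t x ≤ 2 * U ^ 2 * (3 * f.val t x ^ 2 + (gradSq f).val t x) := by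
  have h0' := sq_le_sq' (abs_le.1 h0).1 (abs_le.1 h0).2
  have key : ∀ i, (dx i (u * f)).val t x ^ 2
      ≤ 2 * U ^ 2 * (f.val t x ^ 2 + (dx i f).val t x ^ 2) := fun i => by
    have h1' := sq_le_sq' (abs_le.1 (h1 i)).1 (abs_le.1 (h1 i)).2
    rw [dx_mul, val_add, val_mul, val_mul]
    nlinarith [mul_le_mul_of_nonneg_right h1' (sq_nonneg (f.val t x)),
      mul_le_mul_of_nonneg_right h0' (sq_nonneg ((dx i f).val t x)),
      sq_nonneg ((dx i u).val t x * f.val t x - u.val t x * (dx i f).val t x)]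
  rw [val_gradSq, val_gradSq]
  refine (Finset.sum_le_sum fun i _ => key i).trans (le_of_eq ?_)
  simp only [Fin.sum_univ_three]
  ring

theorem add_four_sq_le (y z v w : ℝ) :
    (y + z + (v + w)) ^ 2 ≤ 4 * (y ^ 2 + z ^ 2 + v ^ 2 + w ^ 2) := by
  nlinarith [sq_nonneg (y - z), sq_nonneg (v - w), sq_nonneg (y + z - (v + w))]

theorem mul_sq_le {y z U : ℝ} (hy : |y| ≤ U) : (y * z) ^ 2 ≤ U ^ 2 * z ^ 2 := by
  rw [mul_pow]
  exact mul_le_mul_of_nonneg_right (sq_le_sq' (abs_le.1 hy).1 (abs_le.1 hy).2) (sq_nonneg z)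

theorem sq_add_four_le {a b c d U p q r s : ℝ} (ha : |a| ≤ U) (hb : |b| ≤ U) (hc : |c| ≤ U)
    (hd : |d| ≤ U) : (a * p + b * q + (c * r + d * s)) ^ 2
      ≤ 4 * U ^ 2 * (p ^ 2 + q ^ 2 + r ^ 2 + s ^ 2) := by
  refine (add_four_sq_le _ _ _ _).trans ?_
  linarith [mul_sq_le (z := p) ha, mul_sq_le (z := q) hb, mul_sq_le (z := r) hc,
    mul_sq_le (z := s) hd]

theorem hessSq_mul_le {u f : SmoothPer T} {U : ℝ} {t : ℝ} {x : E3} (h0 : |u.val t x| ≤ U)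
    (h1 : ∀ i, |(dx i u).val t x| ≤ U) (h2 : ∀ i j, |(dx i (dx j u)).val t x| ≤ U) :
    (hessSq (u * f)).val t x
      ≤ 4 * U ^ 2 * (9 * f.val t x ^ 2 + 6 * (gradSq f).val t x + (hessSq f).val t x) := by
  have key : ∀ i j, (dx j (dx i (u * f))).val t x ^ 2
      ≤ 4 * U ^ 2 * (f.val t x ^ 2 + (dx j f).val t x ^ 2 + (dx i f).val t x ^ 2
        + (dx j (dx i f)).val t x ^ 2) := fun i j => by
    rw [dx_mul, map_add, dx_mul, dx_mul]
    simp only [val_add, val_mul]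
    exact sq_add_four_le (h2 j i) (h1 i) (h1 j) h0
  rw [val_hessSq, val_hessSq, val_gradSq]
  refine (Finset.sum_le_sum fun i _ => Finset.sum_le_sum fun j _ => key i j).trans (le_of_eq ?_)
  simp only [Fin.sum_univ_three]
  ring

theorem tbound_sum {ι : Type*} (s : Finset ι) {f : ι → SmoothPer T} {X : ι → ℝ}
    (h : ∀ i ∈ s, TBound (f i) (X i)) : TBound (∑ i ∈ s, f i) (∑ i ∈ s, X i) := by
  classical
  induction s using Finset.induction_on with
  | empty => simpa using tbound_zero
  | insert i s hi ih =>
    rw [Finset.sum_insert hi, Finset.sum_insert hi]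
    exact (h i (Finset.mem_insert_self _ _)).add
      (ih fun j hj => h j (Finset.mem_insert_of_mem hj))

/-- Parabolic regularity up to the initial time for constant diffusivity, in scale-invariant
form: each derivative costs a factor `ν`. -/
theorem regularity (hT : 0 < T) {u : Fin 3 → SmoothPer T} (hu : ∑ j, dx j (u j) = 0)
    {κ ν K U : ℝ} (hκ : 0 < κ) (hK : 1 ≤ K)
    (hu0 : ∀ j, ∀ t ∈ Ioo 0 T, ∀ x, |(u j).val t x| ≤ U)
    (hdu : ∀ i j, ∀ t ∈ Ioo 0 T, ∀ x, |(dx i (u j)).val t x| ≤ κ * ν ^ 2)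
    (hddu : ∀ i j k, ∀ t ∈ Ioo 0 T, ∀ x, |(dx i (dx j (u k))).val t x| ≤ K * κ * ν ^ 3)
    {f : SmoothPer T} (hf : matD u f = divGrad (cst κ) f) {f₀ : E3 → ℝ}
    (hlim : ∀ k, Tendsto (coefSq f k) (𝓝[>] 0) (𝓝 (‖fourierCoef f₀ k‖ ^ 2)))
    {Y : ℝ} (hY : ∀ᶠ t in 𝓝[>] (0 : ℝ), (f ^ 2).integ t ≤ Y) {D : ℝ} (hD0 : 0 ≤ D)
    (hD : TBound (κ • gradSq f) D)
    (hS₁ : sobolevSq 1 f₀ ≤ ENNReal.ofReal (K * ν ^ 2 * D))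
    (hS₂ : sobolevSq 2 f₀ ≤ ENNReal.ofReal (K * ν ^ 4 * D)) :
    ((∀ t ∈ Ioo 0 T, (gradSq f).integ t ≤ 115 * K ^ 2 * (ν ^ 2 * D)) ∧
      ∀ t ∈ Ioo 0 T, (hessSq f).integ t ≤ 115 * K ^ 2 * (ν ^ 4 * D)) ∧
    TBound (κ • hessSq f) (115 * K ^ 2 * (ν ^ 2 * D)) ∧
    TBound (κ • thirdSq f) (115 * K ^ 2 * (ν ^ 4 * D)) := by
  -- A common bound for u, ∇u and ∇²u. It is used only for finiteness of the time integrals of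
  -- derivatives of uⱼf, and drops out of the estimates.
  set V := U + κ * ν ^ 2 + |K * κ * ν ^ 3| with hV
  have hT2 : T / 2 ∈ Ioo 0 T := ⟨by positivity, by linarith⟩
  have hU0 : 0 ≤ U := (abs_nonneg _).trans (hu0 0 _ hT2 0)
  have hκν : 0 ≤ κ * ν ^ 2 := by positivity
  have b0 : ∀ j, ∀ t ∈ Ioo 0 T, ∀ x, |(u j).val t x| ≤ V := fun j t ht x =>
    (hu0 j t ht x).trans (by linarith [abs_nonneg (K * κ * ν ^ 3)])
  have b1 : ∀ i j, ∀ t ∈ Ioo 0 T, ∀ x, |(dx i (u j)).val t x| ≤ V := fun i j t ht x =>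
    (hdu i j t ht x).trans (by linarith [abs_nonneg (K * κ * ν ^ 3)])
  have b2 : ∀ i j k, ∀ t ∈ Ioo 0 T, ∀ x, |(dx i (dx j (u k))).val t x| ≤ V := fun i j k t ht x =>
    (hddu i j k t ht x).trans (by linarith [le_abs_self (K * κ * ν ^ 3)])
  have hfY := (energy_bounds hu hf (fun t ht x => by rw [val_algebraMap _ ht]; exact hκ.le) hY).1
  have hY0 : 0 ≤ Y := (integ_nonneg (f := f ^ 2) fun x => by rw [val_sq]; positivity).trans
    (hfY _ hT2)
  have t0 : TBound (f ^ 2) (T * Y) := tbound_of_integ_le hY0 hfY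
  have t1 : TBound (gradSq f) (κ⁻¹ * D) := by
    have := hD.smul (inv_nonneg.2 hκ.le)
    rwa [smul_smul, inv_mul_cancel₀ hκ.ne', one_smul] at this
  have s1 := tbound_sum Finset.univ fun j (_ : j ∈ Finset.univ) =>
    TBound.mono (f := gradSq (u j * f)) (((t0.smul (by norm_num : (0 : ℝ) ≤ 3)).add t1).smul
      (by positivity : 0 ≤ 2 * V ^ 2)) fun t ht x => by
        simpa only [val_add, val_smul, val_sq] using
            gradSq_mul_le (f := f) (b0 j t ht x) fun i => b1 i j t ht x
  obtain ⟨g1, g2⟩ := gradSq_bounds hu hκ hdu hf hD fun ε hε =>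
    eventually_sobDens_le hT hu hκ hf 1 hlim (by positivity) hS₁ s1 hε
  have hν2 : 0 ≤ ν ^ 2 * D := by positivity
  have hν4 : 0 ≤ ν ^ 4 * D := by positivity
  have hK2 : K ≤ K ^ 2 := by nlinarith
  have g2' : TBound (κ • hessSq f) (7 * K * (ν ^ 2 * D)) := by
    have := g2.smul (by norm_num : (0 : ℝ) ≤ 1 / 2)
    rw [smul_smul, show (1 / 2 : ℝ) * 2 = 1 by norm_num, one_smul] at this
    exact this.le (by nlinarith)
  have t2 : TBound (hessSq f) (κ⁻¹ * (7 * K * (ν ^ 2 * D))) := by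
    have := g2'.smul (inv_nonneg.2 hκ.le)
    rwa [smul_smul, inv_mul_cancel₀ hκ.ne', one_smul] at this
  -- The order-two bound near time 0 needs |∇²(uⱼf)|² integrable in time, which the order-one
  -- estimate has just provided.
  have s2 := tbound_sum Finset.univ fun j (_ : j ∈ Finset.univ) =>
    TBound.mono (f := hessSq (u j * f)) ((((t0.smul (by norm_num : (0 : ℝ) ≤ 9)).add
      (t1.smul (by norm_num : (0 : ℝ) ≤ 6))).add t2).smul
      (by positivity : 0 ≤ 4 * V ^ 2)) fun t ht x => by
        simpa only [val_add, val_smul, val_sq] using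
            hessSq_mul_le (f := f) (b0 j t ht x) (fun i => b1 i j t ht x) fun i k => b2 i k j t ht x
  obtain ⟨g3, g4⟩ := hessSq_bounds hu hκ (by linarith) hdu hddu hf hD g2' fun ε hε =>
    eventually_sobDens_le hT hu hκ hf 2 hlim (by positivity) hS₂ s2 hε
  -- The coefficient on the left is K + 7K(12+3K) + 9K = 94K + 21K², and 94 + 21 = 115 since K ≥ 1.
  have hc : K * ν ^ 4 * D + ((12 + 3 * K) * ν ^ 2 * (7 * K * (ν ^ 2 * D)) + 9 * K * ν ^ 4 * D)
      ≤ 115 * K ^ 2 * (ν ^ 4 * D) := by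
    have : K + ((12 + 3 * K) * (7 * K) + 9 * K) ≤ 115 * K ^ 2 := by nlinarith
    nlinarith
  have hc1 : K * ν ^ 2 * D + 6 * ν ^ 2 * D ≤ 115 * K ^ 2 * (ν ^ 2 * D) := by
    have : K + 6 ≤ 115 * K ^ 2 := by nlinarith
    nlinarith
  refine ⟨⟨fun t ht => (g1 t ht).trans hc1, fun t ht => (g3 t ht).trans hc⟩,
    g2'.le (mul_le_mul_of_nonneg_right (by nlinarith) hν2), ?_⟩
  have := g4.smul (by norm_num : (0 : ℝ) ≤ 1 / 2)
  rw [smul_smul, show (1 / 2 : ℝ) * 2 = 1 by norm_num, one_smul] at this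
  refine this.le ?_
  have h0 : 0 ≤ 115 * K ^ 2 * (ν ^ 4 * D) := by positivity
  linarith

end SmoothPer

end TimeAveraging

namespace TimeAveraging

/-! ### Pointwise bounds for second-order expressions -/

theorem sum_three_sq_le (x : Fin 3 → ℝ) : (∑ j, x j) ^ 2 ≤ 3 * ∑ j, x j ^ 2 := by
  simpa using sq_sum_le_card_mul_sum_sq (s := (Finset.univ : Finset (Fin 3))) (f := x)

theorem sum_diag_sq_le (c : Fin 3 → Fin 3 → ℝ) : ∑ j, c j j ^ 2 ≤ ∑ i, ∑ j, c i j ^ 2 :=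
  Finset.sum_le_sum fun i _ => Finset.single_le_sum (f := fun j => c i j ^ 2)
    (fun _ _ => sq_nonneg _) (Finset.mem_univ i)

namespace SmoothPer

variable {T : ℝ}

theorem sum_pure_second_sq_le (f : SmoothPer T) (t : ℝ) (x : E3) :
    ∑ j, (dx j (dx j f)).val t x ^ 2 ≤ (hessSq f).val t x := by
  rw [val_hessSq]
  exact sum_diag_sq_le fun i j => (dx j (dx i f)).val t x

theorem sum_grad_second_sq_le (f : SmoothPer T) (t : ℝ) (x : E3) :
    ∑ i, ∑ j, (dx i (dx j (dx j f))).val t x ^ 2 ≤ (thirdSq f).val t x := by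
  rw [val_thirdSq, Finset.sum_comm]
  refine Finset.sum_le_sum fun j _ => ?_
  exact Finset.single_le_sum (f := fun k => ∑ i, (dx i (dx k (dx j f))).val t x ^ 2)
    (fun k _ => by positivity) (Finset.mem_univ j)

variable {b f : SmoothPer T} {β ν : ℝ} {t : ℝ} {x : E3}

theorem divGrad_sq_le (h0 : |b.val t x| ≤ β) (h1 : ∀ i, |(dx i b).val t x| ≤ β * ν) :
    (divGrad b f).val t x ^ 2
      ≤ 6 * β ^ 2 * (ν ^ 2 * (gradSq f).val t x + (hessSq f).val t x) := by
  have key : ∀ j, (dx j (b * dx j f)).val t x ^ 2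
      ≤ 2 * β ^ 2 * (ν ^ 2 * (dx j f).val t x ^ 2 + (dx j (dx j f)).val t x ^ 2) := fun j => by
    rw [dx_mul, val_add, val_mul, val_mul]
    refine add_sq_le.trans ?_
    have e1 := mul_sq_le (z := (dx j f).val t x) (h1 j)
    have e2 := mul_sq_le (z := (dx j (dx j f)).val t x) h0
    linarith
  rw [divGrad, val_sum]
  refine (sum_three_sq_le _).trans ?_
  have h2 := Finset.sum_le_sum fun j (_ : j ∈ Finset.univ) => key j
  rw [← Finset.mul_sum, Finset.sum_add_distrib, ← Finset.mul_sum] at h2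
  have h3 := mul_le_mul_of_nonneg_left (sum_pure_second_sq_le f t x)
    (by positivity : 0 ≤ 2 * β ^ 2)
  rw [val_gradSq]
  linarith

/-- Four terms from the product rule and the sum over j give 3 · 4 = 12. The terms independent of
one index count three times, so the Hessian receives 12 + 36 = 48, the largest coefficient. -/
theorem gradSq_divGrad_le (h0 : |b.val t x| ≤ β) (h1 : ∀ i, |(dx i b).val t x| ≤ β * ν)
    (h2 : ∀ i j, |(dx i (dx j b)).val t x| ≤ β * ν ^ 2) :
    (gradSq (divGrad b f)).val t x ≤ 48 * β ^ 2 * ((thirdSq f).val t x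
      + ν ^ 2 * (hessSq f).val t x + ν ^ 4 * (gradSq f).val t x) := by
  have key : ∀ i j, (dx i (dx j (b * dx j f))).val t x ^ 2
      ≤ 4 * β ^ 2 * (ν ^ 4 * (dx j f).val t x ^ 2 + ν ^ 2 * (dx j (dx i f)).val t x ^ 2
        + ν ^ 2 * (dx j (dx j f)).val t x ^ 2 + (dx i (dx j (dx j f))).val t x ^ 2) :=
    fun i j => by
    rw [dx_mul, map_add, dx_mul, dx_mul, dx_comm i j f]
    simp only [val_add, val_mul]
    refine (add_four_sq_le _ _ _ _).trans ?_
    have e1 := mul_sq_le (z := (dx j f).val t x) (h2 i j)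
    have e2 := mul_sq_le (z := (dx j (dx i f)).val t x) (h1 j)
    have e3 := mul_sq_le (z := (dx j (dx j f)).val t x) (h1 i)
    have e4 := mul_sq_le (z := (dx i (dx j (dx j f))).val t x) h0
    linarith
  have h3 : (gradSq (divGrad b f)).val t x
      ≤ ∑ i, 3 * ∑ j, (dx i (dx j (b * dx j f))).val t x ^ 2 := by
    rw [val_gradSq]
    refine Finset.sum_le_sum fun i _ => ?_
    rw [divGrad, map_sum, val_sum]
    exact sum_three_sq_le _
  have h4 := Finset.sum_le_sum fun i (_ : i ∈ Finset.univ) =>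
    Finset.sum_le_sum fun j (_ : j ∈ Finset.univ) => key i j
  simp only [← Finset.mul_sum, Finset.sum_add_distrib, Finset.sum_const, Finset.card_univ,
    Fintype.card_fin, nsmul_eq_mul] at h3 h4
  have h5 := mul_le_mul_of_nonneg_left (sum_pure_second_sq_le f t x)
    (by positivity : 0 ≤ 36 * β ^ 2 * ν ^ 2)
  have h6 := mul_le_mul_of_nonneg_left (sum_grad_second_sq_le f t x)
    (by positivity : 0 ≤ 12 * β ^ 2)
  have h7 : 0 ≤ β ^ 2 * (thirdSq f).val t x := mul_nonneg (sq_nonneg _) (val_thirdSq_nonneg f t x)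
  have h8 : 0 ≤ β ^ 2 * (ν ^ 4 * (gradSq f).val t x) :=
    mul_nonneg (sq_nonneg _) (mul_nonneg (by positivity) (val_gradSq_nonneg f t x))
  rw [← val_hessSq, ← val_gradSq] at h4
  push_cast at h4
  linarith

end SmoothPer

end TimeAveraging

namespace TimeAveraging

namespace SmoothPer

variable {T : ℝ}

/-! ### The corrected difference -/

/-- The setting of the averaging argument: `f` solves the averaged equation, `w` is the
difference to the solution of the oscillating one, `q` is the oscillating profile, and `A` is a
fast primitive of `q - 1`. -/
structure Averaging (T κ₀ κ₁ τ ν K : ℝ) (u : Fin 3 → SmoothPer T) (q A f w : SmoothPer T) :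
    Prop where
  pos₀ : 0 < κ₀
  pos₁ : 0 < κ₁
  posτ : 0 < τ
  one_le : 1 ≤ K
  divFree : ∑ j, dx j (u j) = 0
  eq_avg : matD u f = divGrad (cst (κ₀ + κ₁)) f
  eq_diff : matD u w = divGrad (cst κ₀ + cst κ₁ * q) w + divGrad (cst κ₁ * (q - 1)) f
  profile_mem : ∀ t ∈ Ioo 0 T, ∀ x, 0 ≤ q.val t x ∧ q.val t x ≤ K
  dx_profile : ∀ i, ∀ t ∈ Ioo 0 T, ∀ x, |(dx i q).val t x| ≤ K * ν
  dx_dx_profile : ∀ i j, ∀ t ∈ Ioo 0 T, ∀ x, |(dx i (dx j q)).val t x| ≤ K * ν ^ 2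
  corr_mem : ∀ t ∈ Ioo 0 T, ∀ x, 0 ≤ A.val t x ∧ A.val t x ≤ K
  dx_corr : ∀ i, ∀ t ∈ Ioo 0 T, ∀ x, |(dx i A).val t x| ≤ K * ν
  dx_dx_corr : ∀ i j, ∀ t ∈ Ioo 0 T, ∀ x, |(dx i (dx j A)).val t x| ≤ K * ν ^ 2
  matD_corr : ∀ t ∈ Ioo 0 T, ∀ x,
    |(matD u A).val t x - 1 / τ * (q.val t x - 1)| ≤ K * ((κ₀ + κ₁) * ν ^ 2)
  dx_vel : ∀ i j, ∀ t ∈ Ioo 0 T, ∀ x, |(dx i (u j)).val t x| ≤ (κ₀ + κ₁) * ν ^ 2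

/-- The diffusive flux of the first-order corrector. -/
def corrFlux (c : ℝ) (A f : SmoothPer T) (j : Fin 3) : SmoothPer T := cst c * A * dx j f

theorem divGrad_cst_mul (c : ℝ) (A f : SmoothPer T) :
    divGrad (cst c * A) f = ∑ j, dx j (corrFlux c A f j) := rfl

/-- The part of the advected corrector flux that does not reproduce the oscillating source. -/
def remFlux (u : Fin 3 → SmoothPer T) (κ₁ τ : ℝ) (q A f : SmoothPer T) (j : Fin 3) :
    SmoothPer T :=
  matD u (corrFlux (τ * κ₁) A f j) - cst κ₁ * (q - 1) * dx j f
    - ∑ i, dx i (u j) * corrFlux (τ * κ₁) A f i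

/-- Commuting D_t with a divergence costs div(P·∇u), up to the term P·∇(div u), which vanishes. -/
theorem matD_sum_dx {u : Fin 3 → SmoothPer T} (hu : ∑ j, dx j (u j) = 0)
    (P : Fin 3 → SmoothPer T) :
    matD u (∑ j, dx j (P j)) = ∑ j, dx j (matD u (P j) - ∑ i, dx i (u j) * P i) := by
  have h : ∀ i, ∑ j, dx j (dx i (u j)) = 0 := fun i => by
    rw [Finset.sum_congr rfl fun j _ => dx_comm j i (u j), ← map_sum, hu, map_zero]
  have h2 : ∑ i, P i * ∑ j, dx j (dx i (u j)) = 0 := by simp [h]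
  simp only [Fin.sum_univ_three] at h2
  simp only [matD_dx, map_sub, dx_mul, Fin.sum_univ_three, map_add]
  linear_combination (exp := 1) h2

theorem matD_corr_eq {u : Fin 3 → SmoothPer T} (hu : ∑ j, dx j (u j) = 0) (κ₁ τ : ℝ)
    (q A f : SmoothPer T) :
    matD u (divGrad (cst (τ * κ₁) * A) f)
      = divGrad (cst κ₁ * (q - 1)) f + ∑ j, dx j (remFlux u κ₁ τ q A f j) := by
  rw [divGrad_cst_mul, matD_sum_dx hu, divGrad, ← Finset.sum_add_distrib]
  refine Finset.sum_congr rfl fun j _ => ?_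
  rw [← map_add, remFlux]
  congr 1
  ring

namespace Averaging

variable {κ₀ κ₁ τ ν K : ℝ} {u : Fin 3 → SmoothPer T} {q A f w : SmoothPer T}

theorem remFlux_eq (h : Averaging T κ₀ κ₁ τ ν K u q A f w) (j : Fin 3) {t : ℝ}
    (ht : t ∈ Ioo 0 T) (x : E3) :
    (remFlux u κ₁ τ q A f j).val t x = τ * κ₁ *
      (((matD u A).val t x - 1 / τ * (q.val t x - 1)) * (dx j f).val t x
        + A.val t x * (dx j (divGrad (cst (κ₀ + κ₁)) f)).val t x
        + (-(A.val t x * ∑ i, (dx j (u i)).val t x * (dx i f).val t x)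
          + -(A.val t x * ∑ i, (dx i (u j)).val t x * (dx i f).val t x))) := by
  have hτ := h.posτ.ne'
  simp only [remFlux, corrFlux, matD_mul, matD_dx, h.eq_avg, matD_cst, val_sub, val_sum, val_mul,
    val_add, val_algebraMap _ ht, val_one ht, val_zero]
  simp only [Fin.sum_univ_three]
  field_simp
  ring

end Averaging

end SmoothPer

end TimeAveraging

namespace TimeAveraging

/-! ### The pointwise differential inequality -/

theorem two_mul_mul_le {c : ℝ} (hc : 0 < c) (x y : ℝ) : 2 * (x * y) ≤ c * x ^ 2 + y ^ 2 / c := by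
  have h : c * x ^ 2 + y ^ 2 / c - 2 * (x * y) = (c * x - y) ^ 2 / c := by
    field_simp
    ring
  have : 0 ≤ (c * x - y) ^ 2 / c := by positivity
  linarith

theorem two_mul_sum_le {c : ℝ} (hc : 0 < c) (x y : Fin 3 → ℝ) :
    2 * ∑ i, x i * y i ≤ c * ∑ i, x i ^ 2 + (∑ i, y i ^ 2) / c := by
  rw [Finset.mul_sum, Finset.mul_sum, Finset.sum_div, ← Finset.sum_add_distrib]
  exact Finset.sum_le_sum fun i _ => two_mul_mul_le hc _ _

/-- With θ = w - χ the left side is -(3/2)a|w|² + 2a w·χ + 2w·G - 2χ·G - ½κ|w|². The a-terms are at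
most 2a|χ|², so the possibly small a is not needed for coercivity. Young with weight κ/8 for w·G
leaves -(3/8)κ|w|² and 8|G|²/κ, and χ·G contributes one more |G|²/κ. -/
theorem corrected_dissipation_le {a κ : ℝ} (ha : 0 ≤ a) (hκ : 0 < κ) (θ w χ G : Fin 3 → ℝ)
    (hθ : ∀ i, θ i = w i - χ i) :
    -(2 * ∑ i, θ i * (a * χ i - G i)) - 2 * (a * ∑ i, θ i ^ 2) + 1 / 2 * (a - κ) * ∑ i, w i ^ 2
      ≤ -(3 / 8) * (κ * ∑ i, w i ^ 2) + (2 * a + κ) * ∑ i, χ i ^ 2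
        + 9 * ((∑ i, G i ^ 2) / κ) := by
  have h1 := two_mul_sum_le (by positivity : 0 < κ / 8) w G
  have h2 := two_mul_sum_le hκ (fun i => -χ i) G
  have h3 : (∑ i, G i ^ 2) / (κ / 8) = 8 * ((∑ i, G i ^ 2) / κ) := by
    field_simp
  have h4 : -(2 * ∑ i, θ i * (a * χ i - G i)) - 2 * (a * ∑ i, θ i ^ 2)
      + 1 / 2 * a * ∑ i, w i ^ 2 ≤ 2 * ∑ i, w i * G i + 2 * ∑ i, -χ i * G i
        + 2 * a * ∑ i, χ i ^ 2 := by
    simp only [Finset.mul_sum, ← Finset.sum_neg_distrib, ← Finset.sum_sub_distrib,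
      ← Finset.sum_add_distrib]
    refine Finset.sum_le_sum fun i _ => ?_
    rw [hθ i]
    nlinarith [mul_nonneg ha (sq_nonneg (w i + χ i)), mul_nonneg ha (sq_nonneg (w i - χ i)),
      mul_nonneg ha (sq_nonneg (w i)), mul_nonneg ha (sq_nonneg (3 * w i - 2 * χ i)),
      mul_nonneg ha (sq_nonneg (χ i))]
  simp only [neg_sq] at h2
  rw [h3] at h1
  linarith

namespace SmoothPer

variable {T : ℝ}

theorem abs_divGrad_le {b g : SmoothPer T} {β γ ν t : ℝ} {x : E3} (hβ : 0 ≤ β) (hν : 0 ≤ ν)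
    (h0 : |b.val t x| ≤ β)
    (h1 : ∀ i, |(dx i b).val t x| ≤ β * ν) (h2 : ∀ i, |(dx i g).val t x| ≤ γ * ν)
    (h3 : ∀ i, |(dx i (dx i g)).val t x| ≤ γ * ν ^ 2) :
    |(divGrad b g).val t x| ≤ 6 * (β * γ * ν ^ 2) := by
  rw [divGrad, val_sum]
  refine (Finset.abs_sum_le_sum_abs _ _).trans ?_
  have key : ∀ j, |(dx j (b * dx j g)).val t x| ≤ 2 * (β * γ * ν ^ 2) := fun j => by
    rw [dx_mul, val_add, val_mul, val_mul]
    refine (abs_add_le _ _).trans ?_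
    rw [abs_mul, abs_mul]
    have e1 := mul_le_mul (h1 j) (h2 j) (abs_nonneg _) (by positivity)
    have e2 := mul_le_mul h0 (h3 j) (abs_nonneg _) hβ
    linarith
  refine (Finset.sum_le_sum fun j _ => key j).trans (le_of_eq ?_)
  simp
  ring

/-- The density of the scale-invariant third-order norm. -/
def regDens (ν : ℝ) (f : SmoothPer T) : SmoothPer T :=
  thirdSq f + ν ^ 2 • hessSq f + ν ^ 4 • gradSq f

theorem val_regDens (ν : ℝ) (f : SmoothPer T) (t : ℝ) (x : E3) :
    (regDens ν f).val t x = (thirdSq f).val t x + ν ^ 2 * (hessSq f).val t x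
      + ν ^ 4 * (gradSq f).val t x := by
  simp [regDens]

theorem val_regDens_nonneg (ν : ℝ) (f : SmoothPer T) (t : ℝ) (x : E3) :
    0 ≤ (regDens ν f).val t x := by
  rw [val_regDens]
  have h1 := val_thirdSq_nonneg f t x
  have h2 := val_hessSq_nonneg f t x
  have h3 := val_gradSq_nonneg f t x
  positivity

theorem gradSq_le_regDens (ν : ℝ) (f : SmoothPer T) (t : ℝ) (x : E3) :
    ν ^ 4 * (gradSq f).val t x ≤ (regDens ν f).val t x := by
  rw [val_regDens]
  have h1 := val_thirdSq_nonneg f t x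
  have h2 := val_hessSq_nonneg f t x
  have h3 : 0 ≤ ν ^ 2 * (hessSq f).val t x := by positivity
  linarith

/-- The oscillating diffusivity. -/
abbrev oscDiff (κ₀ κ₁ : ℝ) (q : SmoothPer T) : SmoothPer T := cst κ₀ + cst κ₁ * q

/-- The first-order corrector of `f`. -/
abbrev corr (κ₁ τ : ℝ) (A f : SmoothPer T) : SmoothPer T := divGrad (cst (τ * κ₁) * A) f

/-- The oscillating part of the diffusion of `f`. -/
abbrev oscSrc (κ₁ : ℝ) (q f : SmoothPer T) : SmoothPer T := divGrad (cst κ₁ * (q - 1)) f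

namespace Averaging

variable {κ₀ κ₁ τ ν K : ℝ} {u : Fin 3 → SmoothPer T} {q A f w : SmoothPer T}

theorem pos (h : Averaging T κ₀ κ₁ τ ν K u q A f w) : 0 < κ₀ + κ₁ := add_pos h.pos₀ h.pos₁

variable {t : ℝ}

theorem oscDiff_mem (h : Averaging T κ₀ κ₁ τ ν K u q A f w) (ht : t ∈ Ioo 0 T) (x : E3) :
    κ₀ ≤ (oscDiff κ₀ κ₁ q).val t x ∧ (oscDiff κ₀ κ₁ q).val t x ≤ K * (κ₀ + κ₁) := by
  obtain ⟨h1, h2⟩ := h.profile_mem t ht x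
  have h3 := h.pos₀
  have h4 := h.pos₁
  have h5 := h.one_le
  rw [val_add, val_mul, val_algebraMap _ ht, val_algebraMap _ ht]
  constructor <;> nlinarith

theorem abs_cst_mul_le {c d β : ℝ} {g : SmoothPer T} {x : E3} (ht : t ∈ Ioo 0 T) (hc : 0 ≤ c)
    (hcd : c ≤ d) (hg : |g.val t x| ≤ β) : |(cst c * g).val t x| ≤ d * β := by
  rw [val_mul, val_algebraMap _ ht, abs_mul, abs_of_nonneg hc]
  exact mul_le_mul hcd hg (abs_nonneg _) (hc.trans hcd)

theorem abs_oscDiff_le (h : Averaging T κ₀ κ₁ τ ν K u q A f w) (ht : t ∈ Ioo 0 T) (x : E3) :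
    |(oscDiff κ₀ κ₁ q).val t x| ≤ K * (κ₀ + κ₁) := by
  obtain ⟨h1, h2⟩ := h.oscDiff_mem ht x
  rwa [abs_of_nonneg (h.pos₀.le.trans h1)]

theorem abs_dx_oscDiff_le (h : Averaging T κ₀ κ₁ τ ν K u q A f w) (ht : t ∈ Ioo 0 T) (x : E3)
    (i : Fin 3) : |(dx i (oscDiff κ₀ κ₁ q)).val t x| ≤ K * (κ₀ + κ₁) * ν := by
  have h1 := abs_cst_mul_le (d := κ₀ + κ₁) ht h.pos₁.le (by linarith [h.pos₀])
    (h.dx_profile i t ht x)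
  rw [map_add, dx_mul, dx_cst, dx_cst, zero_mul, zero_add, zero_add]
  linarith

theorem abs_dx_dx_oscDiff_le (h : Averaging T κ₀ κ₁ τ ν K u q A f w) (ht : t ∈ Ioo 0 T) (x : E3)
    (i j : Fin 3) : |(dx i (dx j (oscDiff κ₀ κ₁ q))).val t x| ≤ K * (κ₀ + κ₁) * ν ^ 2 := by
  have h1 := abs_cst_mul_le (d := κ₀ + κ₁) ht h.pos₁.le (by linarith [h.pos₀])
    (h.dx_dx_profile i j t ht x)
  rw [map_add, dx_mul, dx_cst, dx_cst, zero_mul, zero_add, zero_add, dx_mul, dx_cst, zero_mul,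
    zero_add]
  linarith

theorem abs_corr_le (h : Averaging T κ₀ κ₁ τ ν K u q A f w) (ht : t ∈ Ioo 0 T) (x : E3) :
    |A.val t x| ≤ K := by
  obtain ⟨h1, h2⟩ := h.corr_mem t ht x
  rwa [abs_of_nonneg h1]

theorem corr_sq_le (h : Averaging T κ₀ κ₁ τ ν K u q A f w) (ht : t ∈ Ioo 0 T) (x : E3) :
    (corr κ₁ τ A f).val t x ^ 2 ≤ 6 * (τ * (κ₀ + κ₁) * K) ^ 2
      * (ν ^ 2 * (gradSq f).val t x + (hessSq f).val t x) := by
  have hc : 0 ≤ τ * κ₁ := mul_nonneg h.posτ.le h.pos₁.le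
  have hcd : τ * κ₁ ≤ τ * (κ₀ + κ₁) := mul_le_mul_of_nonneg_left (by linarith [h.pos₀]) h.posτ.le
  refine divGrad_sq_le (abs_cst_mul_le ht hc hcd (h.abs_corr_le ht x)) fun i => ?_
  rw [dx_mul, dx_cst, zero_mul, zero_add, mul_assoc]
  exact abs_cst_mul_le ht hc hcd (h.dx_corr i t ht x)

theorem gradSq_corr_le (h : Averaging T κ₀ κ₁ τ ν K u q A f w) (ht : t ∈ Ioo 0 T) (x : E3) :
    (gradSq (corr κ₁ τ A f)).val t x ≤ 48 * (τ * (κ₀ + κ₁) * K) ^ 2 * (regDens ν f).val t x := by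
  have hc : 0 ≤ τ * κ₁ := mul_nonneg h.posτ.le h.pos₁.le
  have hcd : τ * κ₁ ≤ τ * (κ₀ + κ₁) := mul_le_mul_of_nonneg_left (by linarith [h.pos₀]) h.posτ.le
  rw [val_regDens]
  refine gradSq_divGrad_le (abs_cst_mul_le ht hc hcd (h.abs_corr_le ht x)) (fun i => ?_)
    fun i j => ?_
  · rw [dx_mul, dx_cst, zero_mul, zero_add, mul_assoc]
    exact abs_cst_mul_le ht hc hcd (h.dx_corr i t ht x)
  · rw [dx_mul, dx_cst, zero_mul, zero_add, dx_mul, dx_cst, zero_mul, zero_add, mul_assoc]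
    exact abs_cst_mul_le ht hc hcd (h.dx_dx_corr i j t ht x)

theorem gradSq_oscSrc_le (h : Averaging T κ₀ κ₁ τ ν K u q A f w) (ht : t ∈ Ioo 0 T) (x : E3) :
    (gradSq (oscSrc κ₁ q f)).val t x ≤ 48 * ((κ₀ + κ₁) * K) ^ 2 * (regDens ν f).val t x := by
  have hcd : κ₁ ≤ κ₀ + κ₁ := by linarith [h.pos₀]
  obtain ⟨h1, h2⟩ := h.profile_mem t ht x
  have h3 := h.one_le
  rw [val_regDens]
  refine gradSq_divGrad_le (abs_cst_mul_le ht h.pos₁.le hcd ?_) (fun i => ?_) fun i j => ?_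
  · rw [val_sub, val_one ht, abs_le]
    constructor <;> linarith
  · rw [dx_mul, dx_cst, zero_mul, zero_add, mul_assoc, map_sub, Derivation.map_one_eq_zero,
      sub_zero]
    exact abs_cst_mul_le ht h.pos₁.le hcd (h.dx_profile i t ht x)
  · rw [dx_mul, dx_cst, zero_mul, zero_add, dx_mul, dx_cst, zero_mul, zero_add, mul_assoc, map_sub,
      Derivation.map_one_eq_zero, sub_zero]
    exact abs_cst_mul_le ht h.pos₁.le hcd (h.dx_dx_profile i j t ht x)

theorem sum_mul_sq_le {κ : ℝ} {v y : Fin 3 → ℝ} (hv : ∀ i, |v i| ≤ κ) :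
    (∑ i, v i * y i) ^ 2 ≤ 3 * (κ ^ 2 * ∑ i, y i ^ 2) := by
  refine (sum_three_sq_le _).trans (mul_le_mul_of_nonneg_left ?_ (by norm_num))
  rw [Finset.mul_sum]
  exact Finset.sum_le_sum fun i _ => mul_sq_le (hv i)

theorem sum_remFlux_sq_le (h : Averaging T κ₀ κ₁ τ ν K u q A f w) (ht : t ∈ Ioo 0 T) (x : E3) :
    ∑ j, (remFlux u κ₁ τ q A f j).val t x ^ 2
      ≤ 268 * (τ * (κ₀ + κ₁) * K) ^ 2 * ((κ₀ + κ₁) ^ 2 * (regDens ν f).val t x) := by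
  have hκ := h.pos
  set κ := κ₀ + κ₁ with hκd
  have hA := fun z : ℝ => mul_sq_le (z := z) (h.abs_corr_le ht x)
  have key : ∀ j, (remFlux u κ₁ τ q A f j).val t x ^ 2 ≤ (τ * κ * K) ^ 2 * (4 *
      (κ ^ 2 * ν ^ 4 * (dx j f).val t x ^ 2 + (dx j (divGrad (cst κ) f)).val t x ^ 2
        + 6 * (κ ^ 2 * ν ^ 4 * (gradSq f).val t x))) := fun j => by
    rw [h.remFlux_eq j ht x, mul_pow, mul_pow (τ * κ), mul_assoc]
    have hc : (τ * κ₁) ^ 2 ≤ (τ * κ) ^ 2 := by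
      have h0 := h.posτ
      have h1 := h.pos₁
      have h2 : κ₁ ≤ κ := by linarith [h.pos₀]
      gcongr
    refine mul_le_mul hc ?_ (sq_nonneg _) (sq_nonneg _)
    refine (add_four_sq_le _ _ _ _).trans ?_
    rw [neg_sq, neg_sq]
    have e1 := mul_sq_le (z := (dx j f).val t x) (h.matD_corr t ht x)
    have e2 := hA ((dx j (divGrad (cst κ) f)).val t x)
    have e3 := (hA (∑ i, (dx j (u i)).val t x * (dx i f).val t x)).trans
      (mul_le_mul_of_nonneg_left (sum_mul_sq_le fun i => h.dx_vel j i t ht x) (sq_nonneg K))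
    have e4 := (hA (∑ i, (dx i (u j)).val t x * (dx i f).val t x)).trans
      (mul_le_mul_of_nonneg_left (sum_mul_sq_le fun i => h.dx_vel i j t ht x) (sq_nonneg K))
    rw [← val_gradSq] at e3 e4
    linarith
  refine (Finset.sum_le_sum fun j _ => key j).trans ?_
  have h1 : (gradSq (divGrad (cst κ) f)).val t x ≤ _ :=
    gradSq_divGrad_le (β := κ) (ν := ν) (by rw [val_algebraMap _ ht, abs_of_pos hκ])
      (fun i => by
        rw [dx_cst, val_zero, abs_zero]
        have := (abs_nonneg _).trans (h.dx_corr 0 t ht x)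
        have h1 := h.one_le
        exact mul_nonneg hκ.le (by nlinarith))
      (fun i j => by rw [dx_cst, map_zero, val_zero, abs_zero]; positivity)
  rw [← val_regDens, val_gradSq] at h1
  have h2 := gradSq_le_regDens ν f t x
  rw [← Finset.mul_sum, ← Finset.mul_sum, Finset.sum_add_distrib, Finset.sum_add_distrib,
    ← Finset.mul_sum, ← val_gradSq]
  simp only [Finset.sum_const, Finset.card_univ, Fintype.card_fin, nsmul_eq_mul]
  rw [show (268 : ℝ) * (τ * κ * K) ^ 2 * (κ ^ 2 * (regDens ν f).val t x)
    = (τ * κ * K) ^ 2 * (268 * (κ ^ 2 * (regDens ν f).val t x)) by ring]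
  refine mul_le_mul_of_nonneg_left ?_ (sq_nonneg _)
  have h3 := mul_le_mul_of_nonneg_left h2 (sq_nonneg κ)
  push_cast
  linarith

end Averaging

end SmoothPer

end TimeAveraging

namespace TimeAveraging

namespace SmoothPer.Averaging

variable {T κ₀ κ₁ τ ν K : ℝ} {u : Fin 3 → SmoothPer T} {q A f w : SmoothPer T}

/-! ### The energy inequality for the corrected difference -/

/-- The O(1) oscillating source cancels exactly; what is left is the divergence of a flux of order
τ. -/
theorem matD_sub_corr (h : Averaging T κ₀ κ₁ τ ν K u q A f w) :
    matD u (w - corr κ₁ τ A f) = divGrad (oscDiff κ₀ κ₁ q) (w - corr κ₁ τ A f)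
      + ∑ j, dx j (oscDiff κ₀ κ₁ q * dx j (corr κ₁ τ A f) - remFlux u κ₁ τ q A f j) := by
  rw [map_sub, h.eq_diff, matD_corr_eq h.divFree κ₁ τ q A f]
  simp only [divGrad, map_sub, mul_sub, Finset.sum_sub_distrib]
  ring

theorem energy_sub_corr (h : Averaging T κ₀ κ₁ τ ν K u q A f w) {t : ℝ} (ht : t ∈ Ioo 0 T) :
    (dt ((w - corr κ₁ τ A f) ^ 2)).integ t
      = (-(2 * ∑ j, dx j (w - corr κ₁ τ A f)
            * (oscDiff κ₀ κ₁ q * dx j (corr κ₁ τ A f) - remFlux u κ₁ τ q A f j))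
          - 2 * (oscDiff κ₀ κ₁ q * gradSq (w - corr κ₁ τ A f))).integ t := by
  rw [energy h.divFree h.matD_sub_corr ht]
  generalize w - corr κ₁ τ A f = θ
  generalize hF : (fun j => oscDiff κ₀ κ₁ q * dx j (corr κ₁ τ A f) - remFlux u κ₁ τ q A f j) = F
  simp only [funext_iff] at hF
  simp only [hF]
  refine integ_eq_of_eq_add_div (fun j => 2 * (θ * F j)) ?_ ht
  have h2 : ∀ i : Fin 3, dx i (2 : SmoothPer T) = 0 := fun i => Derivation.map_natCast _ 2
  simp only [dx_mul, h2, Fin.sum_univ_three]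
  ring

/-- The terms in the weighted gradient balance of `w` that are quadratic in `∇w`. -/
theorem weighted_gradient_le (h : Averaging T κ₀ κ₁ τ ν K u q A f w) {t : ℝ} (ht : t ∈ Ioo 0 T)
    (x : E3) :
    (matD u A * gradSq w - 2 * (A * oscDiff κ₀ κ₁ q * ∑ i, gradSq (dx i w))
          + divGrad (oscDiff κ₀ κ₁ q) A * gradSq w
          + divGrad A (oscDiff κ₀ κ₁ q) * gradSq w
          - 2 * ∑ i, ∑ j, dx j A * dx i (oscDiff κ₀ κ₁ q) * dx i w * dx j w
          - 2 * (A * ∑ i, ∑ j, dx i (u j) * dx j w * dx i w)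
          + 2 * (A * ∑ i, dx i w * dx i (oscSrc κ₁ q f))).val t x
      ≤ 1 / τ * (q.val t x - 1) * (gradSq w).val t x
        + 25 * (K ^ 2 * ((κ₀ + κ₁) * ν ^ 2)) * (gradSq w).val t x
        + 2 * (A.val t x * ∑ i, (dx i w).val t x * (dx i (oscSrc κ₁ q f)).val t x) := by
  have hκ := h.pos
  have hK := h.one_le
  have hKν : 0 ≤ K * ν := (abs_nonneg _).trans (h.dx_corr 0 t ht x)
  have hν : 0 ≤ ν := by nlinarith
  have hW := val_gradSq_nonneg w t x
  obtain ⟨hA0, hA1⟩ := h.corr_mem t ht x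
  have ha0 := h.pos₀.le.trans (h.oscDiff_mem ht x).1
  have b1 := mul_le_mul_of_nonneg_right (abs_le.1 (h.matD_corr t ht x)).2 hW
  have b2 := mul_le_mul_of_nonneg_right (abs_le.1 (abs_divGrad_le (by positivity) hν
    (h.abs_oscDiff_le ht x) (h.abs_dx_oscDiff_le ht x) (fun i => h.dx_corr i t ht x)
    fun i => h.dx_dx_corr i i t ht x)).2 hW
  have b3 := mul_le_mul_of_nonneg_right (abs_le.1 (abs_divGrad_le (by positivity) hν
    (h.abs_corr_le ht x) (fun i => h.dx_corr i t ht x) (h.abs_dx_oscDiff_le ht x)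
    fun i => h.abs_dx_dx_oscDiff_le ht x i i)).2 hW
  have b4 := (abs_le.1 (abs_sum_sum_mul_le (M := K * ν * (K * (κ₀ + κ₁) * ν))
    (m := fun i j => (dx j A).val t x * (dx i (oscDiff κ₀ κ₁ q)).val t x)
    (fun i j => by
      rw [abs_mul]
      exact mul_le_mul (h.dx_corr j t ht x) (h.abs_dx_oscDiff_le ht x i) (abs_nonneg _) hKν)
    (fun i => (dx i w).val t x) fun j => (dx j w).val t x)).1
  have b5 := (abs_le.1 (abs_sum_sum_mul_le (fun i j => h.dx_vel i j t ht x)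
    (fun i => (dx i w).val t x) fun j => (dx j w).val t x)).1
  -- The Hessian term is discarded by sign, which is where nonnegativity of the primitive enters.
  -- The other terms contribute K + 6K² + 6K² + 6K² + 6K ≤ 25K².
  have b6 : 0 ≤ A.val t x * (oscDiff κ₀ κ₁ q).val t x * ∑ i, (gradSq (dx i w)).val t x :=
    mul_nonneg (mul_nonneg hA0 ha0) (Finset.sum_nonneg fun i _ => val_gradSq_nonneg _ t x)
  have e4 : ∑ i, ∑ j, (dx j A).val t x * (dx i (oscDiff κ₀ κ₁ q)).val t x * (dx i w).val t x
        * (dx j w).val t x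
      = ∑ i, ∑ j, (dx j A).val t x * (dx i (oscDiff κ₀ κ₁ q)).val t x * (dx j w).val t x
        * (dx i w).val t x :=
    Finset.sum_congr rfl fun i _ => Finset.sum_congr rfl fun j _ => by ring
  simp only [val_add _ _ t x, val_sub, val_mul, val_sum, val_ofNat _ ht] at b1 b2 b3 b4 b5 b6 e4 ⊢
  rw [e4]
  rw [← val_gradSq] at b4 b5
  have b5' := mul_le_mul_of_nonneg_left b5 hA0
  have hX : 0 ≤ (κ₀ + κ₁) * ν ^ 2 * (gradSq w).val t x := by positivity
  have c1 := mul_le_mul_of_nonneg_right hA1 hX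
  have c2 := mul_le_mul_of_nonneg_right (by nlinarith : K ≤ K ^ 2) hX
  linarith

/-- The weight τκ₁/2 is chosen so that D_t A produces exactly ½(a-κ)|∇w|², the term needed by
`corrected_dissipation_le`. Of the resulting -(3/8)κ|∇w|², one eighth absorbs the quadratic errors,
one eighth the source of the gradient equation, and one eighth remains. -/
theorem deriv_corrected_energy_le (h : Averaging T κ₀ κ₁ τ ν K u q A f w)
    (hε : 100 * K ^ 2 * (τ * (κ₀ + κ₁) * ν ^ 2) ≤ 1) {t : ℝ} (ht : t ∈ Ioo 0 T) :
    (dt ((w - corr κ₁ τ A f) ^ 2 + (τ * κ₁ / 2) • (A * gradSq w))).integ t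
      ≤ ((3000 * K ^ 4 * (τ ^ 2 * (κ₀ + κ₁) ^ 3)) • regDens ν f
          - (1 / 8 : ℝ) • ((κ₀ + κ₁) • gradSq w)).integ t := by
  rw [map_add, Derivation.map_smul, integ_add _ _ ht, integ_smul, h.energy_sub_corr ht,
    gradient_energy h.divFree h.eq_diff A ht, ← integ_smul, ← integ_add _ _ ht]
  refine integ_mono ht fun x => ?_
  rw [val_add, val_smul (τ * κ₁ / 2)]
  have hκ := h.pos
  have hτ := h.posτ
  have hκ₁ := h.pos₁
  have hK := h.one_le
  have p2 := mul_le_mul_of_nonneg_left (h.weighted_gradient_le ht x)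
    (by positivity : 0 ≤ τ * κ₁ / 2)
  refine (add_le_add le_rfl p2).trans ?_
  obtain ⟨ha0, ha1⟩ := h.oscDiff_mem ht x
  have hW := val_gradSq_nonneg w t x
  have hR := val_regDens_nonneg ν f t x
  have p1 := corrected_dissipation_le (h.pos₀.le.trans ha0) hκ
    (fun i => (dx i (w - corr κ₁ τ A f)).val t x) (fun i => (dx i w).val t x)
    (fun i => (dx i (corr κ₁ τ A f)).val t x) (fun i => (remFlux u κ₁ τ q A f i).val t x)
    (fun i => by rw [map_sub, val_sub])
  have p3 := two_mul_sum_le (by positivity : 0 < (κ₀ + κ₁) / 4) (fun i => (dx i w).val t x)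
    fun i => τ * κ₁ * A.val t x * (dx i (oscSrc κ₁ q f)).val t x
  have hHs : ∑ i, (τ * κ₁ * A.val t x * (dx i (oscSrc κ₁ q f)).val t x) ^ 2
      ≤ (τ * (κ₀ + κ₁) * K) ^ 2 * (48 * ((κ₀ + κ₁) * K) ^ 2 * (regDens ν f).val t x) := by
    have h1 := h.gradSq_oscSrc_le ht x
    have h2 : |τ * κ₁ * A.val t x| ≤ τ * (κ₀ + κ₁) * K := by
      rw [abs_mul, abs_of_nonneg (by positivity : 0 ≤ τ * κ₁)]
      have h3 : κ₁ ≤ κ₀ + κ₁ := by linarith [h.pos₀]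
      have h4 := h.abs_corr_le ht x
      gcongr
    refine le_trans ?_ (mul_le_mul_of_nonneg_left h1 (sq_nonneg _))
    rw [val_gradSq, Finset.mul_sum]
    exact Finset.sum_le_sum fun i _ => mul_sq_le h2
  have hGs := h.sum_remFlux_sq_le ht x
  have hXi := h.gradSq_corr_le ht x
  have hXi0 := val_gradSq_nonneg (corr κ₁ τ A f) t x
  have hS : ∑ i, (dx i w).val t x * (τ * κ₁ * A.val t x * (dx i (oscSrc κ₁ q f)).val t x)
      = τ * κ₁ * (A.val t x * ∑ i, (dx i w).val t x * (dx i (oscSrc κ₁ q f)).val t x) := by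
    rw [Finset.mul_sum, Finset.mul_sum]
    exact Finset.sum_congr rfl fun i _ => by ring
  have haκ : (oscDiff κ₀ κ₁ q).val t x - (κ₀ + κ₁) = κ₁ * (q.val t x - 1) := by
    rw [val_add, val_mul, val_algebraMap _ ht, val_algebraMap _ ht]
    ring
  -- The exchange of dissipations: the factor 1/τ cancels the τ of the weight.
  have hq : τ * κ₁ / 2 * (1 / τ * (q.val t x - 1) * (gradSq w).val t x)
      = 1 / 2 * ((oscDiff κ₀ κ₁ q).val t x - (κ₀ + κ₁)) * (gradSq w).val t x := by
    rw [haκ]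
    field_simp
  -- The smallness threshold 100 comes from here: (25/2)/100 = 1/8.
  have hsmall : τ * κ₁ / 2 * (25 * (K ^ 2 * ((κ₀ + κ₁) * ν ^ 2)) * (gradSq w).val t x)
      ≤ 1 / 8 * ((κ₀ + κ₁) * (gradSq w).val t x) := by
    have h1 : κ₁ * (gradSq w).val t x ≤ (κ₀ + κ₁) * (gradSq w).val t x :=
      mul_le_mul_of_nonneg_right (by linarith [h.pos₀]) hW
    have h2 : 0 ≤ κ₁ * (gradSq w).val t x := by positivity
    have h3 := mul_le_mul_of_nonneg_right hε h2
    linarith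
  rw [← val_gradSq, ← val_gradSq, ← val_gradSq] at p1
  rw [hS, ← val_gradSq] at p3
  have g1 : (∑ i, (remFlux u κ₁ τ q A f i).val t x ^ 2) / (κ₀ + κ₁)
      ≤ 268 * K ^ 2 * (τ ^ 2 * (κ₀ + κ₁) ^ 3 * (regDens ν f).val t x) := by
    rw [div_le_iff₀ hκ]
    linarith
  have g2 : (∑ i, (τ * κ₁ * A.val t x * (dx i (oscSrc κ₁ q f)).val t x) ^ 2) / ((κ₀ + κ₁) / 4)
      ≤ 192 * K ^ 4 * (τ ^ 2 * (κ₀ + κ₁) ^ 3 * (regDens ν f).val t x) := by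
    rw [div_le_iff₀ (by positivity)]
    linarith
  have g3 : (2 * (oscDiff κ₀ κ₁ q).val t x + (κ₀ + κ₁)) * (gradSq (corr κ₁ τ A f)).val t x
      ≤ 144 * K ^ 3 * (τ ^ 2 * (κ₀ + κ₁) ^ 3 * (regDens ν f).val t x) := by
    have h1 : 2 * (oscDiff κ₀ κ₁ q).val t x + (κ₀ + κ₁) ≤ 3 * (K * (κ₀ + κ₁)) := by nlinarith
    have h2 := mul_le_mul h1 hXi hXi0 (by positivity)
    linarith
  -- The forcing constants add up to 9 · 268 + 192/2 + 144 = 2652, which is below 3000.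
  have hZ : 0 ≤ τ ^ 2 * (κ₀ + κ₁) ^ 3 * (regDens ν f).val t x := by positivity
  have k1 : K ^ 2 ≤ K ^ 4 := pow_le_pow_right₀ hK (by norm_num)
  have k2 : K ^ 3 ≤ K ^ 4 := pow_le_pow_right₀ hK (by norm_num)
  have m1 := mul_le_mul_of_nonneg_right k1 hZ
  have m2 := mul_le_mul_of_nonneg_right k2 hZ
  have m3 : 0 ≤ K ^ 4 * (τ ^ 2 * (κ₀ + κ₁) ^ 3 * (regDens ν f).val t x) := by positivity
  simp only [val_sub _ _ t x, val_neg, val_mul, val_sum, val_smul, val_ofNat _ ht] at p1 ⊢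
  linarith

end SmoothPer.Averaging

end TimeAveraging

/-! ### Estimates for the difference of the two solutions -/

namespace TimeAveraging

namespace SmoothPer

variable {T : ℝ}

/-- If `w` vanishes in `L²` as `t → 0` and the source stays bounded in `L²`, the parabolic energy
balance makes the gradient small along a sequence of times. -/
theorem frequently_gradSq_le (hT : 0 < T) {u : Fin 3 → SmoothPer T} (hu : ∑ j, dx j (u j) = 0)
    {w a H : SmoothPer T} (hw : matD u w = divGrad a w + H) {κ₀ : ℝ} (hκ₀ : 0 < κ₀)
    (ha : ∀ t ∈ Ioo 0 T, ∀ x, κ₀ ≤ a.val t x) {C : ℝ}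
    (hH : ∀ t ∈ Ioo 0 T, (H ^ 2).integ t ≤ C)
    (hlim : Tendsto (w ^ 2).integ (𝓝[>] 0) (𝓝 0)) {e : ℝ} (he : 0 < e) :
    ∃ᶠ t in 𝓝[>] (0 : ℝ), (gradSq w).integ t ≤ e := by
  intro hnot
  have hC : 0 ≤ C := (integ_nonneg (f := H ^ 2) fun x => by rw [val_sq]; positivity).trans
    (hH (T / 2) ⟨by positivity, by linarith⟩)
  -- Young's parameter: the source may consume at most half of κ₀e, and the other half bounds
  -- δ⁻¹‖w‖² once ‖w‖² is small.
  obtain ⟨δ, hδ, hδC⟩ : ∃ δ > 0, δ * C ≤ κ₀ * e / 2 :=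
    ⟨κ₀ * e / (2 * (C + 1)), by positivity, by
      rw [div_mul_eq_mul_div, div_le_div_iff₀ (by positivity) two_pos]
      nlinarith [mul_pos hκ₀ he]⟩
  have hev := (hnot.and (hlim.eventually_le_const
    (by positivity : 0 < δ * (κ₀ * e / 2)))).and (Ioo_mem_nhdsGT hT)
  obtain ⟨t₁, ht₁, hsub⟩ := mem_nhdsGT_iff_exists_Ioc_subset.1 hev
  have ht₁' : 0 < t₁ := ht₁
  have hd : ∀ t ∈ Ioc 0 t₁, (dt (w ^ 2)).integ t ≤ -(κ₀ * e) := by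
    intro t ht
    obtain ⟨⟨h1, h2⟩, h3⟩ := hsub ht
    have h1' : e < (gradSq w).integ t := not_le.1 h1
    rw [energy hu hw h3]
    have h4 : (2 * (w * H) - 2 * (a * gradSq w)).integ t
        ≤ (δ⁻¹ • w ^ 2 + δ • H ^ 2 - (2 * κ₀) • gradSq w).integ t := by
      refine integ_mono h3 fun x => ?_
      simp only [val_sub, val_add, val_mul, val_smul, val_sq, val_ofNat _ h3]
      have h5 := two_mul_mul_le hδ (H.val t x) (w.val t x)
      have h6 := mul_le_mul_of_nonneg_right (ha t h3 x) (val_gradSq_nonneg w t x)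
      rw [div_eq_inv_mul] at h5
      linarith
    rw [integ_sub (δ⁻¹ • w ^ 2 + δ • H ^ 2) _ h3, integ_add _ _ h3, integ_smul, integ_smul,
      integ_smul] at h4
    have h7 := mul_le_mul_of_nonneg_left (hH t h3) hδ.le
    have h8 : δ⁻¹ * (w ^ 2).integ t ≤ κ₀ * e / 2 := by
      rw [inv_mul_le_iff₀ hδ]
      exact h2
    have h9 := mul_lt_mul_of_pos_left h1' hκ₀
    linarith
  have ht₁T : t₁ < T := (hsub ⟨ht₁', le_rfl⟩).2.2
  -- If the gradient stayed above e, the energy would decrease at rate at least κ₀e up to t₁, hence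
  -- exceed κ₀e(t₁-t) at earlier times. This contradicts ‖w(t)‖ → 0.
  have hle : ∀ᶠ t in 𝓝[>] (0 : ℝ), κ₀ * e * (t₁ - t) ≤ (w ^ 2).integ t := by
    filter_upwards [Ioc_mem_nhdsGT ht₁'] with t ht
    have h := intervalIntegral.integral_mono_on (g := fun _ => -(κ₀ * e)) ht.2
      (intervalIntegrable_integ (dt (w ^ 2)) ht.1 ht.2 ht₁T) (by simp)
      fun s hs => hd s ⟨ht.1.trans_le hs.1, hs.2⟩
    have h2 := tinteg_dt (w ^ 2) ht.1 ht.2 ht₁T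
    rw [tinteg] at h2
    rw [h2, intervalIntegral.integral_const, smul_eq_mul] at h
    have h3 : 0 ≤ (w ^ 2).integ t₁ := integ_nonneg fun x => by rw [val_sq]; positivity
    linarith
  have hcont : Tendsto (fun t : ℝ => κ₀ * e * (t₁ - t)) (𝓝[>] 0) (𝓝 (κ₀ * e * (t₁ - 0))) :=
    (Continuous.tendsto (by fun_prop) 0).mono_left nhdsWithin_le_nhds
  have := le_of_tendsto_of_tendsto hcont hlim hle
  have h0 : 0 < κ₀ * e * (t₁ - 0) := by rw [sub_zero]; positivity
  linarith

theorem tbound_regDens {f : SmoothPer T} {κ ν L D : ℝ} (hL : 1 ≤ L) (hD0 : 0 ≤ D)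
    (h1 : TBound (κ • gradSq f) D) (h2 : TBound (κ • hessSq f) (L * (ν ^ 2 * D)))
    (h3 : TBound (κ • thirdSq f) (L * (ν ^ 4 * D))) :
    TBound (κ • regDens ν f) (3 * L * (ν ^ 4 * D)) := by
  have h := (h3.add (h2.smul (sq_nonneg ν))).add (h1.smul (by positivity : 0 ≤ ν ^ 4))
  have e : κ • regDens ν f
      = κ • thirdSq f + ν ^ 2 • (κ • hessSq f) + ν ^ 4 • (κ • gradSq f) := by
    rw [regDens, smul_add, smul_add, smul_comm κ, smul_comm κ]
  rw [e]
  have hν : 0 ≤ ν ^ 4 * D := by positivity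
  exact h.le (by nlinarith)

namespace Averaging

variable {κ₀ κ₁ τ ν K : ℝ} {u : Fin 3 → SmoothPer T} {q A f w : SmoothPer T} {L D : ℝ}

theorem integ_oscSrc_sq_le (h : Averaging T κ₀ κ₁ τ ν K u q A f w)
    (g1 : ∀ t ∈ Ioo 0 T, (gradSq f).integ t ≤ L * (ν ^ 2 * D))
    (g2 : ∀ t ∈ Ioo 0 T, (hessSq f).integ t ≤ L * (ν ^ 4 * D)) {t : ℝ} (ht : t ∈ Ioo 0 T) :
    ((oscSrc κ₁ q f) ^ 2).integ t ≤ 12 * ((κ₀ + κ₁) * K) ^ 2 * (L * (ν ^ 4 * D)) := by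
  have hcd : κ₁ ≤ κ₀ + κ₁ := by linarith [h.pos₀]
  have h1 : ((oscSrc κ₁ q f) ^ 2).integ t
      ≤ ((6 * ((κ₀ + κ₁) * K) ^ 2) • (ν ^ 2 • gradSq f + hessSq f)).integ t := by
    refine integ_mono ht fun x => ?_
    rw [val_sq, val_smul, val_add, val_smul]
    obtain ⟨h1, h2⟩ := h.profile_mem t ht x
    have h3 := h.one_le
    refine divGrad_sq_le (abs_cst_mul_le ht h.pos₁.le hcd ?_) fun i => ?_
    · rw [val_sub, val_one ht, abs_le]
      constructor <;> linarith
    · rw [dx_mul, dx_cst, zero_mul, zero_add, mul_assoc, map_sub, Derivation.map_one_eq_zero,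
        sub_zero]
      exact abs_cst_mul_le ht h.pos₁.le hcd (h.dx_profile i t ht x)
  rw [integ_smul, integ_add _ _ ht, integ_smul] at h1
  refine h1.trans ?_
  have h2 := mul_le_mul_of_nonneg_left (g1 t ht) (sq_nonneg ν)
  have h3 := g2 t ht
  have h4 : ν ^ 2 * (gradSq f).integ t + (hessSq f).integ t ≤ 2 * (L * (ν ^ 4 * D)) := by linarith
  have h5 := mul_le_mul_of_nonneg_left h4 (by positivity : 0 ≤ 6 * ((κ₀ + κ₁) * K) ^ 2)
  linarith

theorem integ_corr_sq_le (h : Averaging T κ₀ κ₁ τ ν K u q A f w)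
    (g1 : ∀ t ∈ Ioo 0 T, (gradSq f).integ t ≤ L * (ν ^ 2 * D))
    (g2 : ∀ t ∈ Ioo 0 T, (hessSq f).integ t ≤ L * (ν ^ 4 * D)) {t : ℝ} (ht : t ∈ Ioo 0 T) :
    ((corr κ₁ τ A f) ^ 2).integ t ≤ 12 * K ^ 2 * L * ((τ * (κ₀ + κ₁) * ν ^ 2) ^ 2 * D) := by
  have h1 : ((corr κ₁ τ A f) ^ 2).integ t
      ≤ ((6 * (τ * (κ₀ + κ₁) * K) ^ 2) • (ν ^ 2 • gradSq f + hessSq f)).integ t := by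
    refine integ_mono ht fun x => ?_
    rw [val_sq, val_smul, val_add, val_smul]
    exact h.corr_sq_le ht x
  rw [integ_smul, integ_add _ _ ht, integ_smul] at h1
  refine h1.trans ?_
  have h2 := mul_le_mul_of_nonneg_left (g1 t ht) (sq_nonneg ν)
  have h3 := g2 t ht
  have h4 : ν ^ 2 * (gradSq f).integ t + (hessSq f).integ t ≤ 2 * (L * (ν ^ 4 * D)) := by linarith
  have h5 := mul_le_mul_of_nonneg_left h4 (by positivity : 0 ≤ 6 * (τ * (κ₀ + κ₁) * K) ^ 2)
  linarith

/-- The averaging estimate when the fast time scale is short enough. -/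
theorem diff_bounds (h : Averaging T κ₀ κ₁ τ ν K u q A f w) (hT : 0 < T)
    (hε : 100 * K ^ 2 * (τ * (κ₀ + κ₁) * ν ^ 2) ≤ 1) (hL : 1 ≤ L) (hD0 : 0 ≤ D)
    (hlim : Tendsto (w ^ 2).integ (𝓝[>] 0) (𝓝 0))
    (g1 : ∀ t ∈ Ioo 0 T, (gradSq f).integ t ≤ L * (ν ^ 2 * D))
    (g2 : ∀ t ∈ Ioo 0 T, (hessSq f).integ t ≤ L * (ν ^ 4 * D))
    (G1 : TBound ((κ₀ + κ₁) • gradSq f) D)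
    (G2 : TBound ((κ₀ + κ₁) • hessSq f) (L * (ν ^ 2 * D)))
    (G3 : TBound ((κ₀ + κ₁) • thirdSq f) (L * (ν ^ 4 * D))) :
    (∀ t ∈ Ioo 0 T, (w ^ 2).integ t
        ≤ 80000 * K ^ 4 * L * ((τ * (κ₀ + κ₁) * ν ^ 2) ^ 2 * D)) ∧
      TBound ((κ₀ + κ₁) • gradSq w)
        (80000 * K ^ 4 * L * ((τ * (κ₀ + κ₁) * ν ^ 2) ^ 2 * D)) := by
  have hκ := h.pos
  have hτ := h.posτ
  have hκ₁ := h.pos₁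
  have hK := h.one_le
  set θ := w - corr κ₁ τ A f with hθ
  set Z := (τ * (κ₀ + κ₁) * ν ^ 2) ^ 2 * D with hZ
  have hZ0 : 0 ≤ Z := by positivity
  have hA : ∀ t x, 0 ≤ ((τ * κ₁ / 2) • (A * gradSq w)).val t x :=
    val_nonneg_of_Ioo fun t ht x => by
      rw [val_smul, val_mul]
      have h1 := (h.corr_mem t ht x).1
      have h2 := val_gradSq_nonneg w t x
      positivity
  have hR := (tbound_regDens hL hD0 G1 G2 G3).smul
    (by positivity : 0 ≤ 3000 * K ^ 4 * (τ ^ 2 * (κ₀ + κ₁) ^ 2))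
  rw [smul_smul, show 3000 * K ^ 4 * (τ ^ 2 * (κ₀ + κ₁) ^ 2) * (κ₀ + κ₁)
    = 3000 * K ^ 4 * (τ ^ 2 * (κ₀ + κ₁) ^ 3) by ring,
    show 3000 * K ^ 4 * (τ ^ 2 * (κ₀ + κ₁) ^ 2) * (3 * L * (ν ^ 4 * D))
      = 9000 * K ^ 4 * L * Z by rw [hZ]; ring] at hR
  have hχ := fun {t : ℝ} (ht : t ∈ Ioo 0 T) => h.integ_corr_sq_le g1 g2 ht
  rw [← hZ] at hχ
  have hw : ∀ t ∈ Ioo 0 T, (θ ^ 2).integ t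
      ≤ 2 * (w ^ 2).integ t + 2 * ((corr κ₁ τ A f) ^ 2).integ t := fun t ht => by
    rw [← integ_smul, ← integ_smul, ← integ_add _ _ ht]
    refine integ_mono ht fun x => ?_
    simp only [hθ, val_sq, val_sub, val_add, val_smul]
    nlinarith [sq_nonneg (w.val t x + (corr κ₁ τ A f).val t x)]
  have hw' : ∀ t ∈ Ioo 0 T, (w ^ 2).integ t
      ≤ 2 * (θ ^ 2).integ t + 2 * ((corr κ₁ τ A f) ^ 2).integ t := fun t ht => by
    rw [← integ_smul, ← integ_smul, ← integ_add _ _ ht]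
    refine integ_mono ht fun x => ?_
    simp only [hθ, val_sq, val_sub, val_add, val_smul]
    nlinarith [sq_nonneg (w.val t x - 2 * (corr κ₁ τ A f).val t x)]
  -- Near time 0 only the corrector contributes: ‖θ‖² ≤ 2‖w‖² + 2‖χ‖² with ‖w‖ → 0 gives S with 24 =
  -- 2 · 12, and the weighted gradient is negligible along a sequence of times. X is the integrated
  -- forcing, 9000 = 3000 · 3. Undoing the factor 1/8 gives 8 · 9024, below 80000.
  have key := bounds_of_energy_ineq
    (g := θ ^ 2 + (τ * κ₁ / 2) • (A * gradSq w))
    (h := (1 / 8 : ℝ) • ((κ₀ + κ₁) • gradSq w)) (S := 24 * K ^ 2 * L * Z)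
    (X := 9000 * K ^ 4 * L * Z)
    (fun t x => by rw [val_add, val_sq]; exact add_nonneg (sq_nonneg _) (hA t x))
    (fun t x => by
      rw [val_smul, val_smul]
      have := val_gradSq_nonneg w t x
      positivity)
    (fun t₀ t₁ h₀ h₁ h₂ => integ_add_tinteg_le
      (fun t ht => h.deriv_corrected_energy_le hε ht) hR h₀ h₁ h₂)
    (fun e he => by
      have hfreq := frequently_gradSq_le hT h.divFree h.eq_diff h.pos₀
        (fun t ht x => (h.oscDiff_mem ht x).1) (fun t ht => h.integ_oscSrc_sq_le g1 g2 ht) hlim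
        (by positivity : 0 < e / (τ * κ₁ * K))
      refine (hfreq.and_eventually ((hlim.eventually_le_const (by positivity : 0 < e / 4)).and
        (Ioo_mem_nhdsGT hT))).mono ?_
      rintro t ⟨e1, e2, ht⟩
      have e3 : (A * gradSq w).integ t ≤ K * (gradSq w).integ t := by
        rw [← integ_smul]
        refine integ_mono ht fun x => ?_
        rw [val_mul, val_smul]
        exact mul_le_mul_of_nonneg_right (h.corr_mem t ht x).2 (val_gradSq_nonneg w t x)
      have e4 := mul_le_mul_of_nonneg_left e3 (by positivity : 0 ≤ τ * κ₁ / 2)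
      rw [le_div_iff₀ (by positivity)] at e1
      rw [integ_add _ _ ht, integ_smul]
      have e5 := hw t ht
      have e6 := hχ ht
      linarith)
  have hS : 24 * K ^ 2 * L * Z + 9000 * K ^ 4 * L * Z ≤ 9024 * K ^ 4 * L * Z := by
    have h1 := mul_le_mul_of_nonneg_right (pow_le_pow_right₀ hK (by norm_num : 2 ≤ 4))
      (by positivity : 0 ≤ L * Z)
    linarith
  have hKL : 0 ≤ K ^ 4 * L * Z := by positivity
  constructor
  · intro t ht
    have e1 := key.1 t ht
    rw [integ_add _ _ ht] at e1
    have e2 := integ_nonneg (hA t)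
    have e3 := hw' t ht
    have e4 := hχ ht
    linarith
  · have e1 := key.2.smul (by norm_num : (0 : ℝ) ≤ 8)
    rw [smul_smul, show (8 : ℝ) * (1 / 8) = 1 by norm_num, one_smul] at e1
    exact e1.le (by linarith)

/-- The energy estimate for the difference without averaging. -/
theorem diff_bounds_crude (h : Averaging T κ₀ κ₁ τ ν K u q A f w)
    (hlim : Tendsto (w ^ 2).integ (𝓝[>] 0) (𝓝 0)) (G1 : TBound ((κ₀ + κ₁) • gradSq f) D) :
    (∀ t ∈ Ioo 0 T, (w ^ 2).integ t ≤ K ^ 2 * (κ₀ + κ₁) / κ₀ * D) ∧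
      TBound (κ₀ • gradSq w) (K ^ 2 * (κ₀ + κ₁) / κ₀ * D) := by
  have hκ := h.pos
  have hκ₀ := h.pos₀
  have key := bounds_of_energy_ineq (g := w ^ 2) (h := κ₀ • gradSq w) (S := 0)
    (X := K ^ 2 * (κ₀ + κ₁) / κ₀ * D)
    (fun t x => by rw [val_sq]; exact sq_nonneg _)
    (fun t x => by
      rw [val_smul]
      have := val_gradSq_nonneg w t x
      positivity)
    (fun t₀ t₁ h₀ h₁ h₂ => integ_add_tinteg_le (fun t ht => ?_)
      (G1.smul (by positivity : 0 ≤ K ^ 2 * (κ₀ + κ₁) / κ₀)) h₀ h₁ h₂)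
    (fun e he => (hlim.eventually_le_const (by linarith)).frequently)
  · simpa using key
  · rw [energy h.divFree h.eq_diff ht]
    -- Keeping the source in divergence form lets half of the dissipation κ₀|∇w|² absorb ∇w. No
    -- regularity of f beyond its dissipation is used, at the price of the ratio κ/κ₀.
    have e1 : (2 * (w * oscSrc κ₁ q f) - 2 * (oscDiff κ₀ κ₁ q * gradSq w)).integ t
        = (-(2 * ∑ j, dx j w * (cst κ₁ * (q - 1) * dx j f))
            - 2 * (oscDiff κ₀ κ₁ q * gradSq w)).integ t := by
      refine integ_eq_of_eq_add_div (fun j => 2 * (w * (cst κ₁ * (q - 1) * dx j f))) ?_ ht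
      have h2 : ∀ i : Fin 3, dx i (2 : SmoothPer T) = 0 := fun i => Derivation.map_natCast _ 2
      generalize hF : (fun j => cst κ₁ * (q - 1) * dx j f) = F
      simp only [funext_iff] at hF
      simp only [oscSrc, divGrad, hF, dx_mul, h2, Fin.sum_univ_three]
      ring
    rw [e1]
    refine integ_mono ht fun x => ?_
    obtain ⟨ha0, -⟩ := h.oscDiff_mem ht x
    obtain ⟨hq0, hq1⟩ := h.profile_mem t ht x
    have hK := h.one_le
    have e2 := two_mul_sum_le hκ₀ (fun j => (dx j w).val t x)
      fun j => -(κ₁ * (q.val t x - 1) * (dx j f).val t x)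
    have e3 : |κ₁ * (q.val t x - 1)| ≤ (κ₀ + κ₁) * K := by
      rw [abs_mul, abs_of_pos h.pos₁]
      have e4 : |q.val t x - 1| ≤ K := by
        rw [abs_le]
        constructor <;> linarith
      exact mul_le_mul (by linarith) e4 (abs_nonneg _) hκ.le
    have e5 : ∑ j, (-(κ₁ * (q.val t x - 1) * (dx j f).val t x)) ^ 2
        ≤ ((κ₀ + κ₁) * K) ^ 2 * (gradSq f).val t x := by
      rw [val_gradSq, Finset.mul_sum]
      refine Finset.sum_le_sum fun j _ => ?_
      rw [neg_sq]
      exact mul_sq_le e3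
    have e6 := div_le_div_of_nonneg_right e5 hκ₀.le
    rw [← val_gradSq] at e2
    simp only [mul_neg, Finset.sum_neg_distrib] at e2
    have e7 := mul_le_mul_of_nonneg_right ha0 (val_gradSq_nonneg w t x)
    have e8 : ((κ₀ + κ₁) * K) ^ 2 * (gradSq f).val t x / κ₀
        = K ^ 2 * (κ₀ + κ₁) / κ₀ * ((κ₀ + κ₁) * (gradSq f).val t x) := by ring
    simp only [val_sub _ _ t x, val_neg, val_mul, val_sum, val_smul, val_ofNat _ ht,
      val_one ht, val_algebraMap κ₁ ht] at e2 e7 ⊢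
    simp only [neg_sq] at e2 e6
    linarith

end Averaging

end SmoothPer

end TimeAveraging

namespace TimeAveraging

namespace SmoothPer

variable {T : ℝ}

namespace Averaging

variable {κ₀ κ₁ τ ν K : ℝ} {u : Fin 3 → SmoothPer T} {q A f w : SmoothPer T} {L D C₀ : ℝ}

/-! ### Comparison of the dissipations -/

/-- `gradient_energy` with constant diffusivity: its spatial derivatives vanish, and so do the
corresponding commutators. -/
theorem integ_dt_corr_gradSq (h : Averaging T κ₀ κ₁ τ ν K u q A f w) {t : ℝ} (ht : t ∈ Ioo 0 T) :
    (dt (A * gradSq f)).integ t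
      = (matD u A * gradSq f - 2 * (A * ((κ₀ + κ₁) • hessSq f))
          + divGrad (cst (κ₀ + κ₁)) A * gradSq f
          - 2 * (A * ∑ i, ∑ j, dx i (u j) * dx j f * dx i f)).integ t := by
  rw [gradient_energy (H := 0) h.divFree (by rw [h.eq_avg, add_zero]) A ht]
  congr 1
  simp only [divGrad, dx_cst, map_zero, mul_zero, zero_mul, Finset.sum_const_zero, hessSq,
    Algebra.smul_def]
  ring

/-- Subtracting τκ₁ times the balance of A|∇f|² removes κ₁(q-1)|∇f|². The remainder is a|∇w|², the
cross term split by Young with parameter δ, and terms with factor τκ₁; 16 exceeds their count 1 + 6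
+ 6. -/
theorem abs_dissipation_sub_le (h : Averaging T κ₀ κ₁ τ ν K u q A f w) {δ : ℝ} (hδ : 0 < δ)
    {t : ℝ} (ht : t ∈ Ioo 0 T) (x : E3) :
    |(oscDiff κ₀ κ₁ q * gradSq (f + w) - (κ₀ + κ₁) • gradSq f
        - (τ * κ₁) • (matD u A * gradSq f - 2 * (A * ((κ₀ + κ₁) • hessSq f))
          + divGrad (cst (κ₀ + κ₁)) A * gradSq f
          - 2 * (A * ∑ i, ∑ j, dx i (u j) * dx j f * dx i f))).val t x|
      ≤ ((K * (1 + 1 / δ)) • ((κ₀ + κ₁) • gradSq w)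
        + (K * δ + 16 * (K * (τ * (κ₀ + κ₁) * ν ^ 2))) • ((κ₀ + κ₁) • gradSq f)
        + (2 * (K * (τ * (κ₀ + κ₁)))) • ((κ₀ + κ₁) • hessSq f)).val t x := by
  have hκ := h.pos
  have hκ₁ := h.pos₁
  have hτ := h.posτ
  have hK := h.one_le
  have hKν : 0 ≤ K * ν := (abs_nonneg _).trans (h.dx_corr 0 t ht x)
  have hν : 0 ≤ ν := by nlinarith
  obtain ⟨ha0, ha1⟩ := h.oscDiff_mem ht x
  have ha : 0 ≤ (oscDiff κ₀ κ₁ q).val t x := h.pos₀.le.trans ha0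
  obtain ⟨hA0, hA1⟩ := h.corr_mem t ht x
  have hF := val_gradSq_nonneg f t x
  have hW := val_gradSq_nonneg w t x
  have hH := val_hessSq_nonneg f t x
  have hcd : τ * κ₁ ≤ τ * (κ₀ + κ₁) := mul_le_mul_of_nonneg_left (by linarith [h.pos₀]) hτ.le
  have hexp : (gradSq (f + w)).val t x = (gradSq f).val t x + (gradSq w).val t x
      + 2 * ∑ i, (dx i f).val t x * (dx i w).val t x := by
    simp only [val_gradSq, map_add, val_add, Fin.sum_univ_three]
    ring
  have c1 := two_mul_sum_le hδ (fun i => (dx i f).val t x) fun i => (dx i w).val t x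
  have c2 := two_mul_sum_le hδ (fun i => (dx i f).val t x) fun i => -(dx i w).val t x
  simp only [mul_neg, Finset.sum_neg_distrib, neg_sq] at c2
  rw [← val_gradSq, ← val_gradSq] at c1 c2
  have hcross : |2 * ((oscDiff κ₀ κ₁ q).val t x * ∑ i, (dx i f).val t x * (dx i w).val t x)|
      ≤ K * (κ₀ + κ₁) * (δ * (gradSq f).val t x + (gradSq w).val t x / δ) := by
    have h0 : 0 ≤ δ * (gradSq f).val t x + (gradSq w).val t x / δ := by positivity
    rw [show 2 * ((oscDiff κ₀ κ₁ q).val t x * ∑ i, (dx i f).val t x * (dx i w).val t x)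
      = (oscDiff κ₀ κ₁ q).val t x * (2 * ∑ i, (dx i f).val t x * (dx i w).val t x) by ring,
      abs_mul, abs_of_nonneg ha]
    refine mul_le_mul ha1 ?_ (abs_nonneg _) (by positivity)
    rw [abs_le]
    constructor <;> linarith
  have hw1 := mul_le_mul_of_nonneg_right ha1 hW
  have hw0 := mul_nonneg ha hW
  have b1 := h.matD_corr t ht x
  have b2 : |(divGrad (cst (κ₀ + κ₁)) A).val t x| ≤ _ :=
    abs_divGrad_le (β := κ₀ + κ₁) (γ := K) hκ.le hν
      (by rw [val_algebraMap _ ht, abs_of_pos hκ])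
      (fun i => by rw [dx_cst, val_zero, abs_zero]; positivity) (fun i => h.dx_corr i t ht x)
      fun i => h.dx_dx_corr i i t ht x
  have b3 := abs_sum_sum_mul_le (fun i j => h.dx_vel i j t ht x)
    (fun i => (dx i f).val t x) fun j => (dx j f).val t x
  rw [← val_gradSq] at b3
  have b3' : |A.val t x * ∑ i, ∑ j, (dx i (u j)).val t x * (dx j f).val t x * (dx i f).val t x|
      ≤ K * (3 / 2 * ((κ₀ + κ₁) * ν ^ 2) * ((gradSq f).val t x + (gradSq f).val t x)) := by
    rw [abs_mul, abs_of_nonneg hA0]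
    exact mul_le_mul hA1 b3 (abs_nonneg _) (by positivity)
  have b4 := mul_le_mul_of_nonneg_right hA1 (by positivity : 0 ≤ (κ₀ + κ₁) * (hessSq f).val t x)
  have b4' := mul_nonneg hA0 (by positivity : 0 ≤ (κ₀ + κ₁) * (hessSq f).val t x)
  have d1 : |((matD u A).val t x - 1 / τ * (q.val t x - 1)) * (gradSq f).val t x|
      ≤ K * ((κ₀ + κ₁) * ν ^ 2) * (gradSq f).val t x := by
    rw [abs_mul, abs_of_nonneg hF]
    exact mul_le_mul_of_nonneg_right b1 hF
  have d2 : |(divGrad (cst (κ₀ + κ₁)) A).val t x * (gradSq f).val t x|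
      ≤ 6 * ((κ₀ + κ₁) * K * ν ^ 2) * (gradSq f).val t x := by
    rw [abs_mul, abs_of_nonneg hF]
    exact mul_le_mul_of_nonneg_right b2 hF
  set R : ℝ := ((matD u A).val t x - 1 / τ * (q.val t x - 1)) * (gradSq f).val t x
    - 2 * (A.val t x * ((κ₀ + κ₁) * (hessSq f).val t x))
    + (divGrad (cst (κ₀ + κ₁)) A).val t x * (gradSq f).val t x
    - 2 * (A.val t x * ∑ i, ∑ j, (dx i (u j)).val t x * (dx j f).val t x * (dx i f).val t x)
    with hR
  have hRle : |R| ≤ 16 * (K * ((κ₀ + κ₁) * ν ^ 2)) * (gradSq f).val t x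
      + 2 * (K * ((κ₀ + κ₁) * (hessSq f).val t x)) := by
    have hX : 0 ≤ K * ((κ₀ + κ₁) * ν ^ 2) * (gradSq f).val t x := by positivity
    rw [abs_le] at d1 d2 b3' ⊢
    constructor <;> linarith [d1.1, d1.2, d2.1, d2.2, b3'.1, b3'.2]
  have hcR : |τ * κ₁ * R| ≤ τ * (κ₀ + κ₁) * (16 * (K * ((κ₀ + κ₁) * ν ^ 2)) * (gradSq f).val t x
      + 2 * (K * ((κ₀ + κ₁) * (hessSq f).val t x))) := by
    rw [abs_mul, abs_of_nonneg (by positivity : 0 ≤ τ * κ₁)]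
    exact mul_le_mul hcd hRle (abs_nonneg _) (by positivity)
  have hid : (oscDiff κ₀ κ₁ q * gradSq (f + w) - (κ₀ + κ₁) • gradSq f
        - (τ * κ₁) • (matD u A * gradSq f - 2 * (A * ((κ₀ + κ₁) • hessSq f))
          + divGrad (cst (κ₀ + κ₁)) A * gradSq f
          - 2 * (A * ∑ i, ∑ j, dx i (u j) * dx j f * dx i f))).val t x
      = (oscDiff κ₀ κ₁ q).val t x * (gradSq w).val t x
        + 2 * ((oscDiff κ₀ κ₁ q).val t x * ∑ i, (dx i f).val t x * (dx i w).val t x)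
        - τ * κ₁ * R := by
    have haκ : (oscDiff κ₀ κ₁ q).val t x = κ₀ + κ₁ + κ₁ * (q.val t x - 1) := by
      rw [val_add, val_mul, val_algebraMap _ ht, val_algebraMap _ ht]
      ring
    simp only [val_sub _ _ t x, val_mul _ _ t x, val_smul, hexp, val_add (_ - _) _ t x, val_sum,
      val_ofNat _ ht]
    rw [hR, haκ]
    have hτ' := hτ.ne'
    field_simp
    ring
  rw [hid]
  rw [val_add (_ + _) _ t x, val_add (_ • _) (_ • _) t x]
  simp only [val_smul]
  have hdiv : (gradSq w).val t x / δ = 1 / δ * (gradSq w).val t x := by ring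
  rw [hdiv] at hcross
  rw [abs_le] at hcross hcR ⊢
  constructor <;> linarith [hcross.1, hcross.2, hcR.1, hcR.2]

/-- The subtracted balance integrates to the boundary values of τκ₁∫A|∇f|², each at most KLεD. The
condition δ > ε, rather than δ = ε, keeps δ positive when ε = 0. -/
theorem abs_tinteg_dissipation_sub_le (h : Averaging T κ₀ κ₁ τ ν K u q A f w) (hL : 1 ≤ L)
    (hD0 : 0 ≤ D) (hC₀ : 0 ≤ C₀)
    (g1 : ∀ t ∈ Ioo 0 T, (gradSq f).integ t ≤ L * (ν ^ 2 * D))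
    (G1 : TBound ((κ₀ + κ₁) • gradSq f) D)
    (G2 : TBound ((κ₀ + κ₁) • hessSq f) (L * (ν ^ 2 * D)))
    (GW : TBound ((κ₀ + κ₁) • gradSq w) (C₀ * ((τ * (κ₀ + κ₁) * ν ^ 2) ^ 2 * D))) {δ : ℝ}
    (hδ : τ * (κ₀ + κ₁) * ν ^ 2 < δ) (hδ1 : δ ≤ 1) {t₀ t₁ : ℝ} (h₀ : 0 < t₀) (h₁ : t₀ ≤ t₁)
    (h₂ : t₁ < T) :
    |(oscDiff κ₀ κ₁ q * gradSq (f + w)).tinteg t₀ t₁ - ((κ₀ + κ₁) • gradSq f).tinteg t₀ t₁|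
      ≤ K * (20 * L + 2 * C₀) * (δ * D) := by
  have hκ := h.pos
  have hκ₁ := h.pos₁
  have hτ := h.posτ
  have hK := h.one_le
  set ε := τ * (κ₀ + κ₁) * ν ^ 2 with hεd
  have hε0 : 0 ≤ ε := by positivity
  have hδ0 : 0 < δ := hε0.trans_lt hδ
  have hcd : τ * κ₁ ≤ τ * (κ₀ + κ₁) := mul_le_mul_of_nonneg_left (by linarith [h.pos₀]) hτ.le
  set Q := oscDiff κ₀ κ₁ q * gradSq (f + w) - (κ₀ + κ₁) • gradSq f with hQ
  set Z := matD u A * gradSq f - 2 * (A * ((κ₀ + κ₁) • hessSq f))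
          + divGrad (cst (κ₀ + κ₁)) A * gradSq f
          - 2 * (A * ∑ i, ∑ j, dx i (u j) * dx j f * dx i f) with hZ
  set P := (K * (1 + 1 / δ)) • ((κ₀ + κ₁) • gradSq w)
        + (K * δ + 16 * (K * ε)) • ((κ₀ + κ₁) • gradSq f)
        + (2 * (K * (τ * (κ₀ + κ₁)))) • ((κ₀ + κ₁) • hessSq f) with hP
  have hpt : ∀ t ∈ Ioo 0 T, ∀ x, |(Q - (τ * κ₁) • Z).val t x| ≤ P.val t x :=
    fun t ht x => h.abs_dissipation_sub_le hδ0 ht x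
  have hPB : TBound P _ := ((GW.smul (by positivity : 0 ≤ K * (1 + 1 / δ))).add
    (G1.smul (by positivity : 0 ≤ K * δ + 16 * (K * ε)))).add
    (G2.smul (by positivity : 0 ≤ 2 * (K * (τ * (κ₀ + κ₁)))))
  have hP1 := hPB h₀ h₁ h₂
  have hup := tinteg_mono h₀ h₁ h₂ fun t ht x => (abs_le.1 (hpt t ht x)).2
  have hlo := tinteg_mono (f := (-1 : ℝ) • P) (g := Q - (τ * κ₁) • Z) h₀ h₁ h₂ fun t ht x => by
    rw [val_smul]
    linarith [(abs_le.1 (hpt t ht x)).1]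
  have hZt : Z.tinteg t₀ t₁ = (A * gradSq f).integ t₁ - (A * gradSq f).integ t₀ := by
    rw [← tinteg_dt _ h₀ h₁ h₂]
    exact tinteg_congr h₀ h₁ h₂ fun t ht => (h.integ_dt_corr_gradSq ht).symm
  rw [tinteg_smul] at hlo
  rw [tinteg_sub _ _ h₀ h₁ h₂, tinteg_smul (τ * κ₁), hZt, hQ, tinteg_sub _ _ h₀ h₁ h₂] at hup hlo
  have hE : ∀ t ∈ Ioo 0 T, 0 ≤ (A * gradSq f).integ t ∧
      (A * gradSq f).integ t ≤ K * (L * (ν ^ 2 * D)) := fun t ht => by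
    have e1 : (A * gradSq f).integ t ≤ (K • gradSq f).integ t := integ_mono ht fun x => by
      rw [val_mul, val_smul]
      exact mul_le_mul_of_nonneg_right (h.corr_mem t ht x).2 (val_gradSq_nonneg f t x)
    rw [integ_smul] at e1
    refine ⟨integ_nonneg fun x => ?_, e1.trans (mul_le_mul_of_nonneg_left (g1 t ht) (by positivity))⟩
    rw [val_mul]
    exact mul_nonneg (h.corr_mem t ht x).1 (val_gradSq_nonneg f t x)
  obtain ⟨e1, e2⟩ := hE t₁ (mem_Ioo_of_le h₀ h₂ ⟨h₁, le_rfl⟩)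
  obtain ⟨e3, e4⟩ := hE t₀ (mem_Ioo_of_le h₀ h₂ ⟨le_rfl, h₁⟩)
  have hbd : |τ * κ₁ * ((A * gradSq f).integ t₁ - (A * gradSq f).integ t₀)|
      ≤ K * L * (ε * D) := by
    rw [abs_mul, abs_of_nonneg (by positivity : 0 ≤ τ * κ₁)]
    have e5 : |(A * gradSq f).integ t₁ - (A * gradSq f).integ t₀| ≤ K * (L * (ν ^ 2 * D)) := by
      rw [abs_le]
      constructor <;> linarith
    have e6 := mul_le_mul hcd e5 (abs_nonneg _) (by positivity)
    linarith
  have hq : 1 / δ * ε ^ 2 ≤ δ := by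
    rw [one_div, inv_mul_le_iff₀ hδ0]
    nlinarith
  have hq2 : ε ^ 2 ≤ δ := by nlinarith
  have hKD : 0 ≤ K * D := by positivity
  -- Contributions: 2C₀ from ∇w since ε²/δ and ε² are at most δ, 17 from the gradient terms, 2L from
  -- the Hessian and L from the boundary, so 20L in total as L ≥ 1.
  have hsum : P.tinteg t₀ t₁ + K * L * (ε * D) ≤ K * (20 * L + 2 * C₀) * (δ * D) := by
    have k1 := mul_le_mul_of_nonneg_right hq (by positivity : 0 ≤ C₀ * (K * D))
    have k2 := mul_le_mul_of_nonneg_right hq2 (by positivity : 0 ≤ C₀ * (K * D))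
    have k3 := mul_le_mul_of_nonneg_right hδ.le hKD
    have k4 := mul_le_mul_of_nonneg_right hδ.le (by positivity : 0 ≤ L * (K * D))
    have k5 := mul_le_mul_of_nonneg_right hL (by positivity : 0 ≤ δ * (K * D))
    have k6 : 2 * (K * (τ * (κ₀ + κ₁))) * (L * (ν ^ 2 * D)) = 2 * (ε * (L * (K * D))) := by
      rw [hεd]; ring
    linarith
  rw [abs_le] at hbd ⊢
  constructor <;> linarith [hbd.1, hbd.2]

end Averaging

end SmoothPer

end TimeAveraging

namespace TimeAveraging

/-! ### Dissipations as space-time integrals -/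

section

variable {T : ℝ}

theorem lintegral_val_eq (g : SmoothPer T) {t : ℝ} (ht : t ∈ Ioo 0 T) (h0 : ∀ x, 0 ≤ g.val t x) :
    ∫⁻ x, ENNReal.ofReal (g.val t x) ∂torusMeasure = ENNReal.ofReal (g.integ t) :=
  (ofReal_integral_eq_lintegral_ofReal (g.integrable_val ht) (Eventually.of_forall h0)).symm

theorem SmoothPer.TBound.lintegral_le {g : SmoothPer T} {X : ℝ} (h : g.TBound X) (hT : 0 < T)
    (h0 : ∀ t x, 0 ≤ g.val t x) :
    ∫⁻ t in Ioo 0 T, ENNReal.ofReal (g.integ t) ≤ ENNReal.ofReal X :=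
  lintegral_ofReal_Ioo_le hT g.continuousOn_integ (fun t _ => SmoothPer.integ_nonneg (h0 t))
    fun _ _ h₀ h₁ h₂ => h h₀ h₁ h₂

/-- Any finite bound makes the full time integral finite, and that integral is then itself a bound.
This lets the actual dissipation replace a qualitative constant. -/
theorem SmoothPer.TBound.of_lintegral {g : SmoothPer T} {X : ℝ} (h : g.TBound X) (hT : 0 < T)
    (h0 : ∀ t x, 0 ≤ g.val t x) :
    g.TBound (∫⁻ t in Ioo 0 T, ENNReal.ofReal (g.integ t)).toReal := by
  have h0' : ∀ t ∈ Ioo 0 T, 0 ≤ g.integ t := fun t _ => SmoothPer.integ_nonneg (h0 t)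
  have hi := integrableOn_Ioo_of_bound hT g.continuousOn_integ h0' fun _ _ h₀ h₁ h₂ => h h₀ h₁ h₂
  intro t₀ t₁ h₀ h₁ h₂
  rw [← integral_eq_lintegral_of_nonneg_ae _ hi.aestronglyMeasurable]
  · exact intervalIntegral_le_setIntegral_Ioo hi h0' h₀ h₁ h₂
  · filter_upwards [ae_restrict_mem measurableSet_Ioo] with t ht using h0' t ht

variable {u : ℝ → E3 → E3} {a b : ℝ → E3 → ℝ} {ρin : E3 → ℝ} {ρ σ : ℝ → E3 → ℝ}

theorem IsSolution.dissipation_eq (h : IsSolution T u a ρin ρ) {α : SmoothPer T}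
    (hα : ∀ t ∈ Ioo 0 T, ∀ x, α.val t x = a t x) (h0 : ∀ t ∈ Ioo 0 T, ∀ x, 0 ≤ α.val t x) :
    dissipation T a ρ
      = ∫⁻ t in Ioo 0 T, ENNReal.ofReal ((α * SmoothPer.gradSq h.el).integ t) := by
  refine setLIntegral_congr_fun measurableSet_Ioo fun t ht => ?_
  have h1 : ∀ x, 0 ≤ (α * SmoothPer.gradSq h.el).val t x := fun x => by
    rw [SmoothPer.val_mul]
    exact mul_nonneg (h0 t ht x) (SmoothPer.val_gradSq_nonneg _ t x)
  rw [← lintegral_val_eq _ ht h1]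
  refine lintegral_congr fun x => ?_
  rw [SmoothPer.val_mul, ENNReal.ofReal_mul (h0 t ht x), hα t ht, h.val_gradSq ht,
    ENNReal.ofReal_pow (norm_nonneg _), ofReal_norm]

theorem IsSolution.gradDistSq_eq (h : IsSolution T u a ρin ρ) (h' : IsSolution T u b ρin σ) :
    gradDistSq T ρ σ
      = ∫⁻ t in Ioo 0 T, ENNReal.ofReal ((SmoothPer.gradSq (h.el - h'.el)).integ t) := by
  refine setLIntegral_congr_fun measurableSet_Ioo fun t ht => ?_
  rw [← lintegral_val_eq _ ht (SmoothPer.val_gradSq_nonneg _ t)]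
  refine lintegral_congr fun x => ?_
  rw [← ofReal_norm, ← ENNReal.ofReal_pow (norm_nonneg _), EuclideanSpace.real_norm_sq_eq,
    SmoothPer.val_gradSq]
  congr 1
  refine Finset.sum_congr rfl fun i _ => ?_
  rw [map_sub, SmoothPer.val_sub, SmoothPer.val_dx_of_eq ht (fun y => h.val_el ht y),
    SmoothPer.val_dx_of_eq ht (fun y => h'.val_el ht y), PiLp.sub_apply, gradient_apply,
    gradient_apply]

theorem IsSolution.tbound_dissipation (hT : 0 < T) (hu : IsVelocity T u)
    (h : IsSolution T u a ρin ρ) {α : SmoothPer T}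
    (hα : ∀ t ∈ Ioo 0 T, ∀ x, α.val t x = a t x) (h0 : ∀ t ∈ Ioo 0 T, ∀ x, 0 ≤ α.val t x) :
    dissipation T a ρ ≠ ⊤ ∧
      (α * SmoothPer.gradSq h.el).TBound (dissipation T a ρ).toReal := by
  obtain ⟨Y, hY⟩ := h.eventually_integ_sq_le hT
  have hb := (SmoothPer.energy_bounds hu.sum_dx_comp (h.matD_el hu hα) h0 hY).2.smul
    (by norm_num : (0 : ℝ) ≤ 1 / 2)
  rw [smul_smul, show (1 / 2 : ℝ) * 2 = 1 by norm_num, one_smul] at hb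
  have hg : ∀ t x, 0 ≤ (α * SmoothPer.gradSq h.el).val t x :=
    SmoothPer.val_nonneg_of_Ioo fun t ht x => by
      rw [SmoothPer.val_mul]
      exact mul_nonneg (h0 t ht x) (SmoothPer.val_gradSq_nonneg _ t x)
  rw [h.dissipation_eq hα h0]
  exact ⟨((hb.lintegral_le hT hg).trans_lt ENNReal.ofReal_lt_top).ne, hb.of_lintegral hT hg⟩

theorem IsSolution.dissipation_toReal_le (hT : 0 < T)
    (h : IsSolution T u a ρin ρ) {α : SmoothPer T}
    (hα : ∀ t ∈ Ioo 0 T, ∀ x, α.val t x = a t x) (h0 : ∀ t ∈ Ioo 0 T, ∀ x, 0 ≤ α.val t x)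
    {X : ℝ} (hX0 : 0 ≤ X) (hX : (α * SmoothPer.gradSq h.el).TBound X) :
    (dissipation T a ρ).toReal ≤ X := by
  rw [h.dissipation_eq hα h0]
  refine ENNReal.toReal_le_of_le_ofReal hX0 (hX.lintegral_le hT ?_)
  refine SmoothPer.val_nonneg_of_Ioo fun t ht x => ?_
  rw [SmoothPer.val_mul]
  exact mul_nonneg (h0 t ht x) (SmoothPer.val_gradSq_nonneg _ t x)

theorem IsSolution.gradDistSq_le (hT : 0 < T) (h : IsSolution T u a ρin ρ)
    (h' : IsSolution T u b ρin σ) {κ X : ℝ} (hκ : 0 < κ)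
    (hX : (κ • SmoothPer.gradSq (h.el - h'.el)).TBound X) :
    ENNReal.ofReal κ * gradDistSq T ρ σ ≤ ENNReal.ofReal X := by
  have h1 := hX.smul (inv_nonneg.2 hκ.le)
  rw [smul_smul, inv_mul_cancel₀ hκ.ne', one_smul] at h1
  rw [h.gradDistSq_eq h']
  refine (mul_le_mul_right (h1.lintegral_le hT (SmoothPer.val_gradSq_nonneg _)) _).trans ?_
  rw [← ENNReal.ofReal_mul hκ.le, mul_inv_cancel_left₀ hκ.ne']

theorem norm_iteratedFDeriv_le_cNorm {F : Type*} [NormedAddCommGroup F] [NormedSpace ℝ F]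
    {v : ℝ → E3 → F} {n : ℕ} {C : ℝ} (hC : 0 ≤ C) (h : cNorm T n v ^ 2 ≤ ENNReal.ofReal (C ^ 2))
    {t : ℝ} (ht : t ∈ Icc 0 T) (x : E3) : ‖iteratedFDeriv ℝ n (v t) x‖ ≤ C := by
  rw [ENNReal.ofReal_pow hC] at h
  have h1 := (ENNReal.pow_right_strictMono two_ne_zero).le_iff_le.1 h
  have h2 : ‖iteratedFDeriv ℝ n (v t) x‖ₑ ≤ cNorm T n v := by
    unfold cNorm
    refine le_trans ?_ (Finset.single_le_sum
      (f := fun j => ⨆ t ∈ Icc (0 : ℝ) T, ⨆ x : E3, ‖iteratedFDeriv ℝ j (v t) x‖ₑ)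
      (fun _ _ => zero_le) (Finset.self_mem_range_succ n))
    refine le_trans ?_ (le_iSup₂ (f := fun t (_ : t ∈ Icc (0 : ℝ) T) =>
      ⨆ x : E3, ‖iteratedFDeriv ℝ n (v t) x‖ₑ) t ht)
    exact le_iSup (fun x => ‖iteratedFDeriv ℝ n (v t) x‖ₑ) x
  have h3 := h2.trans h1
  rw [← ofReal_norm] at h3
  exact (ENNReal.ofReal_le_ofReal_iff hC).1 h3

end

end TimeAveraging

/-! ### Combining the estimates in normalized parameters -/

namespace TimeAveraging

section

variable {T κ₀ κ₁ τ ν K : ℝ} {u : ℝ → E3 → E3} {η : E3 → ℝ → ℝ → ℝ} {ρin : E3 → ℝ}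
  {ρ ρbar : ℝ → E3 → ℝ}

theorem val_oscDiff_osc (hη : IsProfile T η) {t : ℝ} (ht : t ∈ Ioo 0 T) (x : E3) :
    (SmoothPer.oscDiff κ₀ κ₁ (hη.osc τ)).val t x = oscDiffusivity κ₀ κ₁ τ η t x := by
  rw [SmoothPer.val_add, SmoothPer.val_mul, SmoothPer.val_algebraMap _ ht,
    SmoothPer.val_algebraMap _ ht, hη.val_osc τ ht, oscDiffusivity]

/-- The bound K - 1 on η, rather than K, is what makes the primitive at most 1 + (K - 1) = K. -/
theorem averaging (hκ₀ : 0 < κ₀) (hκ₁ : 0 < κ₁) (hτ : 0 < τ) (hK : 1 ≤ K) (hν : 0 ≤ ν)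
    (hu : IsVelocity T u) (hη : IsProfile T η)
    (hρ : IsSolution T u (oscDiffusivity κ₀ κ₁ τ η) ρin ρ)
    (hρbar : IsSolution T u (fun _ _ => κ₀ + κ₁) ρin ρbar)
    (hdu : ∀ t ∈ Icc (0 : ℝ) T, ∀ x, ‖fderiv ℝ (u t) x‖ ≤ (κ₀ + κ₁) * ν ^ 2)
    (hη0 : profileSup T 0 η ≤ ENNReal.ofReal (K - 1))
    (hη1 : profileSup T 1 η ≤ ENNReal.ofReal (K * ν))
    (hη2 : profileSup T 2 η ≤ ENNReal.ofReal (K * ν ^ 2))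
    (hslow : ∀ t ∈ Ioo (0 : ℝ) T, ∀ x s, |slowDeriv u η x t s| ≤ K * ((κ₀ + κ₁) * ν ^ 2)) :
    SmoothPer.Averaging T κ₀ κ₁ τ ν K hu.comp (hη.osc τ) (hη.corrector τ) hρbar.el
      (hρ.el - hρbar.el) := by
  have hM : ∀ t ∈ Ioo 0 T, ∀ x s, η x t s ≤ K - 1 := fun t ht x s => by
    have h := norm_iteratedFDeriv_le_of_profileSup (by linarith) hη0 ht s x
    rw [norm_iteratedFDeriv_zero] at h
    exact (le_abs_self _).trans h
  have h1 := fun {t : ℝ} (ht : t ∈ Ioo 0 T) =>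
    norm_iteratedFDeriv_le_of_profileSup (by positivity) hη1 ht
  have h2 := fun {t : ℝ} (ht : t ∈ Ioo 0 T) =>
    norm_iteratedFDeriv_le_of_profileSup (by positivity) hη2 ht
  have e1 := hρbar.matD_el hu (α := SmoothPer.cst (κ₀ + κ₁)) fun t ht x =>
    SmoothPer.val_algebraMap _ ht x
  have e2 := hρ.matD_el hu (α := SmoothPer.oscDiff κ₀ κ₁ (hη.osc τ)) fun t ht x =>
    val_oscDiff_osc hη ht x
  refine ⟨hκ₀, hκ₁, hτ, hK, hu.sum_dx_comp, e1, ?_, fun t ht x => ?_,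
    fun i t ht x => hη.abs_dx_osc_le τ ht (h1 ht) x i,
    fun i j t ht x => hη.abs_dx_dx_osc_le τ ht (h2 ht) x j i, fun t ht x => ?_,
    fun i t ht x => hη.abs_dx_corrector_le τ ht (h1 ht) x i,
    fun i j t ht x => hη.abs_dx_dx_corrector_le τ ht (h2 ht) x j i,
    fun t ht x => hη.matD_corrector hu τ ht (hslow t ht) x,
    fun i j t ht x => hu.abs_dx_comp_le j i ht (hdu t (Ioo_subset_Icc_self ht) x)⟩
  · rw [map_sub, e1, e2]
    simp only [SmoothPer.divGrad, map_sub, map_add, mul_sub, sub_mul, add_mul, mul_one,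
      Finset.sum_sub_distrib, Finset.sum_add_distrib]
    ring
  · rw [hη.val_osc τ ht]
    exact ⟨hη.nonneg t (Ioo_subset_Icc_self ht) x _, (hM t ht x _).trans (by linarith)⟩
  · obtain ⟨h3, h4⟩ := hη.corrector_bounds τ hM ht x
    exact ⟨h3, h4.trans (by linarith)⟩

/-- The averaging estimates in normalized parameters: `ν² = μ/κ`, and `K` bounds all data. -/
theorem averaging_estimates {N : ℕ} (hT : 0 < T) (hκ₀ : 0 < κ₀) (hκ₁ : 0 < κ₁) (hτ : 0 < τ)
    (hK : 1 ≤ K) (hν : 0 ≤ ν) (hu : IsVelocity T u) (hη : IsProfile T η)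
    (hρ : IsSolution T u (oscDiffusivity κ₀ κ₁ τ η) ρin ρ)
    (hρbar : IsSolution T u (fun _ _ => κ₀ + κ₁) ρin ρbar)
    (hdu : ∀ t ∈ Icc (0 : ℝ) T, ∀ x, ‖fderiv ℝ (u t) x‖ ≤ (κ₀ + κ₁) * ν ^ 2)
    (hddu : ∀ t ∈ Icc (0 : ℝ) T, ∀ x,
      ‖iteratedFDeriv ℝ 1 (fderiv ℝ (u t)) x‖ ≤ K * (κ₀ + κ₁) * ν ^ 3)
    (hη0 : profileSup T 0 η ≤ ENNReal.ofReal (K - 1))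
    (hη1 : profileSup T 1 η ≤ ENNReal.ofReal (K * ν))
    (hη2 : profileSup T 2 η ≤ ENNReal.ofReal (K * ν ^ 2))
    (hslow : ∀ t ∈ Ioo (0 : ℝ) T, ∀ x s, |slowDeriv u η x t s| ≤ K * ((κ₀ + κ₁) * ν ^ 2))
    (hS₁ : sobolevSq 1 ρin
      ≤ ENNReal.ofReal (K * ν ^ 2) * dissipation T (fun _ _ => κ₀ + κ₁) ρbar)
    (hS₂ : sobolevSq 2 ρin
      ≤ ENNReal.ofReal (K * ν ^ 4) * dissipation T (fun _ _ => κ₀ + κ₁) ρbar)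
    {ε : ℝ} (hε : ε = τ * (κ₀ + κ₁) * ν ^ 2) (hε1 : ε < 1 / 2)
    (hcoer : ε ^ (N - 1) * (κ₀ + κ₁) < κ₀) {C : ℝ}
    (hC : C = 240000 * K ^ 4 * (115 * K ^ 2)
      + K * (20 * (115 * K ^ 2) + 2 * (80000 * K ^ 4 * (115 * K ^ 2)))
      + 3 * K ^ 2 * ((100 * K ^ 2) ^ (N - 1)) ^ 2 * (100 * K ^ 2) ^ 2 + 100 * K ^ 2) :
    dissipation T (fun _ _ => κ₀ + κ₁) ρbar ≠ ⊤ ∧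
    dissipation T (oscDiffusivity κ₀ κ₁ τ η) ρ ≠ ⊤ ∧
    (⨆ t ∈ Icc (0 : ℝ) T, l2Sq (fun x => ρ t x - ρbar t x))
        + ENNReal.ofReal (κ₀ + κ₁) * gradDistSq T ρ ρbar
      ≤ ENNReal.ofReal (C * ε ^ 2) * dissipation T (fun _ _ => κ₀ + κ₁) ρbar ∧
    |(dissipation T (fun _ _ => κ₀ + κ₁) ρbar).toReal
        - (dissipation T (oscDiffusivity κ₀ κ₁ τ η) ρ).toReal|
      ≤ C * ε * ((dissipation T (fun _ _ => κ₀ + κ₁) ρbar).toReal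
          + (dissipation T (oscDiffusivity κ₀ κ₁ τ η) ρ).toReal) := by
  have h := averaging hκ₀ hκ₁ hτ hK hν hu hη hρ hρbar hdu hη0 hη1 hη2 hslow
  have hκ := h.pos
  have hα : ∀ t ∈ Ioo 0 T, ∀ x : E3, (SmoothPer.cst (κ₀ + κ₁) : SmoothPer T).val t x = κ₀ + κ₁ :=
    fun t ht x => SmoothPer.val_algebraMap _ ht x
  have hα0 : ∀ t ∈ Ioo 0 T, ∀ x : E3, 0 ≤ (SmoothPer.cst (κ₀ + κ₁) : SmoothPer T).val t x :=
    fun t ht x => by rw [hα t ht x]; exact hκ.le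
  have hβ : ∀ t ∈ Ioo 0 T, ∀ x, (SmoothPer.oscDiff κ₀ κ₁ (hη.osc τ)).val t x
      = oscDiffusivity κ₀ κ₁ τ η t x := fun t ht x => val_oscDiff_osc hη ht x
  have hβ0 : ∀ t ∈ Ioo 0 T, ∀ x, 0 ≤ (SmoothPer.oscDiff κ₀ κ₁ (hη.osc τ)).val t x :=
    fun t ht x => hκ₀.le.trans (h.oscDiff_mem ht x).1
  obtain ⟨hfin, hD⟩ := hρbar.tbound_dissipation hT hu hα hα0
  obtain ⟨hfin', hD'⟩ := hρ.tbound_dissipation hT hu hβ hβ0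
  refine ⟨hfin, hfin', ?_⟩
  rw [← ENNReal.ofReal_toReal hfin] at hS₁ hS₂
  rw [← Algebra.smul_def] at hD
  have hbarX := fun X hX0 hX => hρbar.dissipation_toReal_le hT hα hα0 (X := X) hX0 hX
  have hoscX := fun X hX0 hX => hρ.dissipation_toReal_le hT hβ hβ0 (X := X) hX0 hX
  rw [← Algebra.smul_def] at hbarX
  rw [← ENNReal.ofReal_toReal hfin]
  generalize hDd : (dissipation T (fun _ _ => κ₀ + κ₁) ρbar).toReal = D at *
  generalize hDd' : (dissipation T (oscDiffusivity κ₀ κ₁ τ η) ρ).toReal = D' at *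
  have hD0 : 0 ≤ D := by rw [← hDd]; exact ENNReal.toReal_nonneg
  have hD0' : 0 ≤ D' := by rw [← hDd']; exact ENNReal.toReal_nonneg
  rw [ENNReal.toReal_ofReal hD0]
  have hε0 : 0 ≤ ε := by rw [hε]; positivity
  have hlim := hρ.tendsto_integ_sub_sq hT hρbar
  -- The factor 3 is 2 for the supremum up to the endpoints and 1 for the gradient.
  have hdist : ∀ X, 0 ≤ X → (∀ t ∈ Ioo 0 T, ((hρ.el - hρbar.el) ^ 2).integ t ≤ X) →
      ((κ₀ + κ₁) • SmoothPer.gradSq (hρ.el - hρbar.el)).TBound X → 3 * X ≤ C * ε ^ 2 * D →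
      (⨆ t ∈ Icc (0 : ℝ) T, l2Sq (fun x => ρ t x - ρbar t x))
        + ENNReal.ofReal (κ₀ + κ₁) * gradDistSq T ρ ρbar
      ≤ ENNReal.ofReal (C * ε ^ 2) * ENNReal.ofReal D := by
    intro X hX0 h1 h2 h3
    have e1 : (⨆ t ∈ Icc (0 : ℝ) T, l2Sq (fun x => ρ t x - ρbar t x)) ≤ ENNReal.ofReal (2 * X) :=
      iSup₂_le fun t ht => hρ.l2Sq_sub_le hT hρbar h1 ht
    refine (add_le_add e1 (hρ.gradDistSq_le hT hρbar hκ h2)).trans ?_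
    rw [← ENNReal.ofReal_add (by positivity) hX0, ← ENNReal.ofReal_mul (by rw [hC]; positivity)]
    exact ENNReal.ofReal_le_ofReal (by linarith)
  set L := 115 * K ^ 2 with hL
  set B := (100 * K ^ 2) ^ (N - 1) with hB
  have hL1 : 1 ≤ L := by nlinarith
  have hBpos : 0 < B := by positivity
  -- Small ε allows the averaging argument. Otherwise ε is bounded below in terms of K, so bounds
  -- without any power of ε suffice.
  by_cases hsmall : 100 * K ^ 2 * ε ≤ 1
  · obtain ⟨U, hU⟩ := hu.exists_bound
    obtain ⟨Y, hY⟩ := hρbar.eventually_integ_sq_le hT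
    rw [← ENNReal.ofReal_mul (by positivity)] at hS₁ hS₂
    obtain ⟨⟨g1, g2⟩, G2, G3⟩ := SmoothPer.regularity hT hu.sum_dx_comp hκ hK
      (fun j t ht x => by
        rw [hu.val_comp j ht]
        exact (abs_coord_le _ j).trans (hU t (Ioo_subset_Icc_self ht) x))
      (fun i j t ht x => hu.abs_dx_comp_le j i ht (hdu t (Ioo_subset_Icc_self ht) x))
      (fun i j k t ht x => hu.abs_dx_dx_comp_le k j i ht (hddu t (Ioo_subset_Icc_self ht) x))
      h.eq_avg (hρbar.tendsto_coefSq hT) hY hD0 hD hS₁ hS₂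
    rw [← hL] at g1 g2 G2 G3
    obtain ⟨hw, hW⟩ := h.diff_bounds hT (by rw [← hε]; exact hsmall) hL1 hD0 hlim g1 g2 hD G2 G3
    rw [← hε] at hw hW
    refine ⟨hdist _ (by positivity) hw hW ?_, ?_⟩
    · have e1 : 3 * (80000 * K ^ 4 * L) ≤ C := by
        have : 0 ≤ K * (20 * L + 2 * (80000 * K ^ 4 * L)) + 3 * K ^ 2 * B ^ 2 * (100 * K ^ 2) ^ 2
          + 100 * K ^ 2 := by positivity
        linarith
      have e2 := mul_le_mul_of_nonneg_right e1 (by positivity : 0 ≤ ε ^ 2 * D)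
      linarith
    · set P := K * (20 * L + 2 * (80000 * K ^ 4 * L)) with hP
      have hP0 : 0 ≤ P := by positivity
      -- The bound on compact subintervals is passed to the full integrals in both directions, and
      -- then δ decreases to ε.
      have hδ : ∀ δ, ε < δ → δ ≤ 1 → |D - D'| ≤ P * (δ * D) := by
        intro δ hδ hδ1
        have hδ0 : 0 ≤ δ := hε0.trans hδ.le
        have key := fun {t₀ t₁ : ℝ} => h.abs_tinteg_dissipation_sub_le hL1 hD0
          (C₀ := 80000 * K ^ 4 * L) (by positivity) g1 hD G2 (by rw [← hε]; exact hW)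
          (by rw [← hε]; exact hδ) hδ1 (t₀ := t₀) (t₁ := t₁)
        rw [add_sub_cancel] at key
        have hle1 := hbarX (D' + P * (δ * D)) (by positivity) fun t₀ t₁ h₀ h₁ h₂ => by
          linarith [(abs_le.1 (key h₀ h₁ h₂)).1, hD' h₀ h₁ h₂]
        have hle2 := hoscX (D + P * (δ * D)) (by positivity) fun t₀ t₁ h₀ h₁ h₂ => by
          linarith [(abs_le.1 (key h₀ h₁ h₂)).2, hD h₀ h₁ h₂]
        rw [abs_le]
        constructor <;> linarith
      have hlimδ : Tendsto (fun δ : ℝ => P * (δ * D)) (𝓝[>] ε) (𝓝 (P * (ε * D))) :=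
        (Continuous.tendsto (by fun_prop) ε).mono_left nhdsWithin_le_nhds
      have hfinal : |D - D'| ≤ P * (ε * D) := by
        refine ge_of_tendsto hlimδ ?_
        filter_upwards [Ioc_mem_nhdsGT (by linarith : ε < 1)] with δ hδ' using hδ δ hδ'.1 hδ'.2
      have e1 : P ≤ C := by
        have : 0 ≤ 240000 * K ^ 4 * L + 3 * K ^ 2 * B ^ 2 * (100 * K ^ 2) ^ 2
          + 100 * K ^ 2 := by positivity
        linarith
      have e2 := mul_le_mul_of_nonneg_right e1 (by positivity : 0 ≤ ε * D)
      have e3 : 0 ≤ C * (ε * D') := mul_nonneg (hP0.trans e1) (by positivity)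
      linarith
  · have hbig : 1 ≤ 100 * K ^ 2 * ε := (not_le.1 hsmall).le
    -- From ε ≥ 1/(100K²) and ε^(N-1)κ < κ₀. This is the only place where the coercivity assumption
    -- is needed quantitatively.
    have hratio : (κ₀ + κ₁) / κ₀ ≤ B := by
      rw [div_le_iff₀ hκ₀]
      have e1 : 1 ≤ B * ε ^ (N - 1) := by
        rw [hB, ← mul_pow]
        exact one_le_pow₀ hbig
      have e2 := mul_le_mul_of_nonneg_left hcoer.le hBpos.le
      have e3 := mul_le_mul_of_nonneg_right e1 hκ.le
      linarith
    have hr1 : 1 ≤ (κ₀ + κ₁) / κ₀ := by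
      rw [one_le_div hκ₀]
      linarith
    obtain ⟨hw, hW⟩ := h.diff_bounds_crude hlim hD
    have hB1 : 1 ≤ B := hr1.trans hratio
    have hc : K ^ 2 * (κ₀ + κ₁) / κ₀ * D ≤ K ^ 2 * B * D := by
      rw [mul_div_assoc]
      gcongr
    have hc2 : K ^ 2 * B * D ≤ K ^ 2 * B ^ 2 * D := by
      have : B ≤ B ^ 2 := by nlinarith
      gcongr
    have hW' := hW.smul (by positivity : 0 ≤ (κ₀ + κ₁) / κ₀)
    rw [smul_smul, div_mul_cancel₀ _ hκ₀.ne'] at hW'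
    have hc3 : (κ₀ + κ₁) / κ₀ * (K ^ 2 * (κ₀ + κ₁) / κ₀ * D) ≤ K ^ 2 * B ^ 2 * D := by
      have e1 := mul_le_mul hratio hc (by positivity) hBpos.le
      linarith
    refine ⟨hdist (K ^ 2 * B ^ 2 * D) (by positivity)
      (fun t ht => (hw t ht).trans (hc.trans hc2)) (hW'.le hc3) ?_, ?_⟩
    · have e1 : 3 * K ^ 2 * B ^ 2 * (100 * K ^ 2) ^ 2 ≤ C := by
        have : 0 ≤ 240000 * K ^ 4 * L + K * (20 * L + 2 * (80000 * K ^ 4 * L))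
          + 100 * K ^ 2 := by positivity
        linarith
      have e2 := mul_le_mul_of_nonneg_right e1 (by positivity : 0 ≤ ε ^ 2 * D)
      have e3 : 1 ≤ (100 * K ^ 2 * ε) ^ 2 := one_le_pow₀ hbig
      have e4 := mul_le_mul_of_nonneg_left e3 (by positivity : 0 ≤ 3 * (K ^ 2 * B ^ 2 * D))
      linarith
    · have e1 : 100 * K ^ 2 ≤ C := by
        have : 0 ≤ 240000 * K ^ 4 * L + K * (20 * L + 2 * (80000 * K ^ 4 * L))
          + 3 * K ^ 2 * B ^ 2 * (100 * K ^ 2) ^ 2 := by positivity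
        linarith
      -- Both dissipations are nonnegative, so their difference is at most their sum and Cε ≥ 1 is
      -- enough.
      have e2 : 1 ≤ C * ε := hbig.trans (mul_le_mul_of_nonneg_right e1 hε0)
      have e3 := mul_le_mul_of_nonneg_right e2 (add_nonneg hD0 hD0')
      rw [abs_le]
      constructor <;> linarith

end

end TimeAveraging

end

/-! ### The theorem in the original parameters -/

open TimeAveraging in
theorem proposition6p1 (N : ℕ) (CN M : ℝ) :
    ∃ C : ℝ, 0 < C ∧
      ∀ (T κ₀ κ₁ τ μ : ℝ) (u : ℝ → E3 → E3) (η : E3 → ℝ → ℝ → ℝ)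
        (ρin : E3 → ℝ) (ρ ρbar : ℝ → E3 → ℝ),
        0 < T → 0 < κ₀ → κ₀ < κ₁ → 0 < τ →
        IsVelocity T u → IsProfile T η →
        profileSup T 0 η ≤ ENNReal.ofReal M →
        IsSolution T u (oscDiffusivity κ₀ κ₁ τ η) ρin ρ →
        IsSolution T u (fun _ _ => κ₀ + κ₁) ρin ρbar →
        (∀ t ∈ Set.Icc (0 : ℝ) T, ∀ x, ‖fderiv ℝ (u t) x‖ ≤ μ) →
        -- (A1)
        τ * μ < 1 / 2 →
        (τ * μ) ^ (N - 1) * (κ₀ + κ₁) < κ₀ →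
        -- (A2)
        (∀ n ≤ N, cNorm T n (fun t => fderiv ℝ (u t)) ^ 2
          ≤ ENNReal.ofReal (CN * (μ / (κ₀ + κ₁)) ^ n * μ ^ 2)) →
        -- (A3)
        (∀ n, 1 ≤ n → n ≤ N → sobolevSq n ρin
          ≤ ENNReal.ofReal (CN * (μ / (κ₀ + κ₁)) ^ n)
            * dissipation T (fun _ _ => κ₀ + κ₁) ρbar) →
        -- (A4)
        (∀ n, 1 ≤ n → n ≤ N → profileSup T n η
          ≤ ENNReal.ofReal (CN * (τ * μ) ^ 2 * (μ / (κ₀ + κ₁)) ^ ((n : ℝ) / 2))) →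
        (∀ t ∈ Set.Ioo (0 : ℝ) T, ∀ x s, |slowDeriv u η x t s| ≤ CN * μ) →
        -- both dissipations are finite, and the two estimates hold
        dissipation T (fun _ _ => κ₀ + κ₁) ρbar ≠ ⊤ ∧
        dissipation T (oscDiffusivity κ₀ κ₁ τ η) ρ ≠ ⊤ ∧
        (⨆ t ∈ Set.Icc (0 : ℝ) T, l2Sq (fun x => ρ t x - ρbar t x))
            + ENNReal.ofReal (κ₀ + κ₁) * gradDistSq T ρ ρbar
          ≤ ENNReal.ofReal (C * (τ * μ) ^ 2)
            * dissipation T (fun _ _ => κ₀ + κ₁) ρbar ∧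
        |(dissipation T (fun _ _ => κ₀ + κ₁) ρbar).toReal
            - (dissipation T (oscDiffusivity κ₀ κ₁ τ η) ρ).toReal|
          ≤ C * (τ * μ)
            * ((dissipation T (fun _ _ => κ₀ + κ₁) ρbar).toReal
              + (dissipation T (oscDiffusivity κ₀ κ₁ τ η) ρ).toReal) := by
  -- One constant K ≥ 1 dominates all the data; absolute values are needed because `CN` and `M` are
  -- arbitrary reals.
  set K : ℝ := 1 + |CN| + |M| with hK
  have hCN := abs_nonneg CN
  have hM := abs_nonneg M
  have hK1 : 1 ≤ K := by linarith
  have hCNK : CN ≤ K := by linarith [le_abs_self CN]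
  refine ⟨240000 * K ^ 4 * (115 * K ^ 2)
      + K * (20 * (115 * K ^ 2) + 2 * (80000 * K ^ 4 * (115 * K ^ 2)))
      + 3 * K ^ 2 * ((100 * K ^ 2) ^ (N - 1)) ^ 2 * (100 * K ^ 2) ^ 2 + 100 * K ^ 2,
    by positivity, ?_⟩
  intro T κ₀ κ₁ τ μ u η ρin ρ ρbar hT hκ₀ hκ₀₁ hτ hu hη hη0 hρ hρbar hdu hτμ hcoer hA2 hA3 hA4
    hslow
  have hκ₁ : 0 < κ₁ := hκ₀.trans hκ₀₁
  have hκ : 0 < κ₀ + κ₁ := add_pos hκ₀ hκ₁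
  have hμ : 0 ≤ μ := (norm_nonneg _).trans (hdu 0 ⟨le_rfl, hT.le⟩ 0)
  -- For N ≤ 1 the truncated exponent N - 1 is 0, and (A1) would read κ < κ₀. Hence two derivatives
  -- are always available, and no more are used.
  have hN : 2 ≤ N := by
    by_contra hlt
    rw [show N - 1 = 0 by omega, pow_zero, one_mul] at hcoer
    linarith
  set ν : ℝ := √(μ / (κ₀ + κ₁)) with hν
  have hν0 : 0 ≤ ν := Real.sqrt_nonneg _
  have hν2 : μ / (κ₀ + κ₁) = ν ^ 2 := (Real.sq_sqrt (by positivity)).symm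
  have hμν : (κ₀ + κ₁) * ν ^ 2 = μ := by rw [← hν2]; field_simp
  have hpow : ∀ n : ℕ, (μ / (κ₀ + κ₁)) ^ ((n : ℝ) / 2) = ν ^ n := fun n => by
    rw [hν, Real.sqrt_eq_rpow, ← Real.rpow_natCast, ← Real.rpow_mul (by positivity)]
    congr 1
    ring
  have hε0 : 0 ≤ τ * μ := by positivity
  have hprof : ∀ n, 1 ≤ n → n ≤ N → profileSup T n η ≤ ENNReal.ofReal (K * ν ^ n) :=
    fun n h1 h2 => (hA4 n h1 h2).trans <| ENNReal.ofReal_le_ofReal <| by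
      rw [hpow]
      refine mul_le_mul_of_nonneg_right ?_ (by positivity)
      have e1 : (τ * μ) ^ 2 ≤ 1 := by nlinarith
      have e2 := mul_le_mul_of_nonneg_right hCNK (sq_nonneg (τ * μ))
      nlinarith
  have hinit : ∀ n, 1 ≤ n → n ≤ N → sobolevSq n ρin ≤ ENNReal.ofReal (K * ν ^ (2 * n))
      * dissipation T (fun _ _ => κ₀ + κ₁) ρbar := fun n h1 h2 => by
    refine (hA3 n h1 h2).trans (mul_le_mul_left (ENNReal.ofReal_le_ofReal ?_) _)
    rw [hν2, ← pow_mul]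
    exact mul_le_mul_of_nonneg_right hCNK (by positivity)
  refine averaging_estimates hT hκ₀ hκ₁ hτ hK1 hν0 hu hη hρ hρbar (fun t ht x => ?_)
    (fun t ht x => ?_) ?_ ?_ (hprof 2 (by norm_num) hN) (fun t ht x s => ?_) (hinit 1 le_rfl (by omega))
    (hinit 2 (by norm_num) hN) ?_ hτμ hcoer rfl
  · rw [hμν]; exact hdu t ht x
  · refine norm_iteratedFDeriv_le_cNorm (v := fun t => fderiv ℝ (u t)) (by positivity)
      ((hA2 1 (by omega)).trans (ENNReal.ofReal_le_ofReal ?_)) ht x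
    rw [pow_one, hν2, ← hμν]
    -- (A2) bounds the square of the norm, so its constant is compared with K².
    have e1 : CN ≤ K ^ 2 := by nlinarith
    have e2 := mul_le_mul_of_nonneg_right e1
      (by positivity : 0 ≤ ν ^ 2 * ((κ₀ + κ₁) * ν ^ 2) ^ 2)
    linarith
  · exact hη0.trans (ENNReal.ofReal_le_ofReal (by linarith [le_abs_self M]))
  · simpa using hprof 1 le_rfl (by omega)
  · rw [hμν]
    exact (hslow t ht x s).trans (mul_le_mul_of_nonneg_right hCNK hμ)
  · rw [mul_assoc, hμν]
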